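/- Let $0<\alpha<1$. There is a constant $c>0$, depending only on $\alpha$, such that the following holds. Let $\Omega\subset\mathbb R^d$ ($d\in\{1,2,3\}$) be a bounded convex polygonal domain, $\mathcal T_h$ a conforming triangulation of $\Omega$ into $d$-simplexes, $X_h\subset H_0^1(\Omega)$ the space of functions in $H^1_0(\Omega)$ that are affine on each simplex of $\mathcal T_h$, $P_h:L^2(\Omega)\to X_h$ the $L^2(\Omega)$-orthogonal projection, and $\Delta_h:X_h\to X_h$ the discrete Laplacian, $-(\Delta_h\varphi,\chi)=(\nabla\varphi,\nabla\chi)$ for all $\varphi,\chi\in X_h$. Write $\|\cdot\|$ for the norm of $L^2(\Omega)$. Let $T>0$ and let $f\in W^{1,\infty}(0,T;L^2(\Omega))$ have a second weak derivative $f''$, a locally integrable function from $(0,T)$ to $L^2(\Omega)$, such that $$t\mapsto\int_0^t (t-s)^{\alpha-1}\|f''(s)\|\,ds\in L^\infty(0,T).$$ (Then $f$ and $f'$ have continuous representatives on $[0,T]$, and point values of $f$ and $f'$ refer to these.) Let $u_h:[0,T]\to X_h$ be the solution of the semidiscrete problem with zero initial value, $$\partial_t^\alpha u_h(t)-\Delta_h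 u_h(t)=P_hf(t)\quad (0<t<T),\qquad u_h(0)=0,$$ where $\partial_t^\alpha u(t)=\frac1{\Gamma(1-\alpha)}\int_0^t(t-s)^{-\alpha}u'(s)\,ds$ is the Caputo derivative; that is, $u_h$ is absolutely continuous on $[0,T]$ and satisfies the equation for almost every $t$. Let $N\ge 1$, $\tau=T/N$, $t_n=n\tau$, $F_h^n=P_hf(t_n)$, and $\bar\partial_\tau^\alpha\varphi^n=\tau^{-\alpha}\sum_{j=0}^n b_{n-j}\varphi^j$ with $\sum_{j\ge0} b_j\xi^j=(1-\xi)^\alpha$. Let $U_h^0=0$ and let $U_h^1,\dots,U_h^N\in X_h$ solve the corrected fractional Crank--Nicolson scheme $$\begin{aligned} \bar\partial_\tau^\alpha U_h^1-(1-\tfrac\alpha2)\Delta_hU_h^1&=(1-\tfrac\alpha2)\big(F_h^1+\tfrac12F_h^0\big),\\ \bar\partial_\tau^\alpha U_h^2-(1-\tfrac\alpha2)\Delta_hU_h^2-\tfrac\alpha2\Delta_hU_h^1&=(1-\tfrac\alpha2)F_h^2+\tfrac\alpha2F_h^1+\tfrac\alpha4F_h^0,\\ \bar\partial_\tau^\alpha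 U_h^n-(1-\tfrac\alpha2)\Delta_hU_h^n-\tfrac\alpha2\Delta_hU_h^{n-1}&=(1-\tfrac\alpha2)F_h^n+\tfrac\alpha2F_h^{n-1},\qquad 3\le n\le N \end{aligned}$$ (the second equation is imposed if $N\ge2$). Then for every $1\le n\le N$ the integral below is finite and $$\|u_h(t_n)-U_h^n\|\le c\,\tau^2\Big(t_n^{\alpha-2}\|f(0)\|+t_n^{\alpha-1}\|f'(0)\|+\int_0^{t_n}(t_n-s)^{\alpha-1}\|f''(s)\|\,ds\Big).$$ -/

import Mathlib

open MeasureTheory Set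
open scoped ENNReal ContDiff InnerProductSpace Gradient

namespace FracCN

/-! ## The domain, `L²(Ω)`, and `H¹₀(Ω)` -/

/-- `ℝᵈ` with the Euclidean norm. -/
abbrev Space (d : ℕ) : Type := EuclideanSpace ℝ (Fin d)

/-- A bounded convex polygonal (polyhedral) domain: the nonempty interior of the convex hull of
finitely many points. -/
def IsConvexPolygonalDomain {d : ℕ} (Ω : Set (Space d)) : Prop :=
  Ω.Nonempty ∧ ∃ S : Finset (Space d), Ω = interior (convexHull ℝ (S : Set (Space d)))

/-- The Hilbert space `L²(Ω)`. -/
abbrev L2 {d : ℕ} (Ω : Set (Space d)) : Type :=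
  Lp ℝ 2 (volume.restrict Ω)

/-- The Hilbert space `L²(Ω; ℝᵈ)` of square integrable vector fields. -/
abbrev L2Vec {d : ℕ} (Ω : Set (Space d)) : Type :=
  Lp (Space d) 2 (volume.restrict Ω)

/-- The graph of the classical gradient on the test functions `C_c^∞(Ω)`, in
`L²(Ω) × L²(Ω; ℝᵈ)`. -/
noncomputable def testGraph {d : ℕ} (Ω : Set (Space d)) : Submodule ℝ (L2 Ω × L2Vec Ω) where
  carrier := {p | ∃ φ : Space d → ℝ, ContDiff ℝ ∞ φ ∧ HasCompactSupport φ ∧ tsupport φ ⊆ Ω ∧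
    p.1 =ᵐ[volume.restrict Ω] φ ∧ p.2 =ᵐ[volume.restrict Ω] ∇ φ}
  add_mem' := by
    rintro p q ⟨φ, hφ, hφc, hφs, hp, hp'⟩ ⟨ψ, hψ, hψc, hψs, hq, hq'⟩
    refine ⟨φ + ψ, hφ.add hψ, hφc.add hψc, (tsupport_add φ ψ).trans (union_subset hφs hψs), ?_, ?_⟩
    · exact (Lp.coeFn_add _ _).trans (hp.add hq)
    · refine (Lp.coeFn_add _ _).trans ((hp'.add hq').trans (Filter.Eventually.of_forall ?_))
      intro x
      have h1 : DifferentiableAt ℝ φ x := (hφ.differentiable (by simp)) x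
      have h2 : DifferentiableAt ℝ ψ x := (hψ.differentiable (by simp)) x
      simp [gradient, fderiv_add h1 h2]
  zero_mem' := by
    refine ⟨0, contDiff_const, HasCompactSupport.zero, by simp [tsupport], ?_, ?_⟩
    · exact Lp.coeFn_zero _ _ _
    · refine (Lp.coeFn_zero _ _ _).trans (Filter.Eventually.of_forall ?_)
      intro x
      simp [gradient]
  smul_mem' := by
    rintro c p ⟨φ, hφ, hφc, hφs, hp, hp'⟩
    refine ⟨c • φ, contDiff_const.smul hφ, hφc.smul_left (f := fun _ => c), ?_, ?_, ?_⟩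
    · exact (closure_mono (Function.support_const_smul_subset c φ)).trans hφs
    · exact (Lp.coeFn_smul _ _).trans (hp.const_smul c)
    · refine (Lp.coeFn_smul _ _).trans ((hp'.const_smul c).trans (Filter.Eventually.of_forall ?_))
      intro x
      have h1 : DifferentiableAt ℝ φ x := (hφ.differentiable (by simp)) x
      simp [gradient, fderiv_const_smul h1]

/-- The closure of `{(φ, ∇φ) : φ ∈ C_c^∞(Ω)}` in `L²(Ω) × L²(Ω; ℝᵈ)`, that is
`{(v, ∇v) : v ∈ H¹₀(Ω)}`. -/
noncomputable def h10Graph {d : ℕ} (Ω : Set (Space d)) : Submodule ℝ (L2 Ω × L2Vec Ω) :=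
  (testGraph Ω).topologicalClosure

/-- The weak gradient on `H¹₀(Ω)`, as an unbounded operator `L²(Ω) → L²(Ω; ℝᵈ)`. Its domain is the
Sobolev space `H¹₀(Ω)`, the set of first components of `h10Graph Ω`. -/
noncomputable def weakGradient {d : ℕ} (Ω : Set (Space d)) : L2 Ω →ₗ.[ℝ] L2Vec Ω :=
  (h10Graph Ω).toLinearPMap

/-- The Sobolev space `H¹₀(Ω)`. -/
noncomputable def H10 {d : ℕ} (Ω : Set (Space d)) : Submodule ℝ (L2 Ω) :=
  (weakGradient Ω).domain

/-- Integration by parts against a smooth function: the pairs in `h10Graph Ω` consist of a function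
and its weak gradient. -/
theorem h10Graph_integration_by_parts {d : ℕ} {Ω : Set (Space d)} {p : L2 Ω × L2Vec Ω}
    (hp : p ∈ h10Graph Ω) {ψ : Space d → ℝ} (hψ : ContDiff ℝ ∞ ψ) (hψc : HasCompactSupport ψ)
    (v : Space d) :
    ∫ x in Ω, ψ x * ⟪p.2 x, v⟫_ℝ = - ∫ x in Ω, fderiv ℝ ψ x v * p.1 x := by
  have hψ' : Continuous fun x => fderiv ℝ ψ x v :=
    (hψ.continuous_fderiv (by simp)).clm_apply continuous_const
  have hψc' : HasCompactSupport fun x => fderiv ℝ ψ x v := hψc.fderiv_apply (𝕜 := ℝ) v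
  have hv : Continuous fun x => ψ x • v := hψ.continuous.smul continuous_const
  have hvc : HasCompactSupport fun x => ψ x • v := hψc.smul_right
  have m1 : MemLp (fun x => fderiv ℝ ψ x v) 2 (volume.restrict Ω) :=
    (hψ'.memLp_of_hasCompactSupport hψc')
  have m2 : MemLp (fun x => ψ x • v) 2 (volume.restrict Ω) :=
    (hv.memLp_of_hasCompactSupport hvc)
  have e1 : ∀ q : L2 Ω × L2Vec Ω,
      ⟪m2.toLp, q.2⟫_ℝ = ∫ x in Ω, ψ x * ⟪q.2 x, v⟫_ℝ := by
    intro q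
    rw [L2.inner_def]
    refine integral_congr_ae ?_
    filter_upwards [m2.coeFn_toLp] with x hx
    rw [hx, real_inner_smul_left, real_inner_comm]
  have e2 : ∀ q : L2 Ω × L2Vec Ω,
      ⟪m1.toLp, q.1⟫_ℝ = ∫ x in Ω, fderiv ℝ ψ x v * q.1 x := by
    intro q
    rw [L2.inner_def]
    refine integral_congr_ae ?_
    filter_upwards [m1.coeFn_toLp] with x hx
    rw [hx]
    simp [mul_comm]
  have hcl : IsClosed {q : L2 Ω × L2Vec Ω | ⟪m2.toLp, q.2⟫_ℝ = - ⟪m1.toLp, q.1⟫_ℝ} :=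
    isClosed_eq (by fun_prop) (by fun_prop)
  have hsub : (testGraph Ω : Set (L2 Ω × L2Vec Ω)) ⊆
      {q | ⟪m2.toLp, q.2⟫_ℝ = - ⟪m1.toLp, q.1⟫_ℝ} := by
    rintro q ⟨φ, hφ, hφc, hφs, hq, hq'⟩
    have hφ' : Continuous fun x => fderiv ℝ φ x v :=
      (hφ.continuous_fderiv (by simp)).clm_apply continuous_const
    have hz : ∀ x, x ∉ Ω → φ x = 0 := fun x hx =>
      image_eq_zero_of_notMem_tsupport fun h => hx (hφs h)
    have hz' : ∀ x, x ∉ Ω → fderiv ℝ φ x = 0 := fun x hx =>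
      image_eq_zero_of_notMem_tsupport fun h => hx (hφs (tsupport_fderiv_subset ℝ h))
    have i1 : ∫ x in Ω, ψ x * ⟪q.2 x, v⟫_ℝ = ∫ x, ψ x * fderiv ℝ φ x v := by
      rw [← setIntegral_eq_integral_of_forall_compl_eq_zero (s := Ω)
        (f := fun x => ψ x * fderiv ℝ φ x v) (fun x hx => by simp [hz' x hx])]
      refine integral_congr_ae ?_
      filter_upwards [hq'] with x hx
      rw [hx]
      simp [gradient]
    have i2 : ∫ x in Ω, fderiv ℝ ψ x v * q.1 x = ∫ x, fderiv ℝ ψ x v * φ x := by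
      rw [← setIntegral_eq_integral_of_forall_compl_eq_zero (s := Ω)
        (f := fun x => fderiv ℝ ψ x v * φ x) (fun x hx => by simp [hz x hx])]
      refine integral_congr_ae ?_
      filter_upwards [hq] with x hx
      rw [hx]
    change ⟪m2.toLp, q.2⟫_ℝ = - ⟪m1.toLp, q.1⟫_ℝ
    rw [e1, e2, i1, i2]
    refine integral_mul_fderiv_eq_neg_fderiv_mul_of_integrable ?_ ?_ ?_
      (fun x _ => hψ.differentiable (by simp) x) (fun x _ => hφ.differentiable (by simp) x)
    · exact (hψ'.mul hφ.continuous).integrable_of_hasCompactSupport hψc'.mul_right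
    · exact (hψ.continuous.mul hφ').integrable_of_hasCompactSupport hψc.mul_right
    · exact (hψ.continuous.mul hφ.continuous).integrable_of_hasCompactSupport hψc.mul_right
  have := closure_minimal hsub hcl hp
  rw [← e1, ← e2]
  exact this

/-- The weak gradient is well defined. -/
theorem h10Graph_snd_eq_zero {d : ℕ} {Ω : Set (Space d)} (p : L2 Ω × L2Vec Ω)
    (hp : p ∈ h10Graph Ω) (h0 : p.1 = 0) : p.2 = 0 := by
  have key : ∀ v : Space d, ∀ᵐ x ∂(volume.restrict Ω), ⟪p.2 x, v⟫_ℝ = 0 := by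
    intro v
    refine ae_eq_zero_of_integral_contDiff_smul_eq_zero ?_ ?_
    · have : MemLp (fun x => ⟪p.2 x, v⟫_ℝ) 2 (volume.restrict Ω) :=
        (Lp.memLp p.2).inner_const v
      exact this.locallyIntegrable (by norm_num)
    · intro ψ hψ hψc
      simp only [smul_eq_mul]
      rw [h10Graph_integration_by_parts hp hψ hψc v, h0, neg_eq_zero]
      rw [integral_congr_ae (g := fun _ => (0 : ℝ))]
      · simp
      · filter_upwards [Lp.coeFn_zero ℝ 2 (volume.restrict Ω)] with x hx
        rw [hx]
        simp
  refine (Lp.eq_zero_iff_ae_eq_zero).2 ?_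
  have hall : ∀ᵐ x ∂(volume.restrict Ω), ∀ i : Fin d,
      ⟪p.2 x, EuclideanSpace.single i (1 : ℝ)⟫_ℝ = 0 :=
    ae_all_iff.2 fun i => key _
  filter_upwards [hall] with x hx
  ext i
  simpa [EuclideanSpace.inner_single_right] using hx i

/-- `(v, ∇v)` runs through `h10Graph Ω`. -/
theorem weakGradient_graph {d : ℕ} (Ω : Set (Space d)) :
    (weakGradient Ω).graph = h10Graph Ω :=
  Submodule.toLinearPMap_graph_eq _ fun p hp h0 => h10Graph_snd_eq_zero p hp h0

/-! ## Triangulations and the finite element space -/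

/-- A (conforming) triangulation of `Ω`: a finite simplicial complex whose underlying space is the
closure of `Ω`. -/
structure Triangulation {d : ℕ} (Ω : Set (Space d)) where
  complex : Geometry.SimplicialComplex ℝ (Space d)
  finite_faces : complex.faces.Finite
  space_eq : complex.space = closure Ω

/-- The elements of the triangulation, each given by its `d + 1` vertices. -/
def Triangulation.elements {d : ℕ} {Ω : Set (Space d)} (𝒯 : Triangulation Ω) :
    Set (Finset (Space d)) :=
  {s | s ∈ 𝒯.complex.faces ∧ s.card = d + 1}

/-- The finite element space `X_h` of functions in `H¹₀(Ω)` that are affine on each element. -/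
noncomputable def femSpace {d : ℕ} {Ω : Set (Space d)} (𝒯 : Triangulation Ω) :
    Submodule ℝ (L2 Ω) where
  carrier := {v | v ∈ H10 Ω ∧ ∀ s ∈ 𝒯.elements, ∃ ℓ : Space d →ᵃ[ℝ] ℝ,
    ∀ᵐ x ∂(volume.restrict Ω), x ∈ convexHull ℝ (s : Set (Space d)) → v x = ℓ x}
  add_mem' := by
    rintro v w ⟨hv, hv'⟩ ⟨hw, hw'⟩
    refine ⟨add_mem hv hw, fun s hs => ?_⟩
    obtain ⟨ℓ, hℓ⟩ := hv' s hs
    obtain ⟨m, hm⟩ := hw' s hs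
    refine ⟨ℓ + m, ?_⟩
    filter_upwards [hℓ, hm, Lp.coeFn_add v w] with x h1 h2 h3 hx
    rw [h3, Pi.add_apply, h1 hx, h2 hx]
    rfl
  zero_mem' := by
    refine ⟨zero_mem _, fun s _ => ⟨0, ?_⟩⟩
    filter_upwards [Lp.coeFn_zero ℝ 2 (volume.restrict Ω)] with x h1 _
    rw [h1]
    rfl
  smul_mem' := by
    rintro c v ⟨hv, hv'⟩
    refine ⟨Submodule.smul_mem _ c hv, fun s hs => ?_⟩
    obtain ⟨ℓ, hℓ⟩ := hv' s hs
    refine ⟨c • ℓ, ?_⟩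
    filter_upwards [hℓ, Lp.coeFn_smul c v] with x h1 h3 hx
    rw [h3, Pi.smul_apply, h1 hx]
    rfl

theorem femSpace_le_H10 {d : ℕ} {Ω : Set (Space d)} (𝒯 : Triangulation Ω) :
    femSpace 𝒯 ≤ H10 Ω := fun _ hv => hv.1

/-- Almost every point of `Ω` lies in an element. -/
theorem Triangulation.ae_mem_element {d : ℕ} {Ω : Set (Space d)} (𝒯 : Triangulation Ω) :
    ∀ᵐ x ∂(volume.restrict Ω), ∃ s ∈ 𝒯.elements, x ∈ convexHull ℝ (s : Set (Space d)) := by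
  have hnull : ∀ s ∈ 𝒯.complex.faces, s ∉ 𝒯.elements →
      volume (convexHull ℝ (s : Set (Space d))) = 0 := by
    intro s hs hne
    have hind := 𝒯.complex.indep hs
    refine measure_mono_null (convexHull_subset_affineSpan _)
      (Measure.addHaar_affineSubspace _ _ fun htop => hne ⟨hs, ?_⟩)
    have h2 := hind.affineSpan_eq_top_iff_card_eq_finrank_add_one
    rw [Subtype.range_coe_subtype] at h2
    have h3 := h2.1 htop
    simpa using h3
  have hU : volume (⋃ s ∈ 𝒯.complex.faces \ 𝒯.elements,
      convexHull ℝ (s : Set (Space d))) = 0 := by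
    refine (measure_biUnion_null_iff (𝒯.finite_faces.subset sdiff_subset).countable).2 ?_
    exact fun s hs => hnull s hs.1 hs.2
  have h1 : ∀ᵐ x ∂(volume.restrict Ω), x ∉ ⋃ s ∈ 𝒯.complex.faces \ 𝒯.elements,
      convexHull ℝ (s : Set (Space d)) :=
    ae_restrict_of_ae (measure_eq_zero_iff_ae_notMem.1 hU)
  have h2 : ∀ᵐ x ∂(volume.restrict Ω), x ∈ closure Ω := by
    have h3 : ∀ᵐ x ∂(volume.restrict (closure Ω)), x ∈ closure Ω :=
      ae_restrict_mem isClosed_closure.measurableSet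
    exact ae_mono (Measure.restrict_mono subset_closure le_rfl) h3
  filter_upwards [h1, h2] with x hx hx'
  rw [← 𝒯.space_eq, Geometry.SimplicialComplex.mem_space_iff] at hx'
  obtain ⟨s, hs, hxs⟩ := hx'
  by_cases hse : s ∈ 𝒯.elements
  · exact ⟨s, hse, hxs⟩
  · exact absurd (mem_biUnion (show s ∈ 𝒯.complex.faces \ 𝒯.elements from ⟨hs, hse⟩) hxs) hx

/-- The finite element space has finite dimension. -/
instance femSpace_finiteDimensional {d : ℕ} {Ω : Set (Space d)} (𝒯 : Triangulation Ω) :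
    FiniteDimensional ℝ (femSpace 𝒯) := by
  classical
  have hfin : 𝒯.elements.Finite := 𝒯.finite_faces.subset fun s hs => hs.1
  have : Fintype 𝒯.elements := hfin.fintype
  -- a function of `X_h` together with its affine pieces
  let W : Submodule ℝ (L2 Ω × (𝒯.elements → (Space d →ᵃ[ℝ] ℝ))) :=
    { carrier := {q | q.1 ∈ H10 Ω ∧ ∀ s : 𝒯.elements, ∀ᵐ x ∂(volume.restrict Ω),
        x ∈ convexHull ℝ ((s : Finset (Space d)) : Set (Space d)) → q.1 x = q.2 s x}
      add_mem' := by
        rintro p q ⟨hp, hp'⟩ ⟨hq, hq'⟩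
        refine ⟨add_mem hp hq, fun s => ?_⟩
        filter_upwards [hp' s, hq' s, Lp.coeFn_add p.1 q.1] with x h1 h2 h3 hx
        rw [Prod.fst_add, h3, Pi.add_apply, h1 hx, h2 hx]
        rfl
      zero_mem' := by
        refine ⟨zero_mem _, fun s => ?_⟩
        filter_upwards [Lp.coeFn_zero ℝ 2 (volume.restrict Ω)] with x h1 _
        rw [Prod.fst_zero, h1]
        rfl
      smul_mem' := by
        rintro c p ⟨hp, hp'⟩
        refine ⟨Submodule.smul_mem _ c hp, fun s => ?_⟩
        filter_upwards [hp' s, Lp.coeFn_smul c p.1] with x h1 h3 hx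
        rw [Prod.smul_fst, h3, Pi.smul_apply, h1 hx]
        rfl }
  have hinj : Function.Injective
      ((LinearMap.snd ℝ (L2 Ω) (𝒯.elements → (Space d →ᵃ[ℝ] ℝ))).comp W.subtype) := by
    rw [injective_iff_map_eq_zero]
    rintro ⟨⟨v, ℓ⟩, hW⟩ h0
    have h0' : ℓ = 0 := h0
    subst h0'
    have hv : v = 0 := by
      refine (Lp.eq_zero_iff_ae_eq_zero).2 ?_
      have hall := ae_all_iff.2 hW.2
      filter_upwards [hall, 𝒯.ae_mem_element] with x hx hx'
      obtain ⟨s, hs, hxs⟩ := hx'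
      simpa using hx ⟨s, hs⟩ hxs
    subst hv
    rfl
  have : FiniteDimensional ℝ W := FiniteDimensional.of_injective _ hinj
  have hmap : femSpace 𝒯 ≤ W.map (LinearMap.fst ℝ (L2 Ω) (𝒯.elements → (Space d →ᵃ[ℝ] ℝ))) := by
    rintro v ⟨hv, hv'⟩
    choose ℓ hℓ using hv'
    exact ⟨(v, fun s => ℓ s s.2), ⟨hv, fun s => hℓ s s.2⟩, rfl⟩
  exact Submodule.finiteDimensional_of_le hmap

/-- The `L²(Ω)`-orthogonal projection `P_h : L²(Ω) → X_h`. -/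
noncomputable def l2Projection {d : ℕ} {Ω : Set (Space d)} (𝒯 : Triangulation Ω) :
    L2 Ω →L[ℝ] femSpace 𝒯 :=
  (femSpace 𝒯).orthogonalProjectionOnto

/-- The gradient `X_h → L²(Ω; ℝᵈ)`. -/
noncomputable def femGradient {d : ℕ} {Ω : Set (Space d)} (𝒯 : Triangulation Ω) :
    femSpace 𝒯 →ₗ[ℝ] L2Vec Ω :=
  (weakGradient Ω).toFun ∘ₗ Submodule.inclusion (femSpace_le_H10 𝒯)

instance femSpace_completeSpace {d : ℕ} {Ω : Set (Space d)} (𝒯 : Triangulation Ω) :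
    CompleteSpace (femSpace 𝒯) := FiniteDimensional.complete ℝ _

/-- The discrete Laplacian `Δ_h : X_h → X_h`, `-(Δ_h φ, χ) = (∇φ, ∇χ)` for all `φ, χ ∈ X_h`
(see `discreteLaplacian_spec`). -/
noncomputable def discreteLaplacian {d : ℕ} {Ω : Set (Space d)} (𝒯 : Triangulation Ω) :
    femSpace 𝒯 →L[ℝ] femSpace 𝒯 :=
  -(ContinuousLinearMap.adjoint (LinearMap.toContinuousLinearMap (femGradient 𝒯)) ∘L
    LinearMap.toContinuousLinearMap (femGradient 𝒯))

theorem discreteLaplacian_spec {d : ℕ} {Ω : Set (Space d)} (𝒯 : Triangulation Ω)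
    (φ χ : femSpace 𝒯) :
    -⟪discreteLaplacian 𝒯 φ, χ⟫_ℝ = ⟪femGradient 𝒯 φ, femGradient 𝒯 χ⟫_ℝ := by
  simp [discreteLaplacian, ContinuousLinearMap.adjoint_inner_left]

/-! ## Functions of time -/

/-- `g` is the weak (distributional) derivative of `f` on `(0, T)`. -/
def HasWeakTimeDeriv {X : Type*} [NormedAddCommGroup X] [NormedSpace ℝ X] (T : ℝ)
    (f g : ℝ → X) : Prop :=
  LocallyIntegrableOn f (Ioo 0 T) ∧ LocallyIntegrableOn g (Ioo 0 T) ∧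
    ∀ φ : ℝ → ℝ, ContDiff ℝ ∞ φ → HasCompactSupport φ → tsupport φ ⊆ Ioo 0 T →
      ∫ t in Ioo 0 T, deriv φ t • f t = -∫ t in Ioo 0 T, φ t • g t

/-- The integral `∫₀ᵗ (t - s)^(α - 1) ‖g(s)‖ ds`, with values in `[0, ∞]`. -/
noncomputable def weightedIntegral {X : Type*} [NormedAddCommGroup X] (α : ℝ) (g : ℝ → X)
    (t : ℝ) : ℝ≥0∞ :=
  ∫⁻ s in Ioo 0 t, ENNReal.ofReal ((t - s) ^ (α - 1)) * ‖g s‖ₑ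

/-- The Caputo derivative of order `α ∈ (0, 1)`,
`∂ₜ^α u(t) = Γ(1 - α)⁻¹ ∫₀ᵗ (t - s)^(-α) u'(s) ds`. -/
noncomputable def caputoDeriv {X : Type*} [NormedAddCommGroup X] [NormedSpace ℝ X] (α : ℝ)
    (u : ℝ → X) (t : ℝ) : X :=
  (Real.Gamma (1 - α))⁻¹ • ∫ s in Ioo 0 t, (t - s) ^ (-α) • deriv u s

/-- `u : [0, T] → X_h` solves the semidiscrete problem `∂ₜ^α u - Δ_h u = f_h` on `(0, T)`,
`u(0) = v_h`. As usual for the Caputo derivative, `u` is absolutely continuous on `[0, T]`, so that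
`u'` exists almost everywhere and is integrable, and the equation is understood for almost every
`t`. -/
structure IsSemidiscreteSolution {d : ℕ} {Ω : Set (Space d)} (𝒯 : Triangulation Ω) (α T : ℝ)
    (vh : femSpace 𝒯) (fh : ℝ → femSpace 𝒯) (u : ℝ → femSpace 𝒯) : Prop where
  initial : u 0 = vh
  integrable_deriv : IntegrableOn (deriv u) (Ioo 0 T)
  eq_integral_deriv : ∀ t ∈ Icc 0 T, u t = u 0 + ∫ s in Ioo 0 t, deriv u s
  equation : ∀ᵐ t ∂(volume.restrict (Ioo 0 T)),
    caputoDeriv α u t - discreteLaplacian 𝒯 (u t) = fh t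

/-! ## The corrected fractional Crank–Nicolson scheme -/

/-- The backward Euler convolution quadrature weights: the coefficients
`b_j = (-1)ʲ Γ(α + 1) / (Γ(j + 1) Γ(α - j + 1)) = (-1)ʲ (α choose j)` of `(1 - ξ)^α = ∑ b_j ξʲ`. -/
noncomputable def cqWeight (α : ℝ) (j : ℕ) : ℝ := (-1) ^ j * Ring.choose α j

/-- The convolution quadrature `∂̄_τ^α φⁿ = τ^(-α) ∑_{j=0}^n b_{n-j} φʲ`. -/
noncomputable def cqDeriv {X : Type*} [NormedAddCommGroup X] [NormedSpace ℝ X] (α τ : ℝ)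
    (φ : ℕ → X) (n : ℕ) : X :=
  τ ^ (-α) • ∑ j ∈ Finset.range (n + 1), cqWeight α (n - j) • φ j

/-- `U⁰, …, U^N` solve the corrected fractional Crank–Nicolson scheme with step size `τ`, initial
value `v_h` and source `F⁰, …, F^N`. -/
structure IsCorrectedCNSolution {d : ℕ} {Ω : Set (Space d)} (𝒯 : Triangulation Ω) (α τ : ℝ)
    (N : ℕ) (vh : femSpace 𝒯) (F : ℕ → femSpace 𝒯) (U : ℕ → femSpace 𝒯) : Prop where
  initial : U 0 = vh
  step_one : 1 ≤ N →
    cqDeriv α τ (fun j => U j - vh) 1 - (1 - α / 2) • discreteLaplacian 𝒯 (U 1)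
        - (1 / 2 - α / 4) • discreteLaplacian 𝒯 vh
      = (1 - α / 2) • (F 1 + (1 / 2 : ℝ) • F 0)
  step_two : 2 ≤ N →
    cqDeriv α τ (fun j => U j - vh) 2 - (1 - α / 2) • discreteLaplacian 𝒯 (U 2)
        - (α / 2) • discreteLaplacian 𝒯 (U 1) - (α / 4) • discreteLaplacian 𝒯 vh
      = (1 - α / 2) • F 2 + (α / 2) • F 1 + (α / 4) • F 0
  step : ∀ n, 3 ≤ n → n ≤ N →
    cqDeriv α τ (fun j => U j - vh) n - (1 - α / 2) • discreteLaplacian 𝒯 (U n)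
        - (α / 2) • discreteLaplacian 𝒯 (U (n - 1))
      = (1 - α / 2) • F n + (α / 2) • F (n - 1)

end FracCN

namespace FracCN

open Filter Topology Real

/-! ## Laplace-type integrals with power weights -/

/-! The discrete Laplacian is symmetric and negative semidefinite, so an orthonormal eigenbasis
splits both problems into scalar ones with an eigenvalue `lam ≥ 0`. Nothing is known about the size
of `lam`, so every estimate has to be uniform in it; this is also what makes the constant
independent of the mesh and of the domain.

For one component, the exact solution is the convolution of the source `F` with the relaxation
kernel k = `relaxKernel` (`component_eq_integral_relaxKernel`), and the discrete one is τ^α times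
the discrete convolution of the samples of `F` with K = `cnKernel` at μ = lam τ^α, plus half of
K_{n-1} F(0), which is the effect of the correction (`eq_sum_cnKernel_of_scheme`). By homogeneity of
k one may take τ = 1. Taylor's formula writes `F` as a constant, a linear function and a
superposition of ramps (s - σ)_+ with density F''. It therefore suffices to bound the quadrature
error by n^(α-2) for the constant (`exists_abs_integral_sub_sum_le`) and by x^(α-1) for a ramp of
arbitrary real length x (`exists_abs_ramp_integral_sub_sum_le`); scaling back produces τ² t^(α-2)
and τ² t^(α-1).

To obtain these bounds, K_n is compared with the integral h_n of k against the hat function at n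
(`hatMoment`). Quadrature with the weights h_n is exact for ramps ending at a node. Three facts
control e_n = h_n - K_n, uniformly in μ.

First, e_n = O((n+1)^(α-3)). Both kernels are Laplace integrals of one spectral density `specDens`:
k(t) is the integral of e^(-rt) against the density at r^α, while deforming the Cauchy integral for
K_n onto the cut (1, e^L) gives e^(-nx) against the density at `cnBranch`, up to O(e^(-nL))
(`exists_abs_cnKernel_sub_integral_le`). Second order consistency says `cnBranch` = x^α (1 + O(x²)),
and the density is Lipschitz in 1/y uniformly in `lam`, so the difference of the densities is
O(r^(2-α)) and that of the kernels O(n^(α-3)). The difference h_n - k(n) is an average of second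
differences of k, of the same order.

Second, the generating functions of h and K at ξ = e^(-s) differ by O(s^(2-α))
(`exists_abs_tsum_sub_le`). As 2 - α > 1, the sums of e_n and of n e_n both vanish
(`tsum_eq_zero_of_abs_tsum_mul_exp_le`).

Third, partial sums of e_n and of (n - j) e_j are therefore minus their tails, hence O(n^(α-2)) and
O(n^(α-1)) (`exists_abs_sum_sub_le`). For the constant source, the half hat left over at the node of
the initial time is matched by the term K_{n-1}/2.

The formula for the exact solution rests on the Laplace transform of k being 1/(s^α + lam)
(`integral_exp_mul_relaxKernel`), a Cauchy integral around the negative axis; uniqueness of the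
Laplace transform then shows that k inverts the fractional operator by convolution
(`relaxKernel_resolvent`). -/

theorem integrableOn_rpow_mul_exp_neg {p t : ℝ} (hp : -1 < p) (ht : 0 < t) :
    IntegrableOn (fun r : ℝ => r ^ p * exp (-(r * t))) (Ioi 0) := by
  have := integrableOn_rpow_mul_exp_neg_mul_rpow (p := 1) (s := p) (b := t) hp (by norm_num) ht
  refine this.congr_fun (fun r hr => ?_) measurableSet_Ioi
  simp [mul_comm]

theorem integral_rpow_mul_exp_neg {p t : ℝ} (hp : -1 < p) (ht : 0 < t) :
    ∫ r in Ioi (0 : ℝ), r ^ p * exp (-(r * t)) = Gamma (p + 1) * t ^ (-(p + 1)) := by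
  have := Real.integral_rpow_mul_exp_neg_mul_Ioi (a := p + 1) (r := t) (by linarith) ht
  rw [add_sub_cancel_right] at this
  rw [mul_comm (Gamma _), rpow_neg ht.le, ← inv_rpow ht.le, ← one_div, ← this]
  simp [mul_comm]

theorem integrableOn_exp_neg_mul_of_le {φ : ℝ → ℝ} {A p t : ℝ} (hφm : Measurable φ)
    (hφ : ∀ r, 0 < r → |φ r| ≤ A * r ^ p) (hp : -1 < p) (ht : 0 < t) :
    IntegrableOn (fun r => exp (-(r * t)) * φ r) (Ioi 0) := by
  refine ((integrableOn_rpow_mul_exp_neg hp ht).const_mul A).mono' ?_ ?_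
  · exact (by fun_prop : Measurable fun r => exp (-(r * t)) * φ r).aestronglyMeasurable
  · filter_upwards [ae_restrict_mem measurableSet_Ioi] with r hr
    rw [norm_mul, norm_eq_abs, norm_eq_abs, abs_exp]
    nlinarith [hφ r hr, exp_pos (-(r * t))]

/-- The dictionary behind all decay estimates of the kernels: each power of `r` gained by the
density at the origin is a power of `t` gained at infinity. -/
theorem abs_integral_exp_neg_mul_le {φ : ℝ → ℝ} {A p t : ℝ}
    (hφ : ∀ r, 0 < r → |φ r| ≤ A * r ^ p) (hp : -1 < p) (ht : 0 < t) :
    |∫ r in Ioi (0 : ℝ), exp (-(r * t)) * φ r| ≤ A * Gamma (p + 1) * t ^ (-(p + 1)) := by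
  rw [mul_assoc, ← integral_rpow_mul_exp_neg hp ht, ← integral_const_mul, ← norm_eq_abs]
  refine norm_integral_le_of_norm_le ((integrableOn_rpow_mul_exp_neg hp ht).const_mul A) ?_
  filter_upwards [ae_restrict_mem measurableSet_Ioi] with r hr
  rw [norm_mul, norm_eq_abs, norm_eq_abs, abs_exp]
  nlinarith [hφ r hr, exp_pos (-(r * t))]

/-! ## The spectral density of the relaxation kernel -/

/-- The density `-π⁻¹ Im (y e^{iπα} + lam)⁻¹`. -/
noncomputable def specDens (α lam y : ℝ) : ℝ :=
  π⁻¹ * (y * sin (π * α) / (y ^ 2 + 2 * y * lam * cos (π * α) + lam ^ 2))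

theorem sin_pi_mul_pos {α : ℝ} (h0 : 0 < α) (h1 : α < 1) : 0 < sin (π * α) :=
  sin_pos_of_pos_of_lt_pi (by positivity) (by nlinarith [pi_pos])

/-- The right side is |y e^(iπα) + lam|² and the left side the square of its imaginary part. -/
theorem sq_mul_sin_le (α lam y : ℝ) :
    (y * sin (π * α)) ^ 2 ≤ y ^ 2 + 2 * y * lam * cos (π * α) + lam ^ 2 := by
  nlinarith [sin_sq_add_cos_sq (π * α), sq_nonneg (y * cos (π * α) + lam)]

/-- The same with the number rotated to y + lam e^(-iπα). -/
theorem sq_mul_sin_le' (α lam y : ℝ) :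
    (lam * sin (π * α)) ^ 2 ≤ y ^ 2 + 2 * y * lam * cos (π * α) + lam ^ 2 := by
  nlinarith [sin_sq_add_cos_sq (π * α), sq_nonneg (lam * cos (π * α) + y)]

theorem specDens_den_pos {α lam y : ℝ} (h0 : 0 < α) (h1 : α < 1) (hy : 0 < y) :
    0 < y ^ 2 + 2 * y * lam * cos (π * α) + lam ^ 2 :=
  (by have := sin_pi_mul_pos h0 h1; positivity : 0 < (y * sin (π * α)) ^ 2).trans_le
    (sq_mul_sin_le _ _ _)

theorem specDens_nonneg {α lam y : ℝ} (h0 : 0 < α) (h1 : α < 1) (hy : 0 < y) :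
    0 ≤ specDens α lam y := by
  have := sin_pi_mul_pos h0 h1
  have := specDens_den_pos (lam := lam) h0 h1 hy
  unfold specDens
  positivity

/-- The bound must be free of `lam`, so only the part y² sin² of the denominator is used. -/
theorem specDens_le {α lam y : ℝ} (h0 : 0 < α) (h1 : α < 1) (hy : 0 < y) :
    specDens α lam y ≤ (π * sin (π * α))⁻¹ * y⁻¹ := by
  have hs := sin_pi_mul_pos h0 h1
  have hD := specDens_den_pos (lam := lam) h0 h1 hy
  unfold specDens
  rw [mul_inv, mul_assoc π⁻¹ _ y⁻¹]
  refine mul_le_mul_of_nonneg_left ?_ (by positivity)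
  rw [← mul_inv, div_le_iff₀ hD, inv_mul_eq_div, le_div_iff₀ (by positivity)]
  nlinarith [sq_mul_sin_le α lam y]

/-- The density is Lipschitz in the variable 1/y with a constant independent of `lam`; this turns a
relative error of the symbol into an error of the density of the same order. -/
theorem abs_specDens_sub_le {α lam y z : ℝ} (h0 : 0 < α) (h1 : α < 1) (hl : 0 ≤ lam)
    (hy : 0 < y) (hz : 0 < z) :
    |specDens α lam y - specDens α lam z|
      ≤ 2 * (π * sin (π * α) ^ 3)⁻¹ * (|y - z| / (y * z)) := by
  have hs := sin_pi_mul_pos h0 h1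
  set s := sin (π * α) with hsdef
  set c := cos (π * α)
  have hD := specDens_den_pos (lam := lam) h0 h1 hy
  have hE := specDens_den_pos (lam := lam) h0 h1 hz
  have d1 := sq_mul_sin_le α lam y
  have d2 := sq_mul_sin_le' α lam y
  have e1 := sq_mul_sin_le α lam z
  have e2 := sq_mul_sin_le' α lam z
  unfold specDens
  rw [← hsdef] at *
  change |π⁻¹ * (y * s / (y ^ 2 + 2 * y * lam * c + lam ^ 2)) -
    π⁻¹ * (z * s / (z ^ 2 + 2 * z * lam * c + lam ^ 2))| ≤ _
  change 0 < y ^ 2 + 2 * y * lam * c + lam ^ 2 at hD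
  change 0 < z ^ 2 + 2 * z * lam * c + lam ^ 2 at hE
  change _ ≤ y ^ 2 + 2 * y * lam * c + lam ^ 2 at d1
  change _ ≤ y ^ 2 + 2 * y * lam * c + lam ^ 2 at d2
  change _ ≤ z ^ 2 + 2 * z * lam * c + lam ^ 2 at e1
  change _ ≤ z ^ 2 + 2 * z * lam * c + lam ^ 2 at e2
  -- The terms with the cosine cancel in the numerator, which leaves the factor lam² - yz. Both of
  -- its parts can be absorbed into the product of the denominators.
  have hdiff : π⁻¹ * (y * s / (y ^ 2 + 2 * y * lam * c + lam ^ 2)) -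
      π⁻¹ * (z * s / (z ^ 2 + 2 * z * lam * c + lam ^ 2))
      = π⁻¹ * s * (y - z) * (lam ^ 2 - y * z) /
        ((y ^ 2 + 2 * y * lam * c + lam ^ 2) * (z ^ 2 + 2 * z * lam * c + lam ^ 2)) := by
    rw [← mul_sub, div_sub_div _ _ hD.ne' hE.ne', ← mul_div_assoc]
    congr 1
    ring
  rw [hdiff]
  generalize y ^ 2 + 2 * y * lam * c + lam ^ 2 = D at *
  generalize z ^ 2 + 2 * z * lam * c + lam ^ 2 = E at *
  have f1 : (y * z) ^ 2 * s ^ 4 ≤ D * E := by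
    calc (y * z) ^ 2 * s ^ 4 = (y * s) ^ 2 * (z * s) ^ 2 := by ring
      _ ≤ D * E := by gcongr
  have f2 : lam ^ 2 * (y * z) * s ^ 4 ≤ D * E := by
    -- Arithmetic–geometric mean of the two lower bounds `d1` and `d2` for `D`.
    have hD' : y * lam * s ^ 2 ≤ D := by nlinarith [sq_nonneg (y * s - lam * s)]
    have hE' : z * lam * s ^ 2 ≤ E := by nlinarith [sq_nonneg (z * s - lam * s)]
    calc lam ^ 2 * (y * z) * s ^ 4 = (y * lam * s ^ 2) * (z * lam * s ^ 2) := by ring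
      _ ≤ D * E := by gcongr
  have f3 : |lam ^ 2 - y * z| * (y * z) * s ^ 4 ≤ 2 * (D * E) := by
    have : |lam ^ 2 - y * z| ≤ lam ^ 2 + y * z := by
      rw [abs_le]; constructor <;> nlinarith [mul_pos hy hz, sq_nonneg lam]
    calc |lam ^ 2 - y * z| * (y * z) * s ^ 4 ≤ (lam ^ 2 + y * z) * (y * z) * s ^ 4 := by gcongr
      _ = lam ^ 2 * (y * z) * s ^ 4 + (y * z) ^ 2 * s ^ 4 := by ring
      _ ≤ _ := by linarith
  rw [abs_div, abs_mul, abs_mul, abs_of_pos (by positivity : 0 < π⁻¹ * s),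
    abs_of_pos (by positivity : 0 < D * E), div_le_iff₀ (by positivity)]
  have f4 : |lam ^ 2 - y * z| ≤ 2 * (D * E) / ((y * z) * s ^ 4) := by
    rw [le_div_iff₀ (by positivity)]; linarith
  calc π⁻¹ * s * |y - z| * |lam ^ 2 - y * z|
      ≤ π⁻¹ * s * |y - z| * (2 * (D * E) / ((y * z) * s ^ 4)) := by gcongr
    _ = _ := by field_simp

/-- Homogeneity of degree -1, the source of the scaling law of the kernel. -/
theorem specDens_mul {α c lam y : ℝ} (hc : 0 < c) :
    specDens α (c * lam) (c * y) = c⁻¹ * specDens α lam y := by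
  unfold specDens
  rw [show (c * y) ^ 2 + 2 * (c * y) * (c * lam) * cos (π * α) + (c * lam) ^ 2
    = c ^ 2 * (y ^ 2 + 2 * y * lam * cos (π * α) + lam ^ 2) by ring,
    show c * y * sin (π * α) = c ^ 2 * (c⁻¹ * (y * sin (π * α))) by field_simp,
    mul_div_mul_left _ _ (by positivity)]
  ring

@[fun_prop]
theorem measurable_specDens (α lam : ℝ) : Measurable (specDens α lam) := by
  unfold specDens
  fun_prop

/-! ## The relaxation kernel -/

/-- The constant in the bound of the spectral density. -/
noncomputable def densBound (α : ℝ) : ℝ := (π * sin (π * α))⁻¹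

theorem densBound_pos {α : ℝ} (h0 : 0 < α) (h1 : α < 1) : 0 < densBound α := by
  have := sin_pi_mul_pos h0 h1
  unfold densBound
  positivity

theorem abs_specDens_rpow_le {α lam r : ℝ} (h0 : 0 < α) (h1 : α < 1) (hr : 0 < r) :
    |specDens α lam (r ^ α)| ≤ densBound α * r ^ (-α) := by
  have hr' : 0 < r ^ α := rpow_pos_of_pos hr _
  rw [abs_of_nonneg (specDens_nonneg h0 h1 hr'), rpow_neg hr.le]
  exact specDens_le h0 h1 hr'

/-- The resolvent kernel `t^(α - 1) E_{α,α}(-lam t^α)` of the fractional relaxation equation,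
as a Laplace transform. -/
noncomputable def relaxKernel (α lam t : ℝ) : ℝ :=
  ∫ r in Ioi (0 : ℝ), exp (-(r * t)) * specDens α lam (r ^ α)

theorem relaxKernel_integrableOn {α lam t : ℝ} (h0 : 0 < α) (h1 : α < 1) (ht : 0 < t) :
    IntegrableOn (fun r => exp (-(r * t)) * specDens α lam (r ^ α)) (Ioi 0) :=
  integrableOn_exp_neg_mul_of_le (by fun_prop) (fun r hr => abs_specDens_rpow_le h0 h1 hr)
    (by linarith) ht

theorem relaxKernel_nonneg {α lam t : ℝ} (h0 : 0 < α) (h1 : α < 1) : 0 ≤ relaxKernel α lam t :=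
  setIntegral_nonneg measurableSet_Ioi fun _ hr =>
    mul_nonneg (exp_pos _).le (specDens_nonneg h0 h1 (rpow_pos_of_pos hr _))

@[fun_prop]
theorem measurable_relaxKernel (α lam : ℝ) : Measurable (relaxKernel α lam) := by
  have : StronglyMeasurable (Function.uncurry fun t r : ℝ =>
      exp (-(r * t)) * specDens α lam (r ^ α)) := by
    refine Measurable.stronglyMeasurable ?_
    unfold Function.uncurry
    fun_prop
  exact this.integral_prod_right.measurable

/-- The constant in the bound of the kernel. -/
noncomputable def kernelBound (α : ℝ) : ℝ := densBound α * Gamma (1 - α)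

theorem kernelBound_pos {α : ℝ} (h0 : 0 < α) (h1 : α < 1) : 0 < kernelBound α :=
  mul_pos (densBound_pos h0 h1) (Gamma_pos_of_pos (by linarith))

theorem relaxKernel_le {α lam t : ℝ} (h0 : 0 < α) (h1 : α < 1) (ht : 0 < t) :
    relaxKernel α lam t ≤ kernelBound α * t ^ (α - 1) := by
  have := abs_integral_exp_neg_mul_le (t := t) (p := -α)
    (fun r hr => abs_specDens_rpow_le (lam := lam) h0 h1 hr) (by linarith) ht
  refine (le_abs_self _).trans (this.trans_eq ?_)
  unfold kernelBound
  ring_nf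

theorem relaxKernel_antitone {α lam s t : ℝ} (h0 : 0 < α) (h1 : α < 1) (hs : 0 < s)
    (hst : s ≤ t) : relaxKernel α lam t ≤ relaxKernel α lam s := by
  refine setIntegral_mono_on (relaxKernel_integrableOn h0 h1 (hs.trans_le hst))
    (relaxKernel_integrableOn h0 h1 hs) measurableSet_Ioi fun r (hr : 0 < r) => ?_
  have := specDens_nonneg (lam := lam) h0 h1 (rpow_pos_of_pos hr α)
  gcongr

/-- The factor 1 - e^(-r(t-s)) is at most r(t - s): the difference costs one power of `r`, which is
one more power of decay in `s`. -/
theorem relaxKernel_sub_le {α lam s t : ℝ} (h0 : 0 < α) (h1 : α < 1) (hs : 0 < s)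
    (hst : s ≤ t) :
    relaxKernel α lam s - relaxKernel α lam t
      ≤ (t - s) * (densBound α * Gamma (2 - α)) * s ^ (α - 2) := by
  have hm : ∀ r, 0 < r → |(1 - exp (-(r * (t - s)))) * specDens α lam (r ^ α)|
      ≤ (t - s) * densBound α * r ^ (1 - α) := by
    intro r hr
    have h2 := abs_specDens_rpow_le (lam := lam) h0 h1 hr
    have h3 : 0 ≤ 1 - exp (-(r * (t - s))) := by
      rw [sub_nonneg, exp_le_one_iff]
      nlinarith
    have h4 : 1 - exp (-(r * (t - s))) ≤ r * (t - s) := by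
      linarith [add_one_le_exp (-(r * (t - s)))]
    rw [abs_mul, abs_of_nonneg h3, sub_eq_add_neg 1 α, rpow_add hr, rpow_one]
    calc _ ≤ r * (t - s) * (densBound α * r ^ (-α)) := by gcongr
      _ = _ := by ring
  have := abs_integral_exp_neg_mul_le hm (by linarith) hs
  unfold relaxKernel
  rw [← integral_sub (relaxKernel_integrableOn h0 h1 hs)
    (relaxKernel_integrableOn h0 h1 (hs.trans_le hst))]
  have e : ∀ r : ℝ, exp (-(r * s)) * specDens α lam (r ^ α) - exp (-(r * t)) *
      specDens α lam (r ^ α) =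
      exp (-(r * s)) * ((1 - exp (-(r * (t - s)))) * specDens α lam (r ^ α)) := by
    intro r
    have : exp (-(r * t)) = exp (-(r * s)) * exp (-(r * (t - s))) := by
      rw [← exp_add]; ring_nf
    rw [this]; ring
  simp only [e]
  refine (le_abs_self _).trans (this.trans_eq ?_)
  ring_nf

/-- The second difference of the kernel. -/
theorem relaxKernel_second_diff {α lam t x : ℝ} (h0 : 0 < α) (h1 : α < 1) (ht : 1 < t)
    (hx : 0 ≤ x) (hx1 : x ≤ 1) :
    0 ≤ relaxKernel α lam (t + x) + relaxKernel α lam (t - x) - 2 * relaxKernel α lam t ∧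
    relaxKernel α lam (t + x) + relaxKernel α lam (t - x) - 2 * relaxKernel α lam t
      ≤ (densBound α * Gamma (3 - α)) * (t - 1) ^ (α - 3) := by
  have hpos : ∀ r, 0 < r → 0 ≤ specDens α lam (r ^ α) := fun r hr =>
    specDens_nonneg (lam := lam) h0 h1 (rpow_pos_of_pos hr α)
  -- The second difference of the exponential is a perfect square, which gives the sign and the
  -- factor r². One factor e^(-r) is taken out of e^(-rt) to compensate the growth of e^(rx) for x ≤
  -- 1; this is why the decay is in t - 1.
  have hsq : ∀ r : ℝ, exp (-r) * (exp (-(r * x)) + exp (r * x) - 2)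
      = exp (-r) * (exp (-(r * x / 2)) - exp (r * x / 2)) ^ 2 := by
    intro r
    have e1 : exp (-(r * x)) = exp (-(r * x / 2)) ^ 2 := by rw [← exp_nat_mul]; ring_nf
    have e2 : exp (r * x) = exp (r * x / 2) ^ 2 := by rw [← exp_nat_mul]; ring_nf
    have e3 : exp (-(r * x / 2)) * exp (r * x / 2) = 1 := by rw [← exp_add]; simp
    rw [e1, e2]
    linear_combination (2 * exp (-r)) * e3
  have hm : ∀ r, 0 < r → |(exp (-r) * (exp (-(r * x)) + exp (r * x) - 2)) *
      specDens α lam (r ^ α)| ≤ densBound α * r ^ (2 - α) := by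
    intro r hr
    have h2 := abs_specDens_rpow_le (lam := lam) h0 h1 hr
    have h3 : |exp (-r) * (exp (-(r * x)) + exp (r * x) - 2)| ≤ r ^ 2 := by
      rw [hsq, abs_of_nonneg (by positivity)]
      have e4 : exp (-r) * (exp (-(r * x / 2)) - exp (r * x / 2)) ^ 2
          = exp (-r) * exp (r * x / 2) ^ 2 * (1 - exp (-(r * x))) ^ 2 := by
        have : exp (-(r * x / 2)) = exp (r * x / 2) * exp (-(r * x)) := by
          rw [← exp_add]; ring_nf
        rw [this]; ring
      have e5 : exp (-r) * exp (r * x / 2) ^ 2 ≤ 1 := by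
        rw [← exp_nat_mul, ← exp_add, exp_le_one_iff]
        push_cast
        nlinarith
      have e6 : 0 ≤ 1 - exp (-(r * x)) := by
        rw [sub_nonneg, exp_le_one_iff]; nlinarith
      have e7 : 1 - exp (-(r * x)) ≤ r := by nlinarith [add_one_le_exp (-(r * x))]
      rw [e4]
      calc _ ≤ 1 * r ^ 2 := by gcongr
        _ = _ := one_mul _
    rw [abs_mul, sub_eq_add_neg 2 α, rpow_add hr, rpow_two]
    calc _ ≤ r ^ 2 * (densBound α * r ^ (-α)) := by gcongr
      _ = _ := by ring
  have hI := abs_integral_exp_neg_mul_le hm (by linarith) (sub_pos.2 ht)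
  have key : relaxKernel α lam (t + x) + relaxKernel α lam (t - x) - 2 * relaxKernel α lam t =
      ∫ r in Ioi (0 : ℝ), exp (-(r * (t - 1))) *
        ((exp (-r) * (exp (-(r * x)) + exp (r * x) - 2)) * specDens α lam (r ^ α)) := by
    unfold relaxKernel
    have i1 := relaxKernel_integrableOn (lam := lam) h0 h1 (by linarith : 0 < t + x)
    have i2 := relaxKernel_integrableOn (lam := lam) h0 h1 (by linarith : 0 < t - x)
    have i3 := relaxKernel_integrableOn (lam := lam) h0 h1 (by linarith : 0 < t)
    have i12 : IntegrableOn (fun r => exp (-(r * (t + x))) * specDens α lam (r ^ α) +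
      exp (-(r * (t - x))) * specDens α lam (r ^ α)) (Ioi 0) := i1.add i2
    rw [← integral_add i1 i2, ← integral_const_mul, ← integral_sub i12 (i3.const_mul _)]
    congr 1
    ext r
    have a1 : exp (-(r * (t + x))) = exp (-(r * (t - 1))) * exp (-r) * exp (-(r * x)) := by
      rw [← exp_add, ← exp_add]; ring_nf
    have a2 : exp (-(r * (t - x))) = exp (-(r * (t - 1))) * exp (-r) * exp (r * x) := by
      rw [← exp_add, ← exp_add]; ring_nf
    have a3 : exp (-(r * t)) = exp (-(r * (t - 1))) * exp (-r) := by
      rw [← exp_add]; ring_nf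
    rw [a1, a2, a3]; ring
  rw [key]
  refine ⟨setIntegral_nonneg measurableSet_Ioi fun r hr => ?_, ?_⟩
  · rw [hsq]
    have := hpos r hr
    positivity
  · refine (le_abs_self _).trans (hI.trans_eq ?_)
    ring_nf

/-- Substitution r ↦ r/τ together with `specDens_mul`. It reduces all kernel estimates to step size
one, the eigenvalue becoming lam τ^α. -/
theorem relaxKernel_scaling {α lam τ t : ℝ} (hτ : 0 < τ) :
    relaxKernel α lam (τ * t) = τ ^ (α - 1) * relaxKernel α (lam * τ ^ α) t := by
  unfold relaxKernel
  have := integral_comp_mul_left_Ioi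
    (fun r => exp (-(r * t)) * specDens α lam ((r / τ) ^ α)) 0 hτ
  rw [mul_zero] at this
  have e : ∀ r ∈ Ioi (0 : ℝ), exp (-(τ * r * t)) * specDens α lam ((τ * r / τ) ^ α)
      = exp (-(r * (τ * t))) * specDens α lam (r ^ α) := by
    intro r _
    rw [mul_div_cancel_left₀ _ hτ.ne']
    ring_nf
  rw [setIntegral_congr_fun measurableSet_Ioi e] at this
  rw [this, smul_eq_mul, rpow_sub hτ, rpow_one, div_eq_inv_mul, mul_assoc]
  congr 1
  rw [← integral_const_mul]
  refine setIntegral_congr_fun measurableSet_Ioi fun r hr => ?_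
  have hτα : 0 < τ ^ α := rpow_pos_of_pos hτ _
  have h := specDens_mul (α := α) (lam := lam) (y := (r / τ) ^ α) hτα
  rw [div_rpow (mem_Ioi.1 hr).le hτ.le, mul_div_cancel₀ _ hτα.ne', mul_comm (τ ^ α) lam] at h
  rw [div_rpow (mem_Ioi.1 hr).le hτ.le, h]
  field_simp

/-! ## The Stieltjes transform of the spectral density -/

/-- In the strip the argument of e^(αζ) stays in [0, πα], so its distance to a point of the negative
real axis is at least the one attained at the extreme angle πα. -/
theorem exp_mul_sin_le_norm {α lam : ℝ} (h0 : 0 < α) (h1 : α < 1) (hl : 0 ≤ lam) {ζ : ℂ}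
    (hy0 : 0 ≤ ζ.im) (hy1 : ζ.im ≤ π) :
    exp (α * ζ.re) * sin (π * α) ≤ ‖Complex.exp (α * ζ) + lam‖ := by
  have hs := sin_pi_mul_pos h0 h1
  have hcos : cos (π * α) ≤ cos (α * ζ.im) := by
    refine cos_le_cos_of_nonneg_of_le_pi (by positivity) ?_ ?_
    · nlinarith [pi_pos]
    · nlinarith
  have hn : ‖Complex.exp (α * ζ) + lam‖ ^ 2 =
      exp (α * ζ.re) ^ 2 + 2 * exp (α * ζ.re) * lam * cos (α * ζ.im) + lam ^ 2 := by
    rw [Complex.sq_norm, Complex.normSq_apply]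
    simp only [Complex.add_re, Complex.add_im, Complex.exp_re, Complex.exp_im, Complex.re_ofReal_mul,
      Complex.im_ofReal_mul, Complex.ofReal_re, Complex.ofReal_im]
    linear_combination (exp (α * ζ.re)) ^ 2 * sin_sq_add_cos_sq (α * ζ.im)
  refine le_of_sq_le_sq ?_ (norm_nonneg _)
  rw [hn]
  refine (sq_mul_sin_le α lam _).trans ?_
  have : 0 ≤ exp (α * ζ.re) * lam := by positivity
  nlinarith

theorem exp_mul_add_ne_zero {α lam : ℝ} (h0 : 0 < α) (h1 : α < 1) (hl : 0 ≤ lam) {ζ : ℂ}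
    (hy0 : 0 ≤ ζ.im) (hy1 : ζ.im ≤ π) : Complex.exp (α * ζ) + lam ≠ 0 := by
  have hs := sin_pi_mul_pos h0 h1
  rw [← norm_pos_iff]
  exact lt_of_lt_of_le (by positivity) (exp_mul_sin_le_norm h0 h1 hl hy0 hy1)

theorem norm_inv_exp_mul_add_le {α lam : ℝ} (h0 : 0 < α) (h1 : α < 1) (hl : 0 ≤ lam) {ζ : ℂ}
    (hy0 : 0 ≤ ζ.im) (hy1 : ζ.im ≤ π) :
    ‖(Complex.exp (α * ζ) + lam)⁻¹‖ ≤ exp (-(α * ζ.re)) / sin (π * α) := by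
  have hs := sin_pi_mul_pos h0 h1
  rw [norm_inv, exp_neg, inv_eq_one_div, inv_eq_one_div, div_div]
  exact one_div_le_one_div_of_le (by positivity) (exp_mul_sin_le_norm h0 h1 hl hy0 hy1)

/-- The closed strip has height less than the period 2πi, so in the contour integral below the
denominator e^ζ - e^σ has no zero other than σ. -/
theorem exp_eq_exp_ofReal_iff {x : ℝ} {ζ : ℂ} (hy0 : 0 ≤ ζ.im) (hy1 : ζ.im ≤ π)
    (h : Complex.exp ζ = Complex.exp x) : ζ = x := by
  have := Complex.exp_inj_of_neg_pi_lt_of_le_pi (x := ζ) (y := x) (by linarith [pi_pos]) hy1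
    (by simpa using pi_pos) (by simpa using pi_pos.le) h
  exact this

/-- The density is the boundary value of (s^α + lam)⁻¹ on the upper side of the negative axis, s =
e^(x + iπ). -/
theorem im_inv_exp_add {α lam x : ℝ} :
    ((Complex.exp (α * (x + π * Complex.I)) + lam)⁻¹).im = -π * specDens α lam (exp (α * x)) := by
  have e : Complex.exp (α * (x + π * Complex.I)) + lam =
      ((exp (α * x) * cos (π * α) + lam : ℝ) : ℂ) + ((exp (α * x) * sin (π * α) : ℝ) : ℂ)
        * Complex.I := by
    rw [mul_add, Complex.exp_add, show (α : ℂ) * (π * Complex.I) = ((π * α : ℝ) : ℂ) * Complex.I by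
      push_cast; ring, Complex.exp_mul_I]
    push_cast
    ring
  have hn : Complex.normSq (((exp (α * x) * cos (π * α) + lam : ℝ) : ℂ) +
      ((exp (α * x) * sin (π * α) : ℝ) : ℂ) * Complex.I) =
      exp (α * x) ^ 2 + 2 * exp (α * x) * lam * cos (π * α) + lam ^ 2 := by
    rw [Complex.normSq_add_mul_I]
    linear_combination (exp (α * x)) ^ 2 * sin_sq_add_cos_sq (π * α)
  rw [e, Complex.inv_im, hn]
  unfold specDens
  simp only [Complex.add_im, Complex.mul_im, Complex.ofReal_re, Complex.ofReal_im, Complex.I_re,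
    Complex.I_im]
  field_simp
  ring

/-- The rectangle identity for `((e^(αζ) + lam)⁻¹ - F) e^ζ / (e^ζ - s)`, `F` the value at
`ζ = log s`. -/
theorem stieltjes_rect {α lam σ : ℝ} (h0 : 0 < α) (h1 : α < 1) (hl : 0 ≤ lam) {F : ℝ}
    (hF : F = (exp (α * σ) + lam)⁻¹) {M : ℝ} (hM : |σ| < M) :
    π * ∫ x in (-M)..M, specDens α lam (exp (α * x)) * (exp x / (exp x + exp σ)) =
      (∫ y in (0 : ℝ)..π, ((Complex.exp (α * (-M + y * Complex.I)) + lam)⁻¹ - F) *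
        Complex.exp (-M + y * Complex.I) / (Complex.exp (-M + y * Complex.I) - exp σ)).re -
      (∫ y in (0 : ℝ)..π, ((Complex.exp (α * (M + y * Complex.I)) + lam)⁻¹ - F) *
        Complex.exp (M + y * Complex.I) / (Complex.exp (M + y * Complex.I) - exp σ)).re := by
  have hs := sin_pi_mul_pos h0 h1
  set Φ : ℂ → ℂ := fun ζ => (Complex.exp (α * ζ) + lam)⁻¹ with hΦ
  set q : ℂ → ℂ := fun ζ => (Φ ζ - F) * Complex.exp ζ / (Complex.exp ζ - exp σ) with hq
  set S : Set ℂ := {ζ | 0 ≤ ζ.im ∧ ζ.im ≤ π} with hS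
  -- The zero of the denominator lies on the lower edge. Subtracting `F` makes it removable, and the
  -- quotient of `dslope`s is the extension: continuous on the closed rectangle and holomorphic
  -- inside, which is all that Cauchy's theorem needs.
  set Q : ℂ → ℂ := fun ζ => dslope Φ σ ζ / dslope Complex.exp σ ζ * Complex.exp ζ with hQ
  have hΦσ : Φ σ = F := by simp [hΦ, hF]
  have hQq : ∀ ζ, ζ ≠ (σ : ℂ) → Q ζ = q ζ := by
    intro ζ hζ
    have : ζ - σ ≠ 0 := sub_ne_zero.2 hζ
    simp only [hQ, hq]
    rw [dslope_of_ne _ hζ, dslope_of_ne _ hζ, slope_def_field, slope_def_field, hΦσ,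
      div_div_div_cancel_right₀ this, Complex.ofReal_exp]
    ring
  have hΦd : ∀ ζ ∈ S, DifferentiableAt ℂ Φ ζ := by
    intro ζ hζ
    have := exp_mul_add_ne_zero h0 h1 hl hζ.1 hζ.2
    simp only [hΦ]
    fun_prop (disch := assumption)
  have hσS : (σ : ℂ) ∈ S := by simp [hS, pi_pos.le]
  have hne : ∀ ζ ∈ S, dslope Complex.exp σ ζ ≠ 0 := by
    intro ζ hζ
    by_cases h : ζ = σ
    · rw [h, dslope_same]
      simp
    · rw [dslope_of_ne _ h, slope_def_field]
      refine div_ne_zero (sub_ne_zero.2 fun h' => h (exp_eq_exp_ofReal_iff hζ.1 hζ.2 h'))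
        (sub_ne_zero.2 h)
  have hQc : ∀ ζ ∈ S, ContinuousAt Q ζ := by
    intro ζ hζ
    refine ((?_ : ContinuousAt (dslope Φ σ) ζ).div ?_ (hne ζ hζ)).mul (by fun_prop)
    · by_cases h : ζ = σ
      · rw [h, continuousAt_dslope_same]
        exact hΦd _ hσS
      · rw [continuousAt_dslope_of_ne h]
        exact (hΦd _ hζ).continuousAt
    · by_cases h : ζ = σ
      · rw [h, continuousAt_dslope_same]
        exact Complex.differentiable_exp _
      · rw [continuousAt_dslope_of_ne h]
        exact Complex.continuous_exp.continuousAt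
  have hQd : ∀ ζ ∈ S, ζ ≠ σ → DifferentiableAt ℂ Q ζ := by
    intro ζ hζ h
    refine (((differentiableAt_dslope_of_ne h).2 (hΦd _ hζ)).div
      ((differentiableAt_dslope_of_ne h).2 (Complex.differentiable_exp _)) (hne ζ hζ)).mul
      (Complex.differentiable_exp _)
  have hσM := abs_lt.1 hM
  have hM0 : 0 < M := (abs_nonneg _).trans_lt hM
  have rect := Complex.integral_boundary_rect_eq_zero_of_continuousOn_of_differentiableOn Q
    (-M : ℂ) (M + π * Complex.I) ?_ ?_
  rotate_left
  · intro ζ hζ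
    rw [Complex.mem_reProdIm] at hζ
    simp only [Complex.neg_im, Complex.ofReal_im, neg_zero, Complex.add_im, Complex.mul_im,
      Complex.ofReal_re, Complex.I_im, Complex.I_re, mul_one, mul_zero, zero_add, add_zero,
      uIcc_of_le pi_pos.le] at hζ
    exact (hQc ζ hζ.2).continuousWithinAt
  · intro ζ hζ
    rw [Complex.mem_reProdIm] at hζ
    simp only [Complex.neg_im, Complex.ofReal_im, neg_zero, Complex.add_im, Complex.mul_im,
      Complex.ofReal_re, Complex.I_im, Complex.I_re, mul_one, mul_zero, zero_add, add_zero,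
      min_eq_left pi_pos.le, max_eq_right pi_pos.le] at hζ
    refine (hQd ζ ⟨hζ.2.1.le, hζ.2.2.le⟩ ?_).differentiableWithinAt
    rintro rfl
    simpa using hζ.2.1
  simp only [Complex.neg_im, Complex.ofReal_im, neg_zero, Complex.add_im, Complex.mul_im,
    Complex.ofReal_re, Complex.I_im, Complex.I_re, mul_one, mul_zero, zero_add, add_zero,
    Complex.neg_re, Complex.add_re, Complex.mul_re, sub_zero, Complex.ofReal_zero, zero_mul,
    Complex.ofReal_neg] at rect
  have him := congrArg Complex.im rect
  simp only [Complex.add_im, Complex.sub_im, Complex.zero_im, smul_eq_mul,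
    Complex.mul_im, Complex.I_re, Complex.I_im, zero_mul, one_mul, zero_add] at him
  -- On the real axis everything is real, except possibly at the null set {σ}, where the value plays
  -- no role.
  have hbot : (∫ x in (-M)..M, Q x).im = 0 := by
    have hcont : ContinuousOn (fun x : ℝ => Q x) (uIcc (-M) M) := fun x _ =>
      ((hQc x ⟨by simp, by simp [pi_pos.le]⟩).comp
        Complex.continuous_ofReal.continuousAt).continuousWithinAt
    have := Complex.imCLM.intervalIntegral_comp_comm (μ := volume) hcont.intervalIntegrable
    simp only [Complex.imCLM_apply] at this
    rw [← this]
    have h2 : ∀ᵐ x : ℝ, x ∈ uIoc (-M) M → (Q x).im = 0 := by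
      have h3 : ∀ᵐ x : ℝ, x ≠ σ := by simp [ae_iff, measure_singleton]
      filter_upwards [h3] with x hx _
      rw [hQq _ (by exact_mod_cast hx)]
      have : q x = (((exp (α * x) + lam)⁻¹ - F) * exp x / (exp x - exp σ) : ℝ) := by
        simp [hq, hΦ]
      rw [this, Complex.ofReal_im]
    rw [intervalIntegral.integral_congr_ae h2]
    simp
  -- On the line Im ζ = π the exponential is -e^x: the pole term becomes e^x/(e^x + e^σ), real, and
  -- the imaginary part is the density.
  have htop : (∫ x in (-M)..M, Q (x + π * Complex.I)).im =
      -(π * ∫ x in (-M)..M, specDens α lam (exp (α * x)) * (exp x / (exp x + exp σ))) := by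
    have hcont : ContinuousOn (fun x : ℝ => Q (x + π * Complex.I)) (uIcc (-M) M) := fun x _ => by
      refine (ContinuousAt.comp (f := fun x : ℝ => (x + π * Complex.I : ℂ)) (g := Q) (hQc _ ?_)
        (by fun_prop)).continuousWithinAt
      simp [hS, pi_pos.le]
    have := Complex.imCLM.intervalIntegral_comp_comm (μ := volume) hcont.intervalIntegrable
    simp only [Complex.imCLM_apply] at this
    rw [← this, ← intervalIntegral.integral_const_mul, ← intervalIntegral.integral_neg]
    refine intervalIntegral.integral_congr fun x _ => ?_
    have hx : (x + π * Complex.I : ℂ) ≠ σ := by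
      intro h
      have := congrArg Complex.im h
      simp [pi_pos.ne'] at this
    rw [hQq _ hx]
    have e : Complex.exp (x + π * Complex.I) = ((-exp x : ℝ) : ℂ) := by
      rw [Complex.exp_add, Complex.exp_pi_mul_I]; simp
    have e2 : q (x + π * Complex.I) =
        ((Complex.exp (α * (x + π * Complex.I)) + lam)⁻¹ - F) *
          ((exp x / (exp x + exp σ) : ℝ) : ℂ) := by
      simp only [hq, hΦ]
      rw [e, mul_div_assoc, ← Complex.ofReal_sub, ← Complex.ofReal_div,
        show -exp x - exp σ = -(exp x + exp σ) by ring, neg_div_neg_eq]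
    rw [e2, Complex.im_mul_ofReal, Complex.sub_im, Complex.ofReal_im, sub_zero, im_inv_exp_add]
    ring
  have hleft : ∫ y in (0 : ℝ)..π, Q (-M + y * Complex.I) =
      ∫ y in (0 : ℝ)..π, q (-M + y * Complex.I) := by
    refine intervalIntegral.integral_congr fun y _ => hQq _ fun h => ?_
    have := congrArg Complex.re h
    simp at this
    linarith
  have hright : ∫ y in (0 : ℝ)..π, Q (M + y * Complex.I) =
      ∫ y in (0 : ℝ)..π, q (M + y * Complex.I) := by
    refine intervalIntegral.integral_congr fun y _ => hQq _ fun h => ?_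
    have := congrArg Complex.re h
    simp at this
    linarith
  rw [hbot, htop, hleft, hright] at him
  simp only [hq, hΦ] at him
  linarith

theorem integrableOn_specDens_div {α lam s : ℝ} (h0 : 0 < α) (h1 : α < 1) (hs : 0 < s) :
    IntegrableOn (fun r => specDens α lam (r ^ α) / (r + s)) (Ioi 0) := by
  have hm : Measurable fun r => specDens α lam (r ^ α) / (r + s) := by fun_prop
  have hb := fun r hr => abs_specDens_rpow_le (lam := lam) (r := r) h0 h1 hr
  rw [← Ioc_union_Ioi_eq_Ioi (zero_le_one' ℝ)]
  refine IntegrableOn.union ?_ ?_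
  · have := (intervalIntegral.intervalIntegrable_rpow' (a := 0) (b := 1)
      (by linarith : -1 < -α)).1.const_mul (densBound α * s⁻¹)
    refine this.mono' hm.aestronglyMeasurable ?_
    filter_upwards [ae_restrict_mem measurableSet_Ioc] with r hr
    have hr0 := hr.1
    have := densBound_pos h0 h1
    rw [norm_eq_abs, abs_div, abs_of_pos (by linarith : 0 < r + s), div_eq_mul_inv]
    calc _ ≤ densBound α * r ^ (-α) * s⁻¹ := by
          gcongr
          · exact hb r hr0
          · linarith
      _ = _ := by ring
  · have := (integrableOn_Ioi_rpow_of_lt (by linarith : -α - 1 < -1) zero_lt_one).const_mul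
      (densBound α)
    refine this.mono' hm.aestronglyMeasurable ?_
    filter_upwards [ae_restrict_mem measurableSet_Ioi] with r hr
    have hr0 : 0 < r := zero_lt_one.trans hr
    have := densBound_pos h0 h1
    rw [norm_eq_abs, abs_div, abs_of_pos (by linarith : 0 < r + s), rpow_sub hr0, rpow_one,
      ← mul_div_assoc]
    gcongr
    · exact hb r hr0
    · linarith

/-- Cauchy's formula for (z^α + lam)⁻¹ in the plane cut along the negative axis, written in the
logarithmic variable r = e^x so that the contour is a rectangle. As the rectangle grows, the left
edge contributes nothing and the right edge produces the value. -/
theorem integral_specDens_div {α lam s : ℝ} (h0 : 0 < α) (h1 : α < 1) (hl : 0 ≤ lam)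
    (hs : 0 < s) :
    ∫ r in Ioi 0, specDens α lam (r ^ α) / (r + s) = (s ^ α + lam)⁻¹ := by
  have hsin := sin_pi_mul_pos h0 h1
  set F := (s ^ α + lam)⁻¹ with hF
  have hF0 : 0 < F := by positivity
  have hFσ : F = (exp (α * log s) + lam)⁻¹ := by
    rw [hF, rpow_def_of_pos hs, mul_comm α]
  set g : ℝ → ℝ := fun x => specDens α lam (exp (α * x)) * (exp x / (exp x + exp (log s))) with hg
  have hgx : ∀ x, g x = |exp x| • (specDens α lam (exp x ^ α) / (exp x + s)) := by
    intro x
    simp only [hg]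
    rw [exp_log hs, abs_exp, smul_eq_mul, ← exp_mul, mul_comm x α]
    ring
  have hinj : InjOn exp univ := exp_injective.injOn
  have hder : ∀ x ∈ (univ : Set ℝ), HasDerivWithinAt exp (exp x) univ x := fun x _ =>
    (hasDerivAt_exp x).hasDerivWithinAt
  have himg : exp '' univ = Ioi 0 := by rw [image_univ, range_exp]
  have hint : Integrable g := by
    have := (integrableOn_image_iff_integrableOn_abs_deriv_smul MeasurableSet.univ hder hinj
      (fun r => specDens α lam (r ^ α) / (r + s))).1
      (by rw [himg]; exact integrableOn_specDens_div h0 h1 hs)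
    rw [integrableOn_univ] at this
    exact this.congr (Eventually.of_forall fun x => (hgx x).symm)
  have hval : ∫ r in Ioi 0, specDens α lam (r ^ α) / (r + s) = ∫ x, g x := by
    rw [← himg, integral_image_eq_integral_abs_deriv_smul MeasurableSet.univ hder hinj,
      Measure.restrict_univ]
    exact integral_congr_ae (Eventually.of_forall fun x => (hgx x).symm)
  have hlim : Tendsto (fun M : ℝ => ∫ x in (-M)..M, g x) atTop (𝓝 (∫ x, g x)) :=
    intervalIntegral_tendsto_integral hint tendsto_neg_atTop_atBot tendsto_id
  have hlim2 : Tendsto (fun M : ℝ => ∫ x in (-M)..M, g x) atTop (𝓝 F) := by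
    -- The first summand bounds the left edge, the second the deviation of the right edge from its
    -- limit. Both 1 - α > 0 and α > 0 are needed.
    set B : ℝ → ℝ := fun M => 2 / s * (exp (-((1 - α) * M)) / sin (π * α) + F * exp (-M)) +
      2 * (exp (-(α * M)) / sin (π * α) + F * s * exp (-M)) with hB
    have hB0 : Tendsto B atTop (𝓝 0) := by
      have e : ∀ c : ℝ, 0 < c → Tendsto (fun M : ℝ => exp (-(c * M))) atTop (𝓝 0) := fun c hc =>
        tendsto_exp_neg_atTop_nhds_zero.comp (tendsto_id.const_mul_atTop hc)
      have e1 := e 1 one_pos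
      simp only [one_mul] at e1
      have := ((((e (1 - α) (by linarith)).div_const (sin (π * α))).add (e1.const_mul F)).const_mul
        (2 / s)).add
        ((((e α h0).div_const (sin (π * α))).add (e1.const_mul (F * s))).const_mul 2)
      simpa [hB] using this
    refine tendsto_iff_norm_sub_tendsto_zero.2 (squeeze_zero' (g := B)
      (Eventually.of_forall fun _ => norm_nonneg _) ?_ hB0)
    have ev1 : ∀ᶠ M : ℝ in atTop, exp (-M) ≤ s / 2 :=
      (tendsto_exp_neg_atTop_nhds_zero.eventually (ge_mem_nhds (by positivity : 0 < s / 2)))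
    have ev2 : ∀ᶠ M : ℝ in atTop, 2 * s ≤ exp M := tendsto_exp_atTop.eventually_ge_atTop _
    filter_upwards [ev1, ev2, eventually_gt_atTop |log s|] with M hM1 hM2 hM3
    have hr := stieltjes_rect h0 h1 hl hFσ hM3
    rw [exp_log hs] at hr
    have hgM : ∫ x in (-M)..M, specDens α lam (exp (α * x)) * (exp x / (exp x + s)) =
        ∫ x in (-M)..M, g x := by simp only [hg, exp_log hs]
    rw [hgM] at hr
    have expre : ∀ (a y : ℝ), ‖Complex.exp (a + y * Complex.I)‖ = exp a := by
      intro a y; rw [Complex.norm_exp]; simp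
    have hΦ : ∀ a y : ℝ, y ∈ uIoc 0 π → ‖(Complex.exp (α * (a + y * Complex.I)) + lam)⁻¹‖ ≤
        exp (-(α * a)) / sin (π * α) := by
      intro a y hy
      rw [uIoc_of_le pi_pos.le] at hy
      have := norm_inv_exp_mul_add_le (ζ := a + y * Complex.I) h0 h1 hl (by simpa using hy.1.le)
        (by simpa using hy.2)
      simpa using this
    have hleft : ‖∫ y in (0 : ℝ)..π, ((Complex.exp (α * (-M + y * Complex.I)) + lam)⁻¹ - F) *
        Complex.exp (-M + y * Complex.I) / (Complex.exp (-M + y * Complex.I) - s)‖ ≤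
        2 / s * (exp (-((1 - α) * M)) / sin (π * α) + F * exp (-M)) * |π - 0| := by
      refine intervalIntegral.norm_integral_le_of_norm_le_const fun y hy => ?_
      have f1 := hΦ (-M) y hy
      have f2 := expre (-M) y
      rw [Complex.ofReal_neg] at f1 f2
      have f3 : s / 2 ≤ ‖Complex.exp (-M + y * Complex.I) - s‖ := by
        have := norm_sub_norm_le (s : ℂ) (Complex.exp (-M + y * Complex.I))
        rw [norm_sub_rev, f2, Complex.norm_real, norm_of_nonneg hs.le] at this
        linarith
      have f4 : ‖(Complex.exp (α * (-M + y * Complex.I)) + lam)⁻¹ - F‖ ≤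
          exp (-(α * -M)) / sin (π * α) + F := by
        refine (norm_sub_le _ _).trans (add_le_add f1 ?_)
        rw [Complex.norm_real, norm_of_nonneg hF0.le]
      rw [norm_div, norm_mul, f2]
      calc _ ≤ (exp (-(α * -M)) / sin (π * α) + F) * exp (-M) / (s / 2) := by gcongr
        _ = 2 / s * (exp (-(α * -M)) * exp (-M) / sin (π * α) + F * exp (-M)) := by
          field_simp
        _ = _ := by rw [← exp_add]; ring_nf
    -- On the right edge the inverse symbol vanishes and e^ζ/(e^ζ - s) tends to 1, so the integrand
    -- tends to -F.
    have hright : ‖(∫ y in (0 : ℝ)..π, ((Complex.exp (α * (M + y * Complex.I)) + lam)⁻¹ - F) *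
        Complex.exp (M + y * Complex.I) / (Complex.exp (M + y * Complex.I) - s)) + π * F‖ ≤
        2 * (exp (-(α * M)) / sin (π * α) + F * s * exp (-M)) * |π - 0| := by
      have hd : ∀ y : ℝ, exp M / 2 ≤ ‖Complex.exp (M + y * Complex.I) - s‖ := by
        intro y
        have := norm_sub_norm_le (Complex.exp (M + y * Complex.I)) (s : ℂ)
        rw [expre, Complex.norm_real, norm_of_nonneg hs.le] at this
        linarith
      have hd0 : ∀ y : ℝ, Complex.exp (M + y * Complex.I) - s ≠ 0 := fun y => by
        rw [← norm_pos_iff]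
        exact lt_of_lt_of_le (by positivity) (hd y)
      have hcont : ContinuousOn (fun y : ℝ => ((Complex.exp (α * (M + y * Complex.I)) + lam)⁻¹ - F) *
        Complex.exp (M + y * Complex.I) / (Complex.exp (M + y * Complex.I) - s)) (uIcc 0 π) := by
        intro y hy
        rw [uIcc_of_le pi_pos.le] at hy
        have := exp_mul_add_ne_zero (ζ := M + y * Complex.I) h0 h1 hl (by simpa using hy.1)
          (by simpa using hy.2)
        have := hd0 y
        refine ContinuousAt.continuousWithinAt ?_
        fun_prop (disch := assumption)
      have hc : (π * F : ℂ) = ∫ _ in (0 : ℝ)..π, (F : ℂ) := by simp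
      rw [hc, ← intervalIntegral.integral_add hcont.intervalIntegrable (by simp)]
      refine intervalIntegral.norm_integral_le_of_norm_le_const fun y hy => ?_
      have f1 := hΦ M y hy
      have f2 := expre M y
      have e1 : ((Complex.exp (α * (M + y * Complex.I)) + lam)⁻¹ - F) *
          Complex.exp (M + y * Complex.I) / (Complex.exp (M + y * Complex.I) - s) + F =
          ((Complex.exp (α * (M + y * Complex.I)) + lam)⁻¹ * Complex.exp (M + y * Complex.I)
            - F * s) / (Complex.exp (M + y * Complex.I) - s) := by
        rw [div_add' _ _ _ (hd0 y)]
        ring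
      rw [e1, norm_div]
      have f4 : ‖(Complex.exp (α * (M + y * Complex.I)) + lam)⁻¹ * Complex.exp (M + y * Complex.I)
            - F * s‖ ≤ exp (-(α * M)) / sin (π * α) * exp M + F * s := by
        refine (norm_sub_le _ _).trans (add_le_add ?_ ?_)
        · rw [norm_mul, f2]
          gcongr
        · rw [← Complex.ofReal_mul, Complex.norm_real, norm_of_nonneg (by positivity)]
      calc _ ≤ (exp (-(α * M)) / sin (π * α) * exp M + F * s) / (exp M / 2) := by
            gcongr
            exact hd y
        _ = _ := by
          rw [exp_neg M]
          field_simp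
    have hre : π * (∫ x in (-M)..M, g x) - π * F =
        (∫ y in (0 : ℝ)..π, ((Complex.exp (α * (-M + y * Complex.I)) + lam)⁻¹ - F) *
        Complex.exp (-M + y * Complex.I) / (Complex.exp (-M + y * Complex.I) - s)).re -
        ((∫ y in (0 : ℝ)..π, ((Complex.exp (α * (M + y * Complex.I)) + lam)⁻¹ - F) *
        Complex.exp (M + y * Complex.I) / (Complex.exp (M + y * Complex.I) - s)) + π * F).re := by
      rw [hr, Complex.add_re, ← Complex.ofReal_mul, Complex.ofReal_re]
      ring
    have g1 := (Complex.abs_re_le_norm _).trans hleft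
    have g2 := (Complex.abs_re_le_norm _).trans hright
    have g3 : |π * (∫ x in (-M)..M, g x) - π * F| ≤ B M * π := by
      rw [hre]
      refine (abs_sub _ _).trans ?_
      rw [sub_zero, abs_of_pos pi_pos] at g1 g2
      simp only [hB]
      linarith
    rw [← mul_sub, abs_mul, abs_of_pos pi_pos, mul_comm] at g3
    exact le_of_mul_le_mul_right g3 pi_pos
  rw [hval]
  exact tendsto_nhds_unique hlim hlim2

/-! ## The Laplace transform of the relaxation kernel -/

theorem integrable_relaxKernel_prod {α lam s : ℝ} (h0 : 0 < α) (h1 : α < 1) (hs : 0 < s) :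
    Integrable (fun z : ℝ × ℝ => exp (-(s * z.1)) * (exp (-(z.2 * z.1)) * specDens α lam (z.2 ^ α)))
      ((volume.restrict (Ioi 0)).prod (volume.restrict (Ioi 0))) := by
  have hm : Measurable (fun z : ℝ × ℝ =>
      exp (-(s * z.1)) * (exp (-(z.2 * z.1)) * specDens α lam (z.2 ^ α))) := by fun_prop
  rw [integrable_prod_iff' hm.aestronglyMeasurable]
  have e : ∀ t r : ℝ, exp (-(s * t)) * (exp (-(r * t)) * specDens α lam (r ^ α)) =
      exp (-(r + s) * t) * specDens α lam (r ^ α) := by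
    intro t r
    rw [← mul_assoc, ← exp_add]; ring_nf
  simp only [e]
  refine ⟨?_, ?_⟩
  · filter_upwards [ae_restrict_mem measurableSet_Ioi] with r (hr : 0 < r)
    exact (integrableOn_exp_mul_Ioi (by linarith) _).mul_const _
  · refine (integrableOn_specDens_div (lam := lam) h0 h1 hs).congr_fun (fun r (hr : 0 < r) => ?_)
      measurableSet_Ioi
    simp only [norm_mul, norm_eq_abs, abs_exp]
    rw [integral_mul_const, integral_exp_mul_Ioi (by linarith),
      abs_of_nonneg (specDens_nonneg h0 h1 (rpow_pos_of_pos hr α))]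
    simp only [mul_zero, exp_zero]
    rw [neg_div_neg_eq]
    ring

theorem integrableOn_exp_mul_relaxKernel {α lam s : ℝ} (h0 : 0 < α) (h1 : α < 1) (hs : 0 < s) :
    IntegrableOn (fun t => exp (-(s * t)) * relaxKernel α lam t) (Ioi 0) := by
  have := (integrable_relaxKernel_prod (lam := lam) h0 h1 hs).integral_prod_left
  simp only [integral_const_mul] at this
  exact this

/-- A Laplace transform applied twice is a Stieltjes transform, by Fubini. -/
theorem integral_exp_mul_relaxKernel {α lam s : ℝ} (h0 : 0 < α) (h1 : α < 1) (hl : 0 ≤ lam)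
    (hs : 0 < s) :
    ∫ t in Ioi 0, exp (-(s * t)) * relaxKernel α lam t = (s ^ α + lam)⁻¹ := by
  have hswap := integral_integral_swap (f := fun t r : ℝ =>
    exp (-(s * t)) * (exp (-(r * t)) * specDens α lam (r ^ α)))
    (integrable_relaxKernel_prod (lam := lam) h0 h1 hs)
  simp only [integral_const_mul] at hswap
  rw [← integral_specDens_div h0 h1 hl hs]
  refine hswap.trans (setIntegral_congr_fun measurableSet_Ioi fun r (hr : 0 < r) => ?_)
  have e : ∀ t : ℝ, exp (-(s * t)) * (exp (-(r * t)) * specDens α lam (r ^ α)) =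
      exp (-(r + s) * t) * specDens α lam (r ^ α) := by
    intro t
    rw [← mul_assoc, ← exp_add]; ring_nf
  simp only [e]
  rw [integral_mul_const, integral_exp_mul_Ioi (by linarith)]
  simp only [mul_zero, exp_zero]
  rw [neg_div_neg_eq]
  ring

/-! ## Uniqueness for the Laplace transform -/

/-- In the variable y = e^(-x) the hypothesis says that all moments of an integrable density on (0,
1) vanish; Weierstrass approximation then kills it. Only the values of the Laplace transform at
positive integers enter. -/
theorem ae_eq_zero_of_integral_exp_neg_eq_zero {h : ℝ → ℝ}
    (hi : IntegrableOn (fun x => exp (-x) * h x) (Ioi 0))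
    (h0 : ∀ n : ℕ, ∫ x in Ioi (0 : ℝ), exp (-x) ^ n * (exp (-x) * h x) = 0) :
    ∀ᵐ x ∂(volume.restrict (Ioi (0 : ℝ))), h x = 0 := by
  have hbd : ∀ (u : ℝ → ℝ), Measurable u → ∀ C, (∀ x, 0 < x → |u x| ≤ C) →
      IntegrableOn (fun x => u x * (exp (-x) * h x)) (Ioi 0) := by
    intro u hu C hC
    refine hi.bdd_mul (c := C) hu.aestronglyMeasurable ?_
    filter_upwards [ae_restrict_mem measurableSet_Ioi] with x hx
    exact hC x hx
  have hpow : ∀ n : ℕ, IntegrableOn (fun x => exp (-x) ^ n * (exp (-x) * h x)) (Ioi 0) := by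
    intro n
    refine hbd _ (by fun_prop) 1 fun x hx => ?_
    rw [abs_of_pos (by positivity)]
    exact pow_le_one₀ (exp_pos _).le (exp_le_one_iff.2 (by linarith))
  have hpoly : ∀ p : Polynomial ℝ, ∫ x in Ioi (0 : ℝ), p.eval (exp (-x)) * (exp (-x) * h x) = 0 := by
    intro p
    simp only [Polynomial.eval_eq_sum_range, Finset.sum_mul]
    rw [integral_finsetSum]
    · refine Finset.sum_eq_zero fun i _ => ?_
      simp only [mul_assoc]
      rw [integral_const_mul, h0, mul_zero]
    · intro i _
      simp only [mul_assoc]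
      exact (hpow i).const_mul _
  have hcont : ∀ g : ℝ → ℝ, Continuous (fun x => g x) →
      ∫ x in Ioi (0 : ℝ), g (exp (-x)) * (exp (-x) * h x) = 0 := by
    intro g hg
    set I := ∫ x in Ioi (0 : ℝ), |exp (-x) * h x| with hI
    have hI0 : 0 ≤ I := integral_nonneg fun _ => abs_nonneg _
    have key : ∀ ε > 0, |∫ x in Ioi (0 : ℝ), g (exp (-x)) * (exp (-x) * h x)| ≤ ε * I := by
      intro ε hε
      obtain ⟨p, hp⟩ := exists_polynomial_near_of_continuousOn 0 1 g hg.continuousOn ε hε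
      have hmem : ∀ x : ℝ, 0 < x → exp (-x) ∈ Icc (0 : ℝ) 1 := fun x hx =>
        ⟨(exp_pos _).le, exp_le_one_iff.2 (by linarith)⟩
      obtain ⟨C, hC⟩ := isCompact_Icc.exists_bound_of_continuousOn
        (s := Icc (0 : ℝ) 1) hg.continuousOn
      obtain ⟨C', hC'⟩ := isCompact_Icc.exists_bound_of_continuousOn
        (s := Icc (0 : ℝ) 1) p.continuous.continuousOn
      have i1 := hbd (fun x => g (exp (-x))) (by fun_prop) C fun x hx => hC _ (hmem x hx)
      have i2 := hbd (fun x => p.eval (exp (-x))) (p.continuous.measurable.comp (by fun_prop)) C'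
        fun x hx => hC' _ (hmem x hx)
      have e : ∫ x in Ioi (0 : ℝ), g (exp (-x)) * (exp (-x) * h x) =
          ∫ x in Ioi (0 : ℝ), (g (exp (-x)) * (exp (-x) * h x) -
            p.eval (exp (-x)) * (exp (-x) * h x)) := by
        rw [integral_sub i1 i2, hpoly, sub_zero]
      rw [e, hI, ← integral_const_mul, ← norm_eq_abs]
      refine norm_integral_le_of_norm_le (hi.abs.const_mul ε) ?_
      filter_upwards [ae_restrict_mem measurableSet_Ioi] with x hx
      rw [← sub_mul, norm_mul, norm_eq_abs, norm_eq_abs, abs_sub_comm]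
      have := (hp _ (hmem x hx)).le
      gcongr
    refine abs_eq_zero.1 (le_antisymm (le_of_forall_pos_le_add fun ε hε => ?_) (abs_nonneg _))
    refine (key (ε / (I + 1)) (by positivity)).trans ?_
    rw [zero_add, div_mul_eq_mul_div, div_le_iff₀ (by positivity)]
    nlinarith
  have hz := (isOpen_Ioi (a := (0 : ℝ))).ae_eq_zero_of_integral_contDiff_smul_eq_zero (U := Ioi (0 : ℝ))
    (f := fun x => exp (-x) * h x) (μ := volume.restrict (Ioi 0)) ?_ ?_
  · filter_upwards [hz, ae_restrict_mem measurableSet_Ioi] with x hx hx'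
    exact (mul_eq_zero.1 (hx hx')).resolve_left (exp_pos _).ne'
  · exact hi.locallyIntegrable.locallyIntegrableOn _
  · intro ψ hψ hψc hψs
    -- The test function is carried over by x = -log y. Its support is bounded, so the result
    -- vanishes near y = 0 and the extension by zero is continuous.
    have hg : Continuous (fun y : ℝ => if 0 < y then ψ (-log y) else 0) := by
      rw [continuous_iff_continuousAt]
      intro y
      rcases lt_trichotomy y 0 with hy | rfl | hy
      · refine continuousAt_const.congr (f := fun _ => (0 : ℝ)) ?_
        filter_upwards [Iio_mem_nhds hy] with z (hz : z < 0)
        rw [if_neg hz.not_gt]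
      · obtain ⟨R, hR⟩ := hψc.isCompact.isBounded.subset_closedBall 0
        refine continuousAt_const.congr (f := fun _ => (0 : ℝ)) ?_
        have hev : Iio (exp (-R)) ∈ 𝓝 (0 : ℝ) := Iio_mem_nhds (exp_pos (-R))
        filter_upwards [hev] with z (hz : z < exp (-R))
        split_ifs with h
        · symm
          refine image_eq_zero_of_notMem_tsupport fun hmem => ?_
          have h1 := hR hmem
          rw [Metric.mem_closedBall, dist_zero_right, norm_eq_abs] at h1
          have h2 : log z < -R := by rwa [log_lt_iff_lt_exp h]
          linarith [le_abs_self (-log z)]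
        · rfl
      · have : ContinuousAt (fun y => ψ (-log y)) y :=
          hψ.continuous.continuousAt.comp (continuousAt_log hy.ne').neg
        refine this.congr ?_
        filter_upwards [Ioi_mem_nhds hy] with z (hz : 0 < z)
        rw [if_pos hz]
    refine Eq.trans ?_ (hcont _ hg)
    refine setIntegral_congr_fun measurableSet_Ioi fun x _ => ?_
    simp [exp_pos]

/-! ## The resolvent identity -/

/-- The kernel of the operator `∂ₜ^α + lam` acting on the derivative of a function vanishing
at zero. -/
noncomputable def caputoKernel (α lam x : ℝ) : ℝ := (Gamma (1 - α))⁻¹ * x ^ (-α) + lam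

theorem integrableOn_exp_mul_caputoKernel {α lam s : ℝ} (h1 : α < 1) (hs : 0 < s) :
    IntegrableOn (fun t => exp (-(s * t)) * caputoKernel α lam t) (Ioi 0) := by
  have i1 := (integrableOn_rpow_mul_exp_neg (p := -α) (by linarith) hs).const_mul (Gamma (1 - α))⁻¹
  have i2 := (integrableOn_exp_mul_Ioi (a := -s) (by linarith) 0).const_mul lam
  refine IntegrableOn.congr_fun (i1.add i2) (fun t _ => ?_) measurableSet_Ioi
  simp only [Pi.add_apply, caputoKernel]
  ring_nf

theorem integral_exp_mul_caputoKernel {α lam s : ℝ} (h1 : α < 1) (hs : 0 < s) :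
    ∫ t in Ioi 0, exp (-(s * t)) * caputoKernel α lam t = (s ^ α + lam) / s := by
  have i1 := (integrableOn_rpow_mul_exp_neg (p := -α) (by linarith) hs).const_mul (Gamma (1 - α))⁻¹
  have i2 := (integrableOn_exp_mul_Ioi (a := -s) (by linarith) 0).const_mul lam
  have e : ∀ t ∈ Ioi (0 : ℝ), exp (-(s * t)) * caputoKernel α lam t =
      (Gamma (1 - α))⁻¹ * (t ^ (-α) * exp (-(t * s))) + lam * exp (-s * t) := by
    intro t _
    simp only [caputoKernel]
    ring_nf
  rw [setIntegral_congr_fun measurableSet_Ioi e, integral_add i1 i2, integral_const_mul,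
    integral_const_mul, integral_rpow_mul_exp_neg (by linarith) hs,
    integral_exp_mul_Ioi (by linarith)]
  have hG : Gamma (1 - α) ≠ 0 := (Gamma_pos_of_pos (by linarith)).ne'
  rw [show -α + 1 = 1 - α by ring, inv_mul_cancel_left₀ hG, neg_sub, rpow_sub hs, rpow_one]
  simp
  ring

/-- The Laplace transforms (s^α + lam)⁻¹ and (s^α + lam)/s multiply to 1/s, the transform of the
constant 1. -/
theorem relaxKernel_resolvent {α lam : ℝ} (h0 : 0 < α) (h1 : α < 1) (hl : 0 ≤ lam) :
    ∀ᵐ x ∂(volume.restrict (Ioi (0 : ℝ))),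
      ∫ t in 0..x, relaxKernel α lam t * caputoKernel α lam (x - t) = 1 := by
  set H : ℝ → ℝ := fun x => ∫ t in 0..x, relaxKernel α lam t * caputoKernel α lam (x - t) with hH
  have econv : ∀ s x : ℝ, ∫ t in 0..x, ContinuousLinearMap.mul ℝ ℝ
      (exp (-(s * t)) * relaxKernel α lam t) (exp (-(s * (x - t))) * caputoKernel α lam (x - t)) =
      exp (-(s * x)) * H x := by
    intro s x
    rw [hH, ← intervalIntegral.integral_const_mul]
    refine intervalIntegral.integral_congr fun t _ => ?_
    have : exp (-(s * x)) = exp (-(s * t)) * exp (-(s * (x - t))) := by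
      rw [← exp_add]; ring_nf
    simp only [ContinuousLinearMap.mul_apply', this]
    ring
  have hint : ∀ s : ℝ, 0 < s → IntegrableOn (fun x => exp (-(s * x)) * H x) (Ioi 0) := by
    intro s hs
    have := integrable_posConvolution (integrableOn_exp_mul_relaxKernel (lam := lam) h0 h1 hs)
      (integrableOn_exp_mul_caputoKernel (lam := lam) h1 hs) (ContinuousLinearMap.mul ℝ ℝ)
    unfold posConvolution at this
    rw [integrable_indicator_iff measurableSet_Ioi] at this
    simpa only [econv] using this
  have hval : ∀ s : ℝ, 0 < s → ∫ x in Ioi 0, exp (-(s * x)) * H x = s⁻¹ := by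
    intro s hs
    have := integral_posConvolution (integrableOn_exp_mul_relaxKernel (lam := lam) h0 h1 hs)
      (integrableOn_exp_mul_caputoKernel (lam := lam) h1 hs) (ContinuousLinearMap.mul ℝ ℝ)
    simp only [econv] at this
    rw [this, integral_exp_mul_relaxKernel h0 h1 hl hs, integral_exp_mul_caputoKernel h1 hs,
      ContinuousLinearMap.mul_apply']
    have : s ^ α + lam ≠ 0 := by positivity
    field_simp
  have i1 : ∀ s : ℝ, 0 < s → IntegrableOn (fun x : ℝ => exp (-(s * x))) (Ioi 0) := fun s hs => by
    simpa using integrableOn_exp_mul_Ioi (a := -s) (by linarith) 0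
  have v1 : ∀ s : ℝ, 0 < s → ∫ x in Ioi (0 : ℝ), exp (-(s * x)) = s⁻¹ := fun s hs => by
    have := integral_exp_mul_Ioi (a := -s) (by linarith) 0
    simp only [neg_mul] at this
    rw [this]
    simp
  have := ae_eq_zero_of_integral_exp_neg_eq_zero (h := fun x => H x - 1) ?_ ?_
  · filter_upwards [this] with x hx
    linarith
  · have := (hint 1 one_pos).sub (i1 1 one_pos)
    refine this.congr_fun (fun x _ => ?_) measurableSet_Ioi
    simp only [Pi.sub_apply, one_mul]
    ring
  · intro n
    have hn : (0 : ℝ) < n + 1 := by positivity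
    have e : ∀ x : ℝ, exp (-x) ^ n * (exp (-x) * (H x - 1)) =
        exp (-((n + 1) * x)) * H x - exp (-((n + 1) * x)) := by
      intro x
      have : exp (-((n + 1) * x)) = exp (-x) ^ n * exp (-x) := by
        rw [← exp_nat_mul, ← exp_add]; ring_nf
      rw [this]; ring
    simp only [e]
    rw [integral_sub (hint _ hn) (i1 _ hn), hval _ hn, v1 _ hn, sub_self]

/-! ## Associativity of the convolution over a triangle -/

/-- Fubini on the triangle x < s < t. Since `a` and `b` are nonnegative, absolute integrability over
the triangle reduces to that of `g` times the convolution of `a` and `b`, which is what the last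
hypothesis asks. -/
theorem integral_triangle_swap {a b g : ℝ → ℝ} {t : ℝ} (ha : Measurable a)
    (hb : Measurable b) (ha0 : ∀ x, 0 < x → 0 ≤ a x) (hb0 : ∀ x, 0 < x → 0 ≤ b x)
    (hab : ∀ᵐ z ∂(volume.restrict (Ioo 0 t)),
      IntervalIntegrable (fun s => a s * b (z - s)) volume 0 z)
    (hg : AEStronglyMeasurable g (volume.restrict (Ioo 0 t)))
    (hgc : IntegrableOn (fun x => g x * ∫ s in 0..(t - x), a s * b (t - x - s)) (Ioo 0 t)) :
    ∫ s in Ioo 0 t, a (t - s) * ∫ x in Ioo 0 s, b (s - x) * g x =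
      ∫ x in Ioo 0 t, g x * ∫ s in 0..(t - x), a s * b (t - x - s) := by
  set G : ℝ → ℝ → ℝ := fun s x => (Ioi x).indicator (fun s => a (t - s) * b (s - x)) s * g x with hG
  have hab' : ∀ᵐ x ∂(volume.restrict (Ioo 0 t)),
      IntervalIntegrable (fun s => a s * b (t - x - s)) volume 0 (t - x) := by
    have hmp : MeasurePreserving (fun x : ℝ => t - x) (volume.restrict (Ioo 0 t))
        (volume.restrict (Ioo 0 t)) := by
      have := ((volume : Measure ℝ).measurePreserving_sub_left t).restrict_preimage
        (s := Ioo 0 t) measurableSet_Ioo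
      simpa using this
    exact hmp.quasiMeasurePreserving.ae hab
  have hsec : ∀ x, (fun s => (Ioi x).indicator (fun s => a (t - s) * b (s - x)) s) =
      (Ioi x).indicator (fun s => a (t - s) * b (s - x)) := fun x => rfl
  have hset : ∀ x, 0 < x → Ioi x ∩ Ioo 0 t = Ioo x t := by
    intro x hx; ext s; simp only [mem_inter_iff, mem_Ioi, mem_Ioo]
    exact ⟨fun h => ⟨h.1, h.2.2⟩, fun h => ⟨h.1, hx.trans h.1, h.2⟩⟩
  have hii : ∀ x, IntervalIntegrable (fun s => a s * b (t - x - s)) volume 0 (t - x) →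
      IntervalIntegrable (fun s => a (t - s) * b (s - x)) volume x t := by
    intro x h
    have := (h.comp_sub_left t).symm
    simp only [sub_zero, sub_sub_cancel] at this
    refine this.congr fun s _ => ?_
    congr 2
    ring
  have hintx : ∀ x ∈ Ioo 0 t, ∫ s in Ioo 0 t, (Ioi x).indicator (fun s => a (t - s) * b (s - x)) s =
      ∫ s in 0..(t - x), a s * b (t - x - s) := by
    intro x hx
    rw [integral_indicator measurableSet_Ioi, Measure.restrict_restrict measurableSet_Ioi,
      hset x hx.1, ← integral_Ioc_eq_integral_Ioo, ← intervalIntegral.integral_of_le hx.2.le]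
    have := intervalIntegral.integral_comp_sub_left (a := x) (b := t)
      (fun s => a s * b (t - x - s)) t
    rw [sub_self] at this
    rw [← this]
    refine intervalIntegral.integral_congr fun s _ => ?_
    congr 2
    ring
  have hmeas : AEStronglyMeasurable (Function.uncurry G)
      ((volume.restrict (Ioo 0 t)).prod (volume.restrict (Ioo 0 t))) := by
    have h1 : Measurable fun z : ℝ × ℝ => (Ioi z.2).indicator (fun s => a (t - s) * b (s - z.2)) z.1
        := by
      have : (fun z : ℝ × ℝ => (Ioi z.2).indicator (fun s => a (t - s) * b (s - z.2)) z.1) =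
          {z : ℝ × ℝ | z.2 < z.1}.indicator fun z => a (t - z.1) * b (z.1 - z.2) := by
        ext z; simp [indicator]
      rw [this]
      refine Measurable.indicator ?_ (measurableSet_lt measurable_snd measurable_fst)
      fun_prop
    exact h1.aestronglyMeasurable.mul hg.comp_snd
  have hGint : Integrable (Function.uncurry G)
      ((volume.restrict (Ioo 0 t)).prod (volume.restrict (Ioo 0 t))) := by
    rw [integrable_prod_iff' hmeas]
    refine ⟨?_, ?_⟩
    · filter_upwards [hab', ae_restrict_mem measurableSet_Ioo] with x hx hxt
      simp only [Function.uncurry, hG]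
      refine Integrable.mul_const ?_ _
      rw [integrable_indicator_iff measurableSet_Ioi, IntegrableOn,
        Measure.restrict_restrict measurableSet_Ioi, hset x hxt.1]
      exact (intervalIntegrable_iff_integrableOn_Ioo_of_le hxt.2.le).1 (hii x hx)
    · refine IntegrableOn.congr_fun hgc.norm (fun x hx => ?_) measurableSet_Ioo
      simp only [Function.uncurry, hG, norm_mul]
      rw [integral_mul_const, mul_comm, ← hintx x hx]
      congr 1
      rw [norm_of_nonneg]
      · refine setIntegral_congr_fun measurableSet_Ioo fun s hs => ?_
        rw [norm_of_nonneg]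
        refine indicator_apply_nonneg fun hxs => ?_
        exact mul_nonneg (ha0 _ (by linarith [hs.2])) (hb0 _ (sub_pos.2 hxs))
      · refine setIntegral_nonneg measurableSet_Ioo fun s hs => ?_
        refine indicator_apply_nonneg fun hxs => ?_
        exact mul_nonneg (ha0 _ (by linarith [hs.2])) (hb0 _ (sub_pos.2 hxs))
  have hswap := integral_integral_swap hGint
  have hL : ∫ s in Ioo 0 t, ∫ x in Ioo 0 t, G s x =
      ∫ s in Ioo 0 t, a (t - s) * ∫ x in Ioo 0 s, b (s - x) * g x := by
    refine setIntegral_congr_fun measurableSet_Ioo fun s hs => ?_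
    have e : ∀ x, G s x = (Iio s).indicator (fun x => a (t - s) * (b (s - x) * g x)) x := by
      intro x
      simp only [hG, indicator, mem_Ioi, mem_Iio]
      split_ifs <;> ring
    simp only [e]
    rw [integral_indicator measurableSet_Iio, Measure.restrict_restrict measurableSet_Iio,
      integral_const_mul]
    have : Iio s ∩ Ioo 0 t = Ioo 0 s := by
      ext x; simp only [mem_inter_iff, mem_Iio, mem_Ioo]
      exact ⟨fun h => ⟨h.2.1, h.1⟩, fun h => ⟨h.2, h.1, h.2.trans hs.2⟩⟩
    rw [this]
  rw [← hL, hswap]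
  refine setIntegral_congr_fun measurableSet_Ioo fun x hx => ?_
  simp only [hG]
  rw [integral_mul_const, hintx x hx, mul_comm]

/-- The variation of constants formula for the fractional relaxation equation. -/
theorem integral_eq_integral_relaxKernel_mul {α lam T : ℝ} (h0 : 0 < α) (h1 : α < 1)
    (hl : 0 ≤ lam) {g F : ℝ → ℝ} (hg : IntegrableOn g (Ioo 0 T))
    (heq : ∀ᵐ t ∂(volume.restrict (Ioo 0 T)),
      ∫ s in Ioo 0 t, caputoKernel α lam (t - s) * g s = F t) {t : ℝ} (htT : t ≤ T) :
    ∫ s in Ioo 0 t, g s = ∫ s in Ioo 0 t, relaxKernel α lam (t - s) * F s := by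
  have hsub : Ioo 0 t ⊆ Ioo 0 T := Ioo_subset_Ioo_right htT
  have hres : ∀ᵐ x ∂(volume.restrict (Ioo 0 t)),
      ∫ s in 0..x, relaxKernel α lam s * caputoKernel α lam (x - s) = 1 :=
    ae_restrict_of_ae_restrict_of_subset Ioo_subset_Ioi_self (relaxKernel_resolvent h0 h1 hl)
  have hres' : ∀ᵐ x ∂(volume.restrict (Ioo 0 t)),
      ∫ s in 0..(t - x), relaxKernel α lam s * caputoKernel α lam (t - x - s) = 1 := by
    have hmp : MeasurePreserving (fun x : ℝ => t - x) (volume.restrict (Ioo 0 t))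
        (volume.restrict (Ioo 0 t)) := by
      have := ((volume : Measure ℝ).measurePreserving_sub_left t).restrict_preimage
        (s := Ioo 0 t) measurableSet_Ioo
      simpa using this
    exact hmp.quasiMeasurePreserving.ae hres
  have hgt := hg.mono_set hsub
  -- Convolve the equation with the relaxation kernel: the two kernels together act as 1, leaving
  -- the integral of `g`.
  have key := integral_triangle_swap (a := relaxKernel α lam) (b := caputoKernel α lam) (g := g) (by fun_prop) (by unfold caputoKernel; fun_prop) (fun _ _ => relaxKernel_nonneg h0 h1)
    (fun x hx => by
      have := Gamma_pos_of_pos (by linarith : 0 < 1 - α)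
      unfold caputoKernel; positivity) ?_ hgt.aestronglyMeasurable ?_
  · have e1 : ∫ x in Ioo 0 t, g x * ∫ s in 0..(t - x), relaxKernel α lam s *
        caputoKernel α lam (t - x - s) = ∫ x in Ioo 0 t, g x := by
      refine integral_congr_ae ?_
      filter_upwards [hres'] with x hx
      rw [hx, mul_one]
    rw [← e1, ← key]
    refine integral_congr_ae ?_
    filter_upwards [ae_restrict_of_ae_restrict_of_subset hsub heq] with s hs
    rw [hs]
  · filter_upwards [hres] with z hz
    -- Integrability is free: the integral of a non-integrable function is 0 by convention, but here
    -- it equals 1.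
    by_contra hcon
    rw [intervalIntegral.integral_undef hcon] at hz
    exact zero_ne_one hz
  · refine hgt.congr ?_
    filter_upwards [hres'] with x hx
    rw [hx, mul_one]

/-! ## The kernel of the fractional Crank–Nicolson scheme -/

/-- The generating series of the convolution quadrature weights. -/
noncomputable def cqSeries (α : ℝ) : PowerSeries ℝ := PowerSeries.mk (cqWeight α)

/-- The averaging polynomial `1 - α / 2 + α / 2 ξ` of the scheme. -/
noncomputable def cnPoly (α : ℝ) : PowerSeries ℝ :=
  PowerSeries.C (1 - α / 2) + PowerSeries.C (α / 2) * PowerSeries.X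

/-- The symbol of the scheme for the eigenvalue `μ`. -/
noncomputable def cnSeries (α μ : ℝ) : PowerSeries ℝ := cqSeries α + PowerSeries.C μ * cnPoly α

/-- The discrete resolvent kernel of the scheme. -/
noncomputable def cnKernel (α μ : ℝ) (n : ℕ) : ℝ :=
  PowerSeries.coeff n (cnPoly α * (cnSeries α μ)⁻¹)

theorem constantCoeff_cnSeries (α μ : ℝ) :
    PowerSeries.constantCoeff (cnSeries α μ) = 1 + μ * (1 - α / 2) := by
  have : cqWeight α 0 = 1 := by simp [cqWeight]
  simp [cnSeries, cqSeries, cnPoly, ← PowerSeries.coeff_zero_eq_constantCoeff_apply, this,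
    -PowerSeries.coeff_zero_eq_constantCoeff]

theorem constantCoeff_cnSeries_pos {α μ : ℝ} (h1 : α < 1) (hμ : 0 ≤ μ) :
    0 < PowerSeries.constantCoeff (cnSeries α μ) := by
  rw [constantCoeff_cnSeries]
  have : 0 ≤ μ * (1 - α / 2) := mul_nonneg hμ (by linarith)
  linarith

theorem cnSeries_mul_cnKernel {α μ : ℝ} (h1 : α < 1) (hμ : 0 ≤ μ) :
    cnSeries α μ * PowerSeries.mk (cnKernel α μ) = cnPoly α := by
  have : PowerSeries.mk (cnKernel α μ) = cnPoly α * (cnSeries α μ)⁻¹ := by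
    ext n; simp [cnKernel]
  rw [this, mul_left_comm, PowerSeries.mul_inv_cancel _ (constantCoeff_cnSeries_pos h1 hμ).ne',
    mul_one]

theorem coeff_cnPoly (α : ℝ) (n : ℕ) : PowerSeries.coeff n (cnPoly α) =
    if n = 0 then 1 - α / 2 else if n = 1 then α / 2 else 0 := by
  rcases n with _ | _ | n
  · simp [cnPoly]
  · simp [cnPoly, PowerSeries.coeff_C]
  · simp [cnPoly]

theorem coeff_cnSeries (α μ : ℝ) (n : ℕ) : PowerSeries.coeff n (cnSeries α μ) =
    cqWeight α n + μ * PowerSeries.coeff n (cnPoly α) := by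
  simp [cnSeries, cqSeries]

/-- Sequences with the same convolution against a series with nonzero constant coefficient
agree. -/
theorem eq_of_convolution_eq {R : Type*} [Field R] {A : PowerSeries R}
    (hA : PowerSeries.constantCoeff A ≠ 0) {U V : ℕ → R} {N : ℕ}
    (h : ∀ n ≤ N, ∑ j ∈ Finset.range (n + 1), PowerSeries.coeff (n - j) A * U j =
      ∑ j ∈ Finset.range (n + 1), PowerSeries.coeff (n - j) A * V j) :
    ∀ n ≤ N, U n = V n := by
  intro n
  induction n using Nat.strong_induction_on with
  | _ n ih =>
    intro hn
    have h' := h n hn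
    rw [Finset.sum_range_succ, Finset.sum_range_succ] at h'
    have : ∑ j ∈ Finset.range n, PowerSeries.coeff (n - j) A * U j =
        ∑ j ∈ Finset.range n, PowerSeries.coeff (n - j) A * V j :=
      Finset.sum_congr rfl fun j hj => by
        rw [ih j (Finset.mem_range.1 hj) ((Finset.mem_range.1 hj).le.trans hn)]
    rw [this, add_right_inj, Nat.sub_self, PowerSeries.coeff_zero_eq_constantCoeff_apply] at h'
    exact mul_left_cancel₀ hA h'

theorem coeff_mul_mk_eq_sum_range {R : Type*} [CommSemiring R] (A : PowerSeries R) (U : ℕ → R)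
    (n : ℕ) : PowerSeries.coeff n (A * PowerSeries.mk U) =
      ∑ j ∈ Finset.range (n + 1), PowerSeries.coeff (n - j) A * U j := by
  rw [mul_comm, PowerSeries.coeff_mul, Finset.Nat.sum_antidiagonal_eq_sum_range_succ_mk]
  refine Finset.sum_congr rfl fun j _ => ?_
  simp [mul_comm]

theorem cnKernel_recursion {α μ : ℝ} (h1 : α < 1) (hμ : 0 ≤ μ) (n : ℕ) :
    cnKernel α μ n = (1 + μ * (1 - α / 2))⁻¹ * (PowerSeries.coeff n (cnPoly α) -
      ∑ j ∈ Finset.range n, (cqWeight α (n - j) +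
        μ * PowerSeries.coeff (n - j) (cnPoly α)) * cnKernel α μ j) := by
  have h := congrArg (PowerSeries.coeff n) (cnSeries_mul_cnKernel h1 hμ)
  rw [coeff_mul_mk_eq_sum_range, Finset.sum_range_succ, Nat.sub_self,
    PowerSeries.coeff_zero_eq_constantCoeff_apply, constantCoeff_cnSeries] at h
  simp only [coeff_cnSeries] at h
  have hc := constantCoeff_cnSeries_pos h1 hμ
  rw [constantCoeff_cnSeries] at hc
  rw [eq_inv_mul_iff_mul_eq₀ hc.ne']
  linarith

/-- Serves to reach μ = 0 as a limit, where the contour representation is not available. -/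
theorem continuousOn_cnKernel {α : ℝ} (h1 : α < 1) (n : ℕ) :
    ContinuousOn (fun μ => cnKernel α μ n) (Ici 0) := by
  induction n using Nat.strong_induction_on with
  | _ n ih =>
    refine ContinuousOn.congr ?_ fun μ hμ => cnKernel_recursion h1 hμ n
    refine ContinuousOn.mul (ContinuousOn.inv₀ (by fun_prop) fun μ hμ => ?_)
      (continuousOn_const.sub (continuousOn_finsetSum _ fun j hj =>
        ContinuousOn.mul (by fun_prop) (ih j (Finset.mem_range.1 hj))))
    have := constantCoeff_cnSeries_pos h1 hμ
    rw [constantCoeff_cnSeries] at this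
    exact this.ne'

/-! ## The symbol in the complex plane -/

/-- In the variable `η = log (1 - ξ)`, the symbol `(1 - ξ)^α + μ (1 - α / 2 + α / 2 ξ)`. -/
noncomputable def cnSymbol (α μ : ℝ) (η : ℂ) : ℂ :=
  Complex.exp (α * η) + μ * (1 - α / 2 * Complex.exp η)

/-- In the variable `η = log (1 - ξ)`, the quotient `(1 - α / 2 + α / 2 ξ) (1 - ξ)^(-α)`. -/
noncomputable def cnRatio (α : ℝ) (η : ℂ) : ℂ :=
  Complex.exp (-(α * η)) * (1 - α / 2 * Complex.exp η)

theorem cnSymbol_eq (α μ : ℝ) (η : ℂ) :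
    cnSymbol α μ η = Complex.exp (α * η) * (1 + μ * cnRatio α η) := by
  unfold cnSymbol cnRatio
  have : Complex.exp (α * η) * Complex.exp (-(α * η)) = 1 := by rw [← Complex.exp_add]; simp
  linear_combination (-μ * (1 - α / 2 * Complex.exp η)) * this

theorem cnRatio_eq (α : ℝ) (η : ℂ) : cnRatio α η =
    Complex.exp (((-α : ℝ) : ℂ) * η) - ((α / 2 : ℝ) : ℂ) * Complex.exp (((1 - α : ℝ) : ℂ) * η) := by
  have : Complex.exp (((1 - α : ℝ) : ℂ) * η) = Complex.exp (-(α * η)) * Complex.exp η := by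
    rw [← Complex.exp_add]; push_cast; ring_nf
  rw [this, cnRatio]
  push_cast
  ring_nf

theorem cnRatio_im (α : ℝ) (η : ℂ) : (cnRatio α η).im =
    -(exp (-α * η.re) * sin (α * η.im) + α / 2 * (exp ((1 - α) * η.re) * sin ((1 - α) * η.im)))
      := by
  rw [cnRatio_eq]
  simp only [Complex.sub_im, Complex.im_ofReal_mul, Complex.exp_im, Complex.re_ofReal_mul]
  rw [neg_mul, neg_mul α η.im, sin_neg]
  ring

/-- The two terms of the imaginary part carry sin(α Im η) and sin((1 - α) Im η), of equal sign for
|Im η| ≤ π, so they cannot cancel off the real axis. On the real axis the value is positive exactly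
while e^η < 2/α. -/
theorem cnRatio_mem_slitPlane {α : ℝ} (h0 : 0 < α) (h1 : α < 1) {η : ℂ} (hη : |η.im| ≤ π)
    (h : η.im = 0 → exp η.re < 2 / α) : cnRatio α η ∈ Complex.slitPlane := by
  rw [Complex.mem_slitPlane_iff]
  rcases lt_trichotomy η.im 0 with hy | hy | hy
  · right
    have h2 : -π ≤ η.im := (abs_le.1 hη).1
    have s1 : sin (α * η.im) < 0 := sin_neg_of_neg_of_neg_pi_lt (by nlinarith) (by nlinarith [pi_pos])
    have s2 : sin ((1 - α) * η.im) < 0 :=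
      sin_neg_of_neg_of_neg_pi_lt (by nlinarith) (by nlinarith [pi_pos])
    rw [cnRatio_im]
    have t1 := mul_neg_of_pos_of_neg (exp_pos (-α * η.re)) s1
    have t2 := mul_neg_of_pos_of_neg (half_pos h0)
      (mul_neg_of_pos_of_neg (exp_pos ((1 - α) * η.re)) s2)
    linarith
  · left
    have h2 := h hy
    have e : η = (η.re : ℂ) := Complex.ext rfl (by simp [hy])
    have e2 : cnRatio α η = ((exp (-(α * η.re)) * (1 - α / 2 * exp η.re) : ℝ) : ℂ) := by
      rw [e, cnRatio]; push_cast; simp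
    rw [e2, Complex.ofReal_re]
    rw [lt_div_iff₀ h0] at h2
    exact mul_pos (exp_pos _) (by linarith)
  · right
    have h2 : η.im ≤ π := (abs_le.1 hη).2
    have s1 : 0 < sin (α * η.im) := sin_pos_of_pos_of_lt_pi (by positivity) (by nlinarith [pi_pos])
    have s2 : 0 < sin ((1 - α) * η.im) :=
      sin_pos_of_pos_of_lt_pi (mul_pos (by linarith) hy) (by nlinarith [pi_pos])
    rw [cnRatio_im]
    have t1 := mul_pos (exp_pos (-α * η.re)) s1
    have t2 := mul_pos (half_pos h0) (mul_pos (exp_pos ((1 - α) * η.re)) s2)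
    linarith

/-- A zero would force `cnRatio` = -1/μ on the negative real axis. This is the unconditional
stability of the scheme: no restriction on μ. -/
theorem cnSymbol_ne_zero {α μ : ℝ} (h0 : 0 < α) (h1 : α < 1) (hμ : 0 ≤ μ) {η : ℂ}
    (hη : |η.im| ≤ π) (h : η.im = 0 → exp η.re < 2 / α) : cnSymbol α μ η ≠ 0 := by
  rw [cnSymbol_eq]
  refine mul_ne_zero (Complex.exp_ne_zero _) fun h2 => ?_
  have h3 := cnRatio_mem_slitPlane h0 h1 hη h
  have hre := congrArg Complex.re h2
  have him := congrArg Complex.im h2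
  simp only [Complex.add_re, Complex.one_re, Complex.re_ofReal_mul, Complex.zero_re] at hre
  simp only [Complex.add_im, Complex.one_im, Complex.im_ofReal_mul, Complex.zero_im, zero_add] at him
  have hμ' : μ ≠ 0 := by rintro rfl; simp at hre
  have him' := (mul_eq_zero.1 him).resolve_left hμ'
  rw [Complex.mem_slitPlane_iff] at h3
  rcases h3 with h3 | h3
  · nlinarith
  · exact h3 him'

/-! ## The kernel as the Taylor coefficients of the inverse symbol -/

theorem eq_of_eventually_hasSum {c d : ℕ → ℂ} {f : ℂ → ℂ}
    (hc : ∀ᶠ z in 𝓝 (0 : ℂ), HasSum (fun n => z ^ n * c n) (f z))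
    (hd : ∀ᶠ z in 𝓝 (0 : ℂ), HasSum (fun n => z ^ n * d n) (f z)) : c = d := by
  have h1 : HasFPowerSeriesAt f (FormalMultilinearSeries.ofScalars ℂ c) 0 := by
    rw [hasFPowerSeriesAt_iff]
    simpa [FormalMultilinearSeries.coeff_ofScalars] using hc
  have h2 : HasFPowerSeriesAt f (FormalMultilinearSeries.ofScalars ℂ d) 0 := by
    rw [hasFPowerSeriesAt_iff]
    simpa [FormalMultilinearSeries.coeff_ofScalars] using hd
  have h3 := h1.eq_formalMultilinearSeries h2
  ext n
  have := congrArg (fun p => FormalMultilinearSeries.coeff p n) h3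
  simpa [FormalMultilinearSeries.coeff_ofScalars] using this

theorem hasSum_cqWeight (α : ℝ) {z : ℂ} (hz : ‖z‖ < 1) :
    HasSum (fun n => z ^ n * (cqWeight α n : ℂ)) ((1 - z) ^ (α : ℂ)) ∧
      Summable fun n => ‖z ^ n * (cqWeight α n : ℂ)‖ := by
  have h := Complex.one_add_cpow_hasFPowerSeriesOnBall_zero (a := (α : ℂ))
  have hmem : -z ∈ Metric.eball (0 : ℂ) 1 := by
    rw [← ENNReal.ofReal_one, Metric.eball_ofReal]
    simpa using hz
  have e : ∀ n, (binomialSeries ℂ (α : ℂ) n fun _ => -z) = z ^ n * (cqWeight α n : ℂ) := by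
    intro n
    rw [binomialSeries_apply]
    simp only [List.ofFn_const, List.prod_replicate, smul_eq_mul, cqWeight]
    rw [neg_pow]
    push_cast
    ring
  constructor
  · have := h.hasSum hmem
    simp only [e, zero_add] at this
    simpa [sub_eq_add_neg] using this
  · have := (binomialSeries ℂ (α : ℂ)).summable_norm_apply (x := -z)
      (Metric.eball_subset_eball h.r_le hmem)
    simpa only [e] using this

/-- The inverse symbol of the scheme. -/
noncomputable def cnInv (α μ : ℝ) (ξ : ℂ) : ℂ :=
  (1 - α / 2 * (1 - ξ)) / ((1 - ξ) ^ (α : ℂ) + μ * (1 - α / 2 * (1 - ξ)))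

theorem cnInv_den_eq {α μ : ℝ} {ξ : ℂ} (h : ξ ≠ 1) :
    (1 - ξ) ^ (α : ℂ) + μ * (1 - α / 2 * (1 - ξ)) = cnSymbol α μ (Complex.log (1 - ξ)) := by
  have : 1 - ξ ≠ 0 := sub_ne_zero.2 h.symm
  rw [cnSymbol, Complex.exp_log this, Complex.cpow_def_of_ne_zero this, mul_comm (α : ℂ)]

/-- Inside the unit disc |1 - ξ| < 2 < 2/α, so `cnSymbol_ne_zero` applies. -/
theorem cnInv_den_ne_zero {α μ : ℝ} (h0 : 0 < α) (h1 : α < 1) (hμ : 0 ≤ μ) {ξ : ℂ}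
    (hξ : ‖ξ‖ < 1) : (1 - ξ) ^ (α : ℂ) + μ * (1 - α / 2 * (1 - ξ)) ≠ 0 := by
  have hne : ξ ≠ 1 := by rintro rfl; simp at hξ
  have hne' : 1 - ξ ≠ 0 := sub_ne_zero.2 hne.symm
  rw [cnInv_den_eq hne]
  refine cnSymbol_ne_zero h0 h1 hμ ?_ fun _ => ?_
  · rw [Complex.log_im]
    exact Complex.abs_arg_le_pi _
  · rw [Complex.log_re, exp_log (norm_pos_iff.2 hne'), lt_div_iff₀ h0]
    have := norm_sub_le (1 : ℂ) ξ
    rw [norm_one] at this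
    nlinarith [norm_nonneg (1 - ξ)]

theorem differentiableAt_cnInv {α μ : ℝ} (h0 : 0 < α) (h1 : α < 1) (hμ : 0 ≤ μ) {ξ : ℂ}
    (hξ : ‖ξ‖ < 1) : DifferentiableAt ℂ (cnInv α μ) ξ := by
  have hs : 1 - ξ ∈ Complex.slitPlane := by
    left
    have := Complex.re_le_norm ξ
    simp only [Complex.sub_re, Complex.one_re]
    linarith
  unfold cnInv
  refine DifferentiableAt.div (by fun_prop) (DifferentiableAt.add ?_ (by fun_prop))
    (cnInv_den_ne_zero h0 h1 hμ hξ)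
  exact DifferentiableAt.cpow (by fun_prop) (by fun_prop) hs

/-- The link between formal and analytic power series. The Taylor coefficients of `cnInv`, via a
Cauchy product, and `cnKernel`, by definition, satisfy the same convolution equation against
`cnSeries`, whose constant coefficient is nonzero; hence they agree. -/
theorem cauchyPowerSeries_cnInv {α μ : ℝ} (h0 : 0 < α) (h1 : α < 1) (hμ : 0 ≤ μ) {r : NNReal}
    (hr0 : 0 < r) (hr : r < 1) (n : ℕ) :
    (cauchyPowerSeries (cnInv α μ) 0 r).coeff n = cnKernel α μ n ∧
    ∀ z : ℂ, ‖z‖ < r → HasSum (fun n => z ^ n * (cnKernel α μ n : ℂ)) (cnInv α μ z) := by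
  have hr' : (r : ℝ) < 1 := by exact_mod_cast hr
  have hd : DifferentiableOn ℂ (cnInv α μ) (Metric.closedBall 0 r) := fun z hz =>
    (differentiableAt_cnInv h0 h1 hμ ((mem_closedBall_zero_iff.1 hz).trans_lt hr')
      ).differentiableWithinAt
  have hps := hd.hasFPowerSeriesOnBall hr0
  set p := cauchyPowerSeries (cnInv α μ) 0 r
  have hsum : ∀ z : ℂ, ‖z‖ < r → HasSum (fun n => z ^ n * p.coeff n) (cnInv α μ z) ∧
      Summable fun n => ‖z ^ n * p.coeff n‖ := by
    intro z hz
    have hmem : z ∈ Metric.eball (0 : ℂ) r := by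
      rw [Metric.mem_eball, edist_zero_right, ← ofReal_norm, ← ENNReal.ofReal_coe_nnreal]
      exact (ENNReal.ofReal_lt_ofReal_iff (by exact_mod_cast hr0)).2 hz
    have e : ∀ n, (p n fun _ => z) = z ^ n * p.coeff n := by
      intro n; rw [FormalMultilinearSeries.apply_eq_pow_smul_coeff, smul_eq_mul]
    constructor
    · have := hps.hasSum hmem
      simpa only [e, zero_add] using this
    · have := p.summable_norm_apply (x := z) (Metric.eball_subset_eball hps.r_le hmem)
      simpa only [e] using this
  set A : ℕ → ℂ := fun n => (PowerSeries.coeff n (cnSeries α μ) : ℝ)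
  have hA : ∀ z : ℂ, ‖z‖ < 1 → HasSum (fun n => z ^ n * A n)
      ((1 - z) ^ (α : ℂ) + μ * (1 - α / 2 * (1 - z))) ∧ Summable fun n => ‖z ^ n * A n‖ := by
    intro z hz
    obtain ⟨s1, s2⟩ := hasSum_cqWeight α hz
    have e : ∀ n, z ^ n * A n = z ^ n * (cqWeight α n : ℂ) +
        μ * (z ^ n * (PowerSeries.coeff n (cnPoly α) : ℝ)) := by
      intro n
      simp only [A, coeff_cnSeries]
      push_cast
      ring
    have hfin : ∀ n ∉ Finset.range 2, z ^ n * ((PowerSeries.coeff n (cnPoly α) : ℝ) : ℂ) = 0 := by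
      intro n hn
      rw [Finset.mem_range, not_lt] at hn
      rw [coeff_cnPoly, if_neg (by omega), if_neg (by omega)]
      simp
    have s3 : HasSum (fun n => z ^ n * ((PowerSeries.coeff n (cnPoly α) : ℝ) : ℂ))
        (1 - α / 2 * (1 - z)) := by
      have := hasSum_sum_of_ne_finset_zero (L := SummationFilter.unconditional ℕ) hfin
      convert this using 1
      simp [Finset.sum_range_succ, coeff_cnPoly]
      ring
    constructor
    · simp only [e]
      exact s1.add (s3.mul_left _)
    · simp only [e]
      refine Summable.of_nonneg_of_le (fun _ => norm_nonneg _) (fun n => norm_add_le _ _)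
        (s2.add ?_)
      refine summable_of_ne_finset_zero (s := Finset.range 2) fun n hn => ?_
      rw [hfin n hn]; simp
  have hprod : ∀ᶠ z in 𝓝 (0 : ℂ), HasSum (fun n => z ^ n *
      ∑ kl ∈ Finset.HasAntidiagonal.antidiagonal n, A kl.1 * p.coeff kl.2) (1 - α / 2 * (1 - z)) := by
    filter_upwards [Metric.ball_mem_nhds (0 : ℂ) (by exact_mod_cast hr0 : (0 : ℝ) < r)] with z hz
    rw [mem_ball_zero_iff] at hz
    have hz1 := hz.trans hr'
    obtain ⟨a1, a2⟩ := hA z hz1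
    obtain ⟨p1, p2⟩ := hsum z hz
    have hs := (summable_norm_sum_mul_antidiagonal_of_summable_norm a2 p2).of_norm
    have ht := tsum_mul_tsum_eq_tsum_sum_antidiagonal_of_summable_norm a2 p2
    rw [a1.tsum_eq, p1.tsum_eq, cnInv, mul_div_cancel₀ _ (cnInv_den_ne_zero h0 h1 hμ hz1)] at ht
    rw [ht]
    have e : ∀ n, ∑ kl ∈ Finset.HasAntidiagonal.antidiagonal n, z ^ kl.1 * A kl.1 * (z ^ kl.2 * p.coeff kl.2) =
        z ^ n * ∑ kl ∈ Finset.HasAntidiagonal.antidiagonal n, A kl.1 * p.coeff kl.2 := by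
      intro n
      rw [Finset.mul_sum]
      refine Finset.sum_congr rfl fun kl hkl => ?_
      rw [← Finset.HasAntidiagonal.mem_antidiagonal.1 hkl, pow_add]
      ring
    simp only [e] at hs ⊢
    exact hs.hasSum
  have hpoly : ∀ᶠ z in 𝓝 (0 : ℂ), HasSum (fun n => z ^ n *
      ((PowerSeries.coeff n (cnPoly α) : ℝ) : ℂ)) (1 - α / 2 * (1 - z)) := by
    refine Eventually.of_forall fun z => ?_
    have hfin : ∀ n ∉ Finset.range 2, z ^ n * ((PowerSeries.coeff n (cnPoly α) : ℝ) : ℂ) = 0 := by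
      intro n hn
      rw [Finset.mem_range, not_lt] at hn
      rw [coeff_cnPoly, if_neg (by omega), if_neg (by omega)]
      simp
    have := hasSum_sum_of_ne_finset_zero (L := SummationFilter.unconditional ℕ) hfin
    convert this using 1
    simp [Finset.sum_range_succ, coeff_cnPoly]
    ring
  have hconv := eq_of_eventually_hasSum hprod hpoly
  have hcoef : ∀ n, p.coeff n = cnKernel α μ n := by
    have hu := fun N => eq_of_convolution_eq (A := PowerSeries.mk A) (U := fun n => p.coeff n)
      (V := fun n => (cnKernel α μ n : ℂ)) (N := N) ?_ ?_
    · exact fun n => hu n n le_rfl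
    · have := constantCoeff_cnSeries_pos h1 hμ
      rw [← PowerSeries.coeff_zero_eq_constantCoeff_apply, PowerSeries.coeff_mk]
      simp only [A]
      rw [PowerSeries.coeff_zero_eq_constantCoeff_apply]
      exact_mod_cast this.ne'
    · intro n _
      have e1 : ∑ j ∈ Finset.range (n + 1), A (n - j) * p.coeff j =
          ((PowerSeries.coeff n (cnPoly α) : ℝ) : ℂ) := by
        have := congrFun hconv n
        rw [← this, ← Finset.Nat.sum_antidiagonal_swap,
          Finset.Nat.sum_antidiagonal_eq_sum_range_succ_mk]
        rfl
      have e2 : ∑ j ∈ Finset.range (n + 1), A (n - j) * (cnKernel α μ j : ℂ) =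
          ((PowerSeries.coeff n (cnPoly α) : ℝ) : ℂ) := by
        have := congrArg (PowerSeries.coeff n) (cnSeries_mul_cnKernel h1 hμ)
        rw [coeff_mul_mk_eq_sum_range] at this
        rw [← this]
        push_cast
        rfl
      simp only [PowerSeries.coeff_mk]
      rw [e1, e2]
  refine ⟨hcoef n, fun z hz => ?_⟩
  have := (hsum z hz).1
  simpa only [hcoef] using this

theorem hasSum_cnKernel {α μ : ℝ} (h0 : 0 < α) (h1 : α < 1) (hμ : 0 ≤ μ) {z : ℂ} (hz : ‖z‖ < 1) :
    HasSum (fun n => z ^ n * (cnKernel α μ n : ℂ)) (cnInv α μ z) := by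
  obtain ⟨r, hr1, hr2⟩ := exists_between hz
  have hr0 : 0 < r := (norm_nonneg z).trans_lt hr1
  lift r to NNReal using hr0.le
  exact (cauchyPowerSeries_cnInv h0 h1 hμ (by exact_mod_cast hr0) (by exact_mod_cast hr2) 0).2 z hr1

/-! ## Contour representation of the discrete kernel -/

/-- The branch of `log (1 - ξ)` on the closed upper half plane, continuous from above on the
cut `(1, ∞)`. -/
noncomputable def logUpper (ξ : ℂ) : ℂ :=
  Complex.log (Complex.I * (1 - ξ)) - (π / 2 : ℝ) * Complex.I

/-- The branch of `(1 - ξ) ^ α` on the closed upper half plane. -/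
noncomputable def powUpper (α : ℝ) (ξ : ℂ) : ℂ :=
  Complex.exp (-(α * (π / 2 : ℝ) * Complex.I)) * (Complex.I * (1 - ξ)) ^ (α : ℂ)

/-- The inverse symbol on the closed upper half plane. -/
noncomputable def cnInvUpper (α μ : ℝ) (ξ : ℂ) : ℂ :=
  (1 - α / 2 * (1 - ξ)) / (powUpper α ξ + μ * (1 - α / 2 * (1 - ξ)))

theorem I_mul_one_sub_re (ξ : ℂ) : (Complex.I * (1 - ξ)).re = ξ.im := by simp

theorem I_mul_one_sub_ne_zero {ξ : ℂ} (h : ξ ≠ 1) : Complex.I * (1 - ξ) ≠ 0 :=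
  mul_ne_zero Complex.I_ne_zero (sub_ne_zero.2 h.symm)

theorem I_mul_one_sub_mem_slitPlane {ξ : ℂ} (h : ξ ≠ 1) (hi : 0 ≤ ξ.im) :
    Complex.I * (1 - ξ) ∈ Complex.slitPlane := by
  rw [Complex.mem_slitPlane_iff, I_mul_one_sub_re]
  rcases hi.lt_or_eq with h2 | h2
  · exact Or.inl h2
  · right
    intro h3
    refine I_mul_one_sub_ne_zero h (Complex.ext ?_ h3)
    rw [I_mul_one_sub_re, ← h2, Complex.zero_re]

theorem exp_logUpper {ξ : ℂ} (h : ξ ≠ 1) : Complex.exp (logUpper ξ) = 1 - ξ := by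
  rw [logUpper, Complex.exp_sub, Complex.exp_log (I_mul_one_sub_ne_zero h)]
  push_cast
  rw [Complex.exp_pi_div_two_mul_I]
  field_simp

theorem exp_mul_logUpper (α : ℝ) {ξ : ℂ} (h : ξ ≠ 1) :
    Complex.exp (α * logUpper ξ) = powUpper α ξ := by
  rw [logUpper, powUpper, Complex.cpow_def_of_ne_zero (I_mul_one_sub_ne_zero h), ← Complex.exp_add]
  congr 1
  ring

theorem cnInvUpper_den_eq {α μ : ℝ} {ξ : ℂ} (h : ξ ≠ 1) :
    powUpper α ξ + μ * (1 - α / 2 * (1 - ξ)) = cnSymbol α μ (logUpper ξ) := by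
  rw [cnSymbol, exp_logUpper h, exp_mul_logUpper α h]

theorem logUpper_im_mem {ξ : ℂ} (hi : 0 ≤ ξ.im) : logUpper ξ ∈ {η : ℂ | -π ≤ η.im ∧ η.im ≤ 0} := by
  have h := Complex.abs_arg_le_pi_div_two_iff.2 (by rwa [I_mul_one_sub_re] :
    0 ≤ (Complex.I * (1 - ξ)).re)
  rw [abs_le] at h
  simp only [logUpper, mem_ofPred_eq, Complex.sub_im, Complex.log_im, Complex.im_ofReal_mul,
    Complex.I_im]
  constructor <;> linarith [h.1, h.2]

/-- Radii up to 1/α > 1 are allowed because |1 - ξ| ≤ 1 + 1/α < 2/α. This room beyond the unit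
circle is what makes the outer arc of the contour exponentially small in `n`. -/
theorem cnRatio_logUpper_mem {α : ℝ} (h0 : 0 < α) (h1 : α < 1) {ξ : ℂ} (h : ξ ≠ 1)
    (hi : 0 ≤ ξ.im) (hn : ‖ξ‖ ≤ 1 / α) : cnRatio α (logUpper ξ) ∈ Complex.slitPlane := by
  have h2 := logUpper_im_mem hi
  refine cnRatio_mem_slitPlane h0 h1 (abs_le.2 ⟨h2.1, h2.2.trans pi_pos.le⟩) fun _ => ?_
  rw [← Complex.norm_exp, exp_logUpper h]
  have := norm_sub_le (1 : ℂ) ξ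
  rw [norm_one] at this
  have h3 : 1 < 1 / α := by rw [lt_div_iff₀ h0]; linarith
  calc ‖1 - ξ‖ ≤ 1 + 1 / α := by linarith
    _ < 1 / α + 1 / α := by linarith
    _ = 2 / α := by ring

/-- At the branch point ξ = 1 the denominator equals μ, hence the strict positivity of μ here and in
the contour argument. -/
theorem cnInvUpper_den_ne_zero {α μ : ℝ} (h0 : 0 < α) (h1 : α < 1) (hμ : 0 < μ) {ξ : ℂ}
    (hi : 0 ≤ ξ.im) (hn : ‖ξ‖ ≤ 1 / α) : powUpper α ξ + μ * (1 - α / 2 * (1 - ξ)) ≠ 0 := by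
  by_cases h : ξ = 1
  · have hα : (α : ℂ) ≠ 0 := by exact_mod_cast h0.ne'
    have hμ' : (μ : ℂ) ≠ 0 := by exact_mod_cast hμ.ne'
    subst h
    simpa [powUpper, Complex.zero_cpow hα] using hμ'
  · have h2 := logUpper_im_mem hi
    rw [cnInvUpper_den_eq h]
    refine cnSymbol_ne_zero h0 h1 hμ.le (abs_le.2 ⟨h2.1, h2.2.trans pi_pos.le⟩) fun _ => ?_
    rw [← Complex.norm_exp, exp_logUpper h]
    have := norm_sub_le (1 : ℂ) ξ
    rw [norm_one] at this
    have h3 : 1 < 1 / α := by rw [lt_div_iff₀ h0]; linarith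
    calc ‖1 - ξ‖ ≤ 1 + 1 / α := by linarith
      _ < 1 / α + 1 / α := by linarith
      _ = 2 / α := by ring

/-- Multiplication by i moves the base into the closed right half plane, where the power is
continuous, including at 0 because α > 0. -/
theorem continuousAt_powUpper {α : ℝ} (h0 : 0 < α) {ξ : ℂ} (hi : 0 ≤ ξ.im) :
    ContinuousAt (powUpper α) ξ := by
  unfold powUpper
  refine continuousAt_const.mul ?_
  refine ContinuousAt.comp (f := fun ξ : ℂ => Complex.I * (1 - ξ)) (g := fun z => z ^ (α : ℂ)) ?_
    (by fun_prop)
  refine Complex.continuousAt_cpow_const_of_re_pos (Or.inl ?_) (by simpa using h0)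
  rwa [I_mul_one_sub_re]

theorem continuousAt_cnInvUpper {α μ : ℝ} (h0 : 0 < α) (h1 : α < 1) (hμ : 0 < μ) {ξ : ℂ}
    (hi : 0 ≤ ξ.im) (hn : ‖ξ‖ ≤ 1 / α) : ContinuousAt (cnInvUpper α μ) ξ := by
  unfold cnInvUpper
  refine ContinuousAt.div (by fun_prop) ?_ (cnInvUpper_den_ne_zero h0 h1 hμ hi hn)
  exact (continuousAt_powUpper h0 hi).add (by fun_prop)

theorem differentiableAt_cnInvUpper {α μ : ℝ} (h0 : 0 < α) (h1 : α < 1) (hμ : 0 < μ) {ξ : ℂ}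
    (h : ξ ≠ 1) (hi : 0 ≤ ξ.im) (hn : ‖ξ‖ ≤ 1 / α) : DifferentiableAt ℂ (cnInvUpper α μ) ξ := by
  unfold cnInvUpper
  refine DifferentiableAt.div (by fun_prop) (DifferentiableAt.add ?_ (by fun_prop))
    (cnInvUpper_den_ne_zero h0 h1 hμ hi hn)
  unfold powUpper
  refine DifferentiableAt.const_mul ?_ _
  exact DifferentiableAt.cpow (by fun_prop) (by fun_prop) (I_mul_one_sub_mem_slitPlane h hi)

/-- The two branches agree in the upper half of the unit disc. -/
theorem cnInvUpper_eq {α μ : ℝ} {ξ : ℂ} (hi : 0 ≤ ξ.im) (hn : ‖ξ‖ < 1) :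
    cnInvUpper α μ ξ = cnInv α μ ξ := by
  have hne : ξ ≠ 1 := by rintro rfl; simp at hn
  have hne' : 1 - ξ ≠ 0 := sub_ne_zero.2 hne.symm
  have hre : 0 < (1 - ξ).re := by
    have := Complex.re_le_norm ξ
    simp only [Complex.sub_re, Complex.one_re]
    linarith
  have hlog : logUpper ξ = Complex.log (1 - ξ) := by
    have ha := abs_lt.1 (Complex.abs_arg_lt_pi_div_two_iff.2 (Or.inl hre))
    have hneg : Complex.arg (1 - ξ) ≤ 0 := by
      rcases hi.lt_or_eq with h | h
      · exact (Complex.arg_neg_iff.2 (by simpa using h)).le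
      · refine (Complex.arg_eq_zero_iff.2 ⟨hre.le, by simp [← h]⟩).le
    rw [logUpper, Complex.log_mul Complex.I_ne_zero hne', Complex.log_I]
    · push_cast; ring
    · rw [Complex.arg_I]
      constructor <;> linarith [ha.1, ha.2, pi_pos]
  rw [cnInvUpper, cnInv, cnInvUpper_den_eq hne, cnInv_den_eq hne, hlog]

theorem powUpper_ofReal_of_lt {α x : ℝ} (hx : x < 1) : powUpper α x = ((1 - x) ^ α : ℝ) := by
  have hx' : 0 < 1 - x := by linarith
  have hne : (x : ℂ) ≠ 1 := by exact_mod_cast hx.ne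
  have e : (1 - (x : ℂ)) = ((1 - x : ℝ) : ℂ) := by push_cast; ring
  have hlog : logUpper x = (log (1 - x) : ℝ) := by
    rw [logUpper, e, mul_comm, Complex.log_ofReal_mul hx' Complex.I_ne_zero, Complex.log_I]
    push_cast; ring
  rw [← exp_mul_logUpper α hne, hlog, rpow_def_of_pos hx']
  push_cast
  ring_nf

theorem powUpper_ofReal_of_gt {α x : ℝ} (hx : 1 < x) :
    powUpper α x = ((x - 1) ^ α : ℝ) * Complex.exp (-(π * α : ℝ) * Complex.I) := by
  have hx' : 0 < x - 1 := by linarith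
  have hne : (x : ℂ) ≠ 1 := by exact_mod_cast hx.ne'
  have e : Complex.I * (1 - (x : ℂ)) = ((x - 1 : ℝ) : ℂ) * -Complex.I := by push_cast; ring
  have hlog : logUpper x = (log (x - 1) : ℝ) - π * Complex.I := by
    rw [logUpper, e, Complex.log_ofReal_mul hx' (neg_ne_zero.2 Complex.I_ne_zero), Complex.log_neg_I]
    push_cast; ring
  rw [← exp_mul_logUpper α hne, hlog, rpow_def_of_pos hx', Complex.ofReal_exp, ← Complex.exp_add]
  congr 1
  push_cast
  ring

theorem cnInvUpper_ofReal_im_of_lt {α μ x : ℝ} (hx : x < 1) : (cnInvUpper α μ x).im = 0 := by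
  rw [cnInvUpper, powUpper_ofReal_of_lt hx]
  have : (1 - α / 2 * (1 - (x : ℂ))) / (((1 - x) ^ α : ℝ) + μ * (1 - α / 2 * (1 - (x : ℂ)))) =
    (((1 - α / 2 * (1 - x)) / ((1 - x) ^ α + μ * (1 - α / 2 * (1 - x))) : ℝ) : ℂ) := by
    push_cast; ring_nf
  rw [this, Complex.ofReal_im]

/-- The modulus of `(1 - ξ)^α / (1 - α / 2 + α / 2 ξ)` on the cut, at `ξ = e^x`. -/
noncomputable def cnBranch (α x : ℝ) : ℝ := (exp x - 1) ^ α / (1 + α / 2 * (exp x - 1))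

/-- On the upper side of the cut (1 - ξ)^α has argument -πα, so after division by the averaging
polynomial the same density appears as for the continuous kernel, with `cnBranch` in place of r^α.
This makes the two kernels comparable. -/
theorem cnInvUpper_ofReal_im_of_gt {α μ x : ℝ} (h0 : 0 < α) (hx : 0 < x) :
    (cnInvUpper α μ (exp x : ℝ)).im = π * specDens α μ (cnBranch α x) := by
  have hx1 : 1 < exp x := one_lt_exp_iff.2 hx
  have hq : 0 < 1 + α / 2 * (exp x - 1) := by
    have : 0 < α / 2 * (exp x - 1) := mul_pos (by linarith) (by linarith)
    linarith
  rw [cnInvUpper, powUpper_ofReal_of_gt hx1]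
  have e1 : (1 - α / 2 * (1 - ((exp x : ℝ) : ℂ))) = ((1 + α / 2 * (exp x - 1) : ℝ) : ℂ) := by
    push_cast; ring
  rw [e1]
  set q := 1 + α / 2 * (exp x - 1) with hqdef
  have hq' : (q : ℂ) ≠ 0 := by exact_mod_cast hq.ne'
  have e2 : (q : ℂ) / (((exp x - 1) ^ α : ℝ) * Complex.exp (-(π * α : ℝ) * Complex.I) + μ * q) =
      ((cnBranch α x : ℂ) * Complex.exp (-(π * α : ℝ) * Complex.I) + μ)⁻¹ := by
    rw [cnBranch, ← hqdef, ← one_div, ← mul_div_mul_right 1 _ hq', one_mul]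
    congr 1
    push_cast
    field_simp
  rw [e2]
  have e3 : (cnBranch α x : ℂ) * Complex.exp (-(π * α : ℝ) * Complex.I) + μ =
      ((cnBranch α x * cos (π * α) + μ : ℝ) : ℂ) + ((-(cnBranch α x * sin (π * α)) : ℝ) : ℂ)
        * Complex.I := by
    rw [show (-((π * α : ℝ) : ℂ) * Complex.I) = ((-(π * α) : ℝ) : ℂ) * Complex.I by push_cast; ring,
      Complex.exp_mul_I, ← Complex.ofReal_cos, ← Complex.ofReal_sin, cos_neg, sin_neg]
    push_cast
    ring
  rw [e3, Complex.inv_im, Complex.normSq_add_mul_I]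
  have e4 : (cnBranch α x * cos (π * α) + μ) ^ 2 + (-(cnBranch α x * sin (π * α))) ^ 2 =
      cnBranch α x ^ 2 + 2 * cnBranch α x * μ * cos (π * α) + μ ^ 2 := by
    linear_combination cnBranch α x ^ 2 * sin_sq_add_cos_sq (π * α)
  rw [e4]
  unfold specDens
  rw [mul_inv_cancel_left₀ pi_pos.ne']
  simp only [Complex.add_im, Complex.ofReal_im, Complex.im_ofReal_mul, Complex.I_im]
  ring

/-- A bound on a circle of radius larger than one, uniform in the eigenvalue. -/
theorem exists_norm_cnInvUpper_le {α L : ℝ} (h0 : 0 < α) (h1 : α < 1) (hL : 0 < L)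
    (hL' : exp L ≤ 1 / α) : ∃ C, 0 < C ∧ ∀ μ, 0 < μ → ∀ y ∈ Icc 0 π,
      ‖cnInvUpper α μ (Complex.exp (L + y * Complex.I))‖ ≤ C := by
  have hnorm : ∀ y : ℝ, ‖Complex.exp (L + y * Complex.I)‖ = exp L := by
    intro y; rw [Complex.norm_exp]; simp
  have hne : ∀ y : ℝ, Complex.exp (L + y * Complex.I) ≠ 1 := by
    intro y h
    have := hnorm y
    rw [h, norm_one] at this
    linarith [one_lt_exp_iff.2 hL]
  have him : ∀ y ∈ Icc 0 π, 0 ≤ (Complex.exp (L + y * Complex.I)).im := by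
    intro y hy
    rw [Complex.exp_im]
    simp only [Complex.add_im, Complex.ofReal_im, Complex.im_ofReal_mul, Complex.I_im, mul_one,
      zero_add]
    exact mul_nonneg (exp_pos _).le (sin_nonneg_of_nonneg_of_le_pi hy.1 hy.2)
  have hmem : ∀ y ∈ Icc 0 π, cnRatio α (logUpper (Complex.exp (L + y * Complex.I))) ∈
      Complex.slitPlane := fun y hy => cnRatio_logUpper_mem h0 h1 (hne y) (him y hy)
        (by rw [hnorm]; exact hL')
  -- The inverse symbol is 1/(w + μ), and `w` does not depend on μ.
  set w : ℝ → ℂ := fun y => (cnRatio α (logUpper (Complex.exp (L + y * Complex.I))))⁻¹ with hw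
  have hcont : ContinuousOn w (Icc 0 π) := by
    intro y hy
    refine ContinuousAt.continuousWithinAt ?_
    refine ContinuousAt.inv₀ ?_ (Complex.slitPlane_ne_zero (hmem y hy))
    unfold cnRatio logUpper
    have hc : ContinuousAt (fun y : ℝ => Complex.log (Complex.I * (1 - Complex.exp
        (L + y * Complex.I)))) y := by
      refine ContinuousAt.clog (by fun_prop) ?_
      exact I_mul_one_sub_mem_slitPlane (hne y) (him y hy)
    fun_prop
  have hsub : w '' Icc 0 π ⊆ Complex.slitPlane := by
    rintro _ ⟨y, hy, rfl⟩
    have h := hmem y hy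
    have hn := Complex.normSq_pos.2 (Complex.slitPlane_ne_zero h)
    rw [Complex.mem_slitPlane_iff] at h ⊢
    simp only [hw, Complex.inv_re, Complex.inv_im]
    rcases h with h | h
    · exact Or.inl (div_pos h hn)
    · exact Or.inr (div_ne_zero (neg_ne_zero.2 h) hn.ne')
  -- The values of `w` on the arc form a compact subset of the slit plane, so they keep a positive
  -- distance from all points -μ at once; this gives the uniformity in μ.
  obtain ⟨δ, hδ, hthick⟩ := (isCompact_Icc.image_of_continuousOn hcont).exists_thickening_subset_open
    Complex.isOpen_slitPlane hsub
  refine ⟨δ⁻¹, inv_pos.2 hδ, fun μ hμ y hy => ?_⟩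
  have hge : δ ≤ ‖w y + μ‖ := by
    by_contra hlt
    push Not at hlt
    have : (-μ : ℂ) ∈ Metric.thickening δ (w '' Icc 0 π) := by
      rw [Metric.mem_thickening_iff]
      refine ⟨w y, mem_image_of_mem w hy, ?_⟩
      rw [dist_comm, dist_eq_norm, sub_neg_eq_add]
      exact hlt
    have h2 := hthick this
    rw [Complex.mem_slitPlane_iff] at h2
    simp at h2
    linarith
  have hval : cnInvUpper α μ (Complex.exp (L + y * Complex.I)) = (w y + μ)⁻¹ := by
    rw [cnInvUpper, cnInvUpper_den_eq (hne y), cnSymbol_eq]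
    set η := logUpper (Complex.exp (L + y * Complex.I)) with hη
    have hwne : cnRatio α η ≠ 0 := Complex.slitPlane_ne_zero (hmem y hy)
    have hP : (1 - α / 2 * (1 - Complex.exp (L + y * Complex.I))) =
        Complex.exp (α * η) * cnRatio α η := by
      rw [← exp_logUpper (hne y), ← hη, cnRatio, ← mul_assoc, ← Complex.exp_add]
      simp
    rw [hP, mul_div_mul_left _ _ (Complex.exp_ne_zero _)]
    simp only [hw, ← hη]
    rw [inv_eq_one_div (cnRatio α η), div_add' _ _ _ hwne, inv_div]
  rw [hval, norm_inv]
  exact inv_anti₀ hδ hge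

theorem cnInv_conj {α μ : ℝ} {ξ : ℂ} (hξ : ‖ξ‖ < 1) :
    cnInv α μ (starRingEnd ℂ ξ) = starRingEnd ℂ (cnInv α μ ξ) := by
  have hre : 0 < (1 - ξ).re := by
    have := Complex.re_le_norm ξ
    simp only [Complex.sub_re, Complex.one_re]
    linarith
  have harg : Complex.arg (1 - ξ) ≠ π := by
    have := abs_lt.1 (Complex.abs_arg_lt_pi_div_two_iff.2 (Or.inl hre))
    linarith [pi_pos, this.2]
  have h2 : (1 - starRingEnd ℂ ξ) = starRingEnd ℂ (1 - ξ) := by simp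
  have h3 : (starRingEnd ℂ (1 - ξ)) ^ (α : ℂ) = starRingEnd ℂ ((1 - ξ) ^ (α : ℂ)) := by
    rw [Complex.conj_cpow _ _ harg, Complex.conj_ofReal]
  rw [cnInv, cnInv, h2, h3]
  simp [map_div₀, Complex.conj_ofNat]

/-- The discrete kernel as half of a Fourier integral. -/
theorem cnKernel_eq_integral {α μ : ℝ} (h0 : 0 < α) (h1 : α < 1) (hμ : 0 ≤ μ) {x₀ : ℝ}
    (hx : x₀ < 0) (n : ℕ) :
    π * cnKernel α μ n = (∫ y in (0 : ℝ)..π, cnInv α μ (Complex.exp (x₀ + y * Complex.I)) *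
      Complex.exp (-(n * (x₀ + y * Complex.I)))).re := by
  obtain ⟨r, hr⟩ : ∃ r : NNReal, (r : ℝ) = exp x₀ := ⟨⟨exp x₀, (exp_pos _).le⟩, rfl⟩
  have hr0 : 0 < r := by
    have : 0 < (r : ℝ) := hr ▸ exp_pos _
    exact_mod_cast this
  have hr1 : r < 1 := by
    have : (r : ℝ) < 1 := by rwa [hr, exp_lt_one_iff]
    exact_mod_cast this
  have hcoe : ((r : ℝ) : ℂ) = Complex.exp x₀ := by rw [hr]; simp
  set g : ℝ → ℂ := fun y => cnInv α μ (Complex.exp (x₀ + y * Complex.I)) *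
      Complex.exp (-(n * (x₀ + y * Complex.I))) with hg
  have hcirc : ∀ y : ℝ, circleMap 0 r y = Complex.exp (x₀ + y * Complex.I) := by
    intro y; rw [circleMap, zero_add, hcoe, Complex.exp_add]
  have h := (cauchyPowerSeries_cnInv h0 h1 hμ hr0 hr1 n).1
  have hint : (2 * π * cnKernel α μ n : ℂ) = ∫ y in (0 : ℝ)..2 * π, g y := by
    rw [← h]
    have : (cauchyPowerSeries (cnInv α μ) 0 r).coeff n =
        (cauchyPowerSeries (cnInv α μ) 0 r) n fun _ => 1 := rfl
    rw [this, cauchyPowerSeries_apply, circleIntegral, smul_eq_mul, ← mul_assoc,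
      ← intervalIntegral.integral_const_mul]
    refine intervalIntegral.integral_congr fun y _ => ?_
    have hne : Complex.exp (x₀ + y * Complex.I) ≠ 0 := Complex.exp_ne_zero _
    have hpi : (π : ℂ) ≠ 0 := by exact_mod_cast pi_pos.ne'
    simp only [deriv_circleMap, hcirc, smul_eq_mul, sub_zero, hg]
    rw [Complex.exp_neg, Complex.exp_nat_mul, one_div, inv_pow]
    field_simp
  have hnorm : ∀ y : ℝ, ‖Complex.exp (x₀ + y * Complex.I)‖ < 1 := by
    intro y
    rw [Complex.norm_exp]
    simpa using hx
  have hgc : Continuous g := by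
    rw [continuous_iff_continuousAt]
    intro y
    refine ContinuousAt.mul ?_ (by fun_prop)
    exact ContinuousAt.comp (f := fun y : ℝ => Complex.exp (x₀ + y * Complex.I))
      (differentiableAt_cnInv h0 h1 hμ (hnorm y)).continuousAt (by fun_prop)
  have hsplit : ∫ y in (0 : ℝ)..2 * π, g y = (∫ y in (0 : ℝ)..π, g y) +
      ∫ y in π..2 * π, g y :=
    (intervalIntegral.integral_add_adjacent_intervals (hgc.intervalIntegrable _ _)
      (hgc.intervalIntegrable _ _)).symm
  -- The symbol has real coefficients: the lower half circle contributes the conjugate of the upper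
  -- one.
  have hrefl : ∫ y in π..2 * π, g y = starRingEnd ℂ (∫ y in (0 : ℝ)..π, g y) := by
    have h2 := intervalIntegral.integral_comp_sub_left (a := 0) (b := π) g (2 * π)
    rw [sub_zero, show 2 * π - π = π by ring] at h2
    rw [← h2, ← intervalIntegral.intervalIntegral_conj]
    refine intervalIntegral.integral_congr fun y _ => ?_
    have e1 : Complex.exp (x₀ + ((2 * π - y : ℝ) : ℂ) * Complex.I) =
        starRingEnd ℂ (Complex.exp (x₀ + y * Complex.I)) := by
      rw [← Complex.exp_conj]
      have : (x₀ + ((2 * π - y : ℝ) : ℂ) * Complex.I) =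
          starRingEnd ℂ (x₀ + y * Complex.I) + 2 * π * Complex.I := by
        simp; ring
      rw [this, Complex.exp_periodic]
    simp only [hg]
    rw [Complex.exp_neg, Complex.exp_nat_mul, e1, cnInv_conj (hnorm y), Complex.exp_neg,
      Complex.exp_nat_mul]
    simp
  rw [hsplit, hrefl, Complex.add_conj] at hint
  have := congrArg Complex.re hint
  rw [Complex.ofReal_re] at this
  have h3 : (2 * π * cnKernel α μ n : ℂ).re = 2 * π * cnKernel α μ n := by
    rw [← Complex.ofReal_ofNat, ← Complex.ofReal_mul, ← Complex.ofReal_mul, Complex.ofReal_re]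
  rw [h3] at this
  linarith

/-- Cauchy's theorem in ζ = log ξ on the rectangle [-1, L] × [0, π], where -1 may be any negative
number. The left edge is the Cauchy integral for the coefficient, the top edge and the bottom edge
for x < 0 are real, the bottom edge for x > 0 is the upper side of the cut, and the right edge is
the arc of radius e^L > 1. -/
theorem exists_abs_cnKernel_sub_integral_le {α L : ℝ} (h0 : 0 < α) (h1 : α < 1) (hL : 0 < L)
    (hL' : exp L ≤ 1 / α) : ∃ C, 0 < C ∧ ∀ μ, 0 < μ → ∀ n : ℕ,
      |cnKernel α μ n - ∫ x in 0..L, exp (-(n * x)) * specDens α μ (cnBranch α x)|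
        ≤ C * exp (-(n * L)) := by
  obtain ⟨C, hC, hbound⟩ := exists_norm_cnInvUpper_le h0 h1 hL hL'
  refine ⟨C, hC, fun μ hμ n => ?_⟩
  set f : ℂ → ℂ := fun ζ => cnInvUpper α μ (Complex.exp ζ) * Complex.exp (-(n * ζ)) with hf
  have him : ∀ ζ : ℂ, 0 ≤ ζ.im → ζ.im ≤ π → 0 ≤ (Complex.exp ζ).im := by
    intro ζ h h'
    rw [Complex.exp_im]
    exact mul_nonneg (exp_pos _).le (sin_nonneg_of_nonneg_of_le_pi h h')
  have hnorm : ∀ ζ : ℂ, ζ.re ≤ L → ‖Complex.exp ζ‖ ≤ 1 / α := by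
    intro ζ h
    rw [Complex.norm_exp]
    exact (exp_le_exp.2 h).trans hL'
  have hfc : ∀ ζ : ℂ, 0 ≤ ζ.im → ζ.im ≤ π → ζ.re ≤ L → ContinuousAt f ζ := by
    intro ζ a b c
    refine ContinuousAt.mul ?_ (by fun_prop)
    exact ContinuousAt.comp (f := Complex.exp)
      (continuousAt_cnInvUpper h0 h1 hμ (him ζ a b) (hnorm ζ c)) (by fun_prop)
  have hfd : ∀ ζ : ℂ, 0 < ζ.im → ζ.im < π → ζ.re ≤ L → DifferentiableAt ℂ f ζ := by
    intro ζ a b c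
    refine DifferentiableAt.mul ?_ (by fun_prop)
    refine DifferentiableAt.comp (f := Complex.exp) ζ
      (differentiableAt_cnInvUpper h0 h1 hμ ?_ (him ζ a.le b.le) (hnorm ζ c)) (by fun_prop)
    intro h
    have h2 := congrArg Complex.im h
    rw [Complex.exp_im, Complex.one_im] at h2
    exact (mul_pos (exp_pos _) (sin_pos_of_pos_of_lt_pi a b)).ne' h2
  have hle : (-1 : ℝ) ≤ L := by linarith
  have rect := Complex.integral_boundary_rect_eq_zero_of_continuousOn_of_differentiableOn f
    (((-1 : ℝ) : ℂ)) (L + π * Complex.I) ?_ ?_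
  rotate_left
  · intro ζ hζ
    rw [Complex.mem_reProdIm] at hζ
    simp only [Complex.ofReal_im, Complex.add_im, Complex.mul_im, Complex.add_re, Complex.mul_re,
      Complex.ofReal_re, Complex.I_im, Complex.I_re, mul_one, mul_zero, zero_add, add_zero,
      uIcc_of_le pi_pos.le, sub_zero, uIcc_of_le hle] at hζ
    exact (hfc ζ hζ.2.1 hζ.2.2 hζ.1.2).continuousWithinAt
  · intro ζ hζ
    rw [Complex.mem_reProdIm] at hζ
    simp only [Complex.ofReal_im, Complex.add_im, Complex.mul_im, Complex.add_re, Complex.mul_re,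
      Complex.ofReal_re, Complex.I_im, Complex.I_re, mul_one, mul_zero, zero_add, add_zero,
      min_eq_left pi_pos.le, max_eq_right pi_pos.le, sub_zero, min_eq_left hle, max_eq_right hle]
      at hζ
    exact (hfd ζ hζ.2.1 hζ.2.2 hζ.1.2.le).differentiableWithinAt
  simp only [Complex.ofReal_im, Complex.add_im, Complex.mul_im, Complex.add_re, Complex.mul_re,
    Complex.ofReal_re, Complex.I_im, Complex.I_re, mul_one, mul_zero, zero_add, add_zero,
    sub_zero, Complex.ofReal_zero, zero_mul] at rect
  have hrect := congrArg Complex.im rect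
  simp only [Complex.add_im, Complex.sub_im, Complex.zero_im, smul_eq_mul,
    Complex.mul_im, Complex.I_re, Complex.I_im, zero_mul, one_mul, zero_add] at hrect
  have hleft : (∫ y in (0 : ℝ)..π, f (((-1 : ℝ) : ℂ) + y * Complex.I)).re = π * cnKernel α μ n := by
    rw [cnKernel_eq_integral h0 h1 hμ.le (by norm_num : (-1 : ℝ) < 0) n]
    congr 1
    refine intervalIntegral.integral_congr fun y hy => ?_
    rw [uIcc_of_le pi_pos.le] at hy
    simp only [hf]
    congr 1
    refine cnInvUpper_eq (him _ (by simpa using hy.1) (by simpa using hy.2)) ?_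
    rw [Complex.norm_exp]
    simp
  have htop : (∫ x in (-1)..L, f (x + π * Complex.I)).im = 0 := by
    have hcont : ContinuousOn (fun x : ℝ => f (x + π * Complex.I)) (uIcc (-1) L) := fun x hx => by
      rw [uIcc_of_le hle] at hx
      exact (ContinuousAt.comp (f := fun x : ℝ => (x + π * Complex.I : ℂ)) (g := f)
        (hfc _ (by simp [pi_pos.le]) (by simp) (by simpa using hx.2))
        (by fun_prop)).continuousWithinAt
    have := Complex.imCLM.intervalIntegral_comp_comm (μ := volume) hcont.intervalIntegrable
    simp only [Complex.imCLM_apply] at this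
    rw [← this, ← intervalIntegral.integral_zero (a := -1) (b := L)]
    refine intervalIntegral.integral_congr fun x _ => ?_
    have e : Complex.exp (x + π * Complex.I) = ((-exp x : ℝ) : ℂ) := by
      rw [Complex.exp_add, Complex.exp_pi_mul_I]; simp
    have e2 : Complex.exp (-(n * (x + π * Complex.I))) = (((-exp x) ^ n)⁻¹ : ℝ) := by
      rw [Complex.exp_neg, Complex.exp_nat_mul, e]; push_cast; rfl
    simp only [hf]
    rw [e2, e, Complex.im_mul_ofReal,
      cnInvUpper_ofReal_im_of_lt (by linarith [exp_pos x] : -exp x < 1), zero_mul]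
  have hbot : (∫ x in (-1)..L, f x).im =
      π * ∫ x in 0..L, exp (-(n * x)) * specDens α μ (cnBranch α x) := by
    have hcont : ContinuousOn (fun x : ℝ => f x) (uIcc (-1) L) := fun x hx => by
      rw [uIcc_of_le hle] at hx
      exact (ContinuousAt.comp (f := fun x : ℝ => (x : ℂ)) (g := f)
        (hfc _ (by simp) (by simp [pi_pos.le]) (by simpa using hx.2))
        (by fun_prop)).continuousWithinAt
    have := Complex.imCLM.intervalIntegral_comp_comm (μ := volume) hcont.intervalIntegrable
    simp only [Complex.imCLM_apply] at this
    have hci : ContinuousOn (fun x : ℝ => (f x).im) (uIcc (-1) L) :=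
      Complex.continuous_im.comp_continuousOn hcont
    have h01 : uIcc (-1 : ℝ) 0 ⊆ uIcc (-1) L := by
      rw [uIcc_of_le hle, uIcc_of_le (by norm_num)]; exact Icc_subset_Icc_right hL.le
    have h02 : uIcc 0 L ⊆ uIcc (-1) L := by
      rw [uIcc_of_le hle, uIcc_of_le hL.le]; exact Icc_subset_Icc_left (by norm_num)
    have e2 : ∀ x : ℝ, (f x).im = (cnInvUpper α μ (exp x : ℝ)).im * exp (-(n * x)) := by
      intro x
      have : Complex.exp (-(n * (x : ℂ))) = (exp (-(n * x)) : ℝ) := by push_cast; rfl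
      simp only [hf]
      rw [this, Complex.im_mul_ofReal, Complex.ofReal_exp]
    rw [← this, ← intervalIntegral.integral_add_adjacent_intervals
      (hci.mono h01).intervalIntegrable (hci.mono h02).intervalIntegrable]
    have z1 : ∫ x in (-1)..0, (f x).im = 0 := by
      refine (intervalIntegral.integral_congr_ae (g := fun _ => 0) ?_).trans
        intervalIntegral.integral_zero
      have h3 : ∀ᵐ x : ℝ, x ≠ 0 := by simp [ae_iff, measure_singleton]
      filter_upwards [h3] with x hx0 hx
      rw [uIoc_of_le (by norm_num)] at hx
      rw [e2, cnInvUpper_ofReal_im_of_lt (exp_lt_one_iff.2 (lt_of_le_of_ne hx.2 hx0)), zero_mul]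
    rw [z1, zero_add, ← intervalIntegral.integral_const_mul]
    refine intervalIntegral.integral_congr_ae (Eventually.of_forall fun x hx => ?_)
    rw [uIoc_of_le hL.le] at hx
    rw [e2, cnInvUpper_ofReal_im_of_gt h0 hx.1]
    ring
  have hright : |(∫ y in (0 : ℝ)..π, f (L + y * Complex.I)).re| ≤ C * exp (-(n * L)) * π := by
    refine (Complex.abs_re_le_norm _).trans ?_
    have := intervalIntegral.norm_integral_le_of_norm_le_const (a := 0) (b := π)
      (f := fun y : ℝ => f (L + y * Complex.I)) (C := C * exp (-(n * L))) fun y hy => ?_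
    · simpa [abs_of_pos pi_pos] using this
    · rw [uIoc_of_le pi_pos.le] at hy
      simp only [hf]
      rw [norm_mul, Complex.norm_exp (-(n * (L + y * Complex.I)))]
      have hre : (-(n * (L + y * Complex.I)) : ℂ).re = -(n * L) := by simp
      rw [hre]
      gcongr
      exact hbound μ hμ y ⟨hy.1.le, hy.2⟩
  rw [hleft, htop, hbot] at hrect
  have e : π * (cnKernel α μ n - ∫ x in 0..L, exp (-(n * x)) * specDens α μ (cnBranch α x)) =
      (∫ y in (0 : ℝ)..π, f (L + y * Complex.I)).re := by linarith
  rw [← e, abs_mul, abs_of_pos pi_pos, mul_comm] at hright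
  exact le_of_mul_le_mul_right hright pi_pos

/-! ## Second order consistency of the symbol -/

theorem abs_exp_sub_one_div_sub_le {x : ℝ} (hx : x ≠ 0) (hx1 : |x| ≤ 1) :
    |(exp x - 1) / x - 1 - x / 2| ≤ x ^ 2 := by
  have h := Real.exp_bound hx1 (n := 3) (by norm_num)
  simp [Finset.sum_range_succ, Nat.factorial] at h
  have e : (exp x - 1) / x - 1 - x / 2 = (exp x - (1 + x + x ^ 2 / 2)) / x := by
    field_simp
    ring
  have hx0 : 0 < |x| := abs_pos.2 hx
  rw [e, abs_div, div_le_iff₀ hx0]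
  have : x ^ 2 * |x| = |x| ^ 3 := by rw [← sq_abs]; ring
  rw [this]
  nlinarith [pow_pos hx0 3]

/-- The symbol of the scheme, divided by that of the continuous problem. -/
noncomputable def symbolRatio (α x : ℝ) : ℝ :=
  ((exp x - 1) / x) ^ α / (1 + α / 2 * (exp x - 1))

/-- Second order consistency: ((e^x - 1)/x)^α and 1 + α/2 (e^x - 1) are both 1 + αx/2 + O(x²). The
averaging weight α/2 of the scheme is the one that matches the linear terms. -/
theorem symbolRatio_sub_one_isBigO (α : ℝ) :
    (fun x => symbolRatio α x - 1) =O[𝓝[≠] 0] fun x => x ^ 2 := by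
  have hq : (fun x : ℝ => (exp x - 1) / x - 1 - x / 2) =O[𝓝[≠] 0] fun x => x ^ 2 := by
    refine Asymptotics.IsBigO.of_bound 1 ?_
    have h1 : ∀ᶠ x : ℝ in 𝓝[≠] 0, |x| ≤ 1 := by
      have : Tendsto (fun x : ℝ => |x|) (𝓝[≠] 0) (𝓝 0) := by
        have := (continuous_abs (G := ℝ)).tendsto 0
        rw [abs_zero] at this
        exact this.mono_left nhdsWithin_le_nhds
      exact this.eventually (ge_mem_nhds one_pos)
    filter_upwards [h1, self_mem_nhdsWithin] with x hx hx0
    rw [norm_eq_abs, one_mul, norm_eq_abs, abs_of_nonneg (sq_nonneg x)]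
    exact abs_exp_sub_one_div_sub_le hx0 hx
  have hx1 : (fun x : ℝ => x ^ 2) =O[𝓝[≠] 0] fun x => x := by
    simp only [sq]
    have h1 : (fun x : ℝ => x) =O[𝓝[≠] 0] fun _ => (1 : ℝ) :=
      (continuous_id.tendsto (0 : ℝ)).isBigO_one ℝ |>.mono nhdsWithin_le_nhds
    simpa using h1.mul (Asymptotics.isBigO_refl (fun x : ℝ => x) (𝓝[≠] 0))
  set u : ℝ → ℝ := fun x => (exp x - 1) / x - 1 with hu
  have hu1 : u =O[𝓝[≠] 0] fun x => x := by
    have h2 : (fun x : ℝ => x / 2) =O[𝓝[≠] 0] fun x => x := by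
      simpa [div_eq_inv_mul] using
        (Asymptotics.isBigO_refl (fun x : ℝ => x) (𝓝[≠] 0)).const_mul_left (2⁻¹ : ℝ)
    refine ((hq.trans hx1).add h2).congr_left fun x => ?_
    simp only [hu]
    ring
  have hid : Tendsto (fun x : ℝ => x) (𝓝[≠] 0) (𝓝 0) :=
    (continuous_id.tendsto (0 : ℝ)).mono_left nhdsWithin_le_nhds
  have hu0 : Tendsto u (𝓝[≠] 0) (𝓝 0) := hu1.trans_tendsto hid
  have hpow : (fun v : ℝ => (1 + v) ^ α - (1 + α * v)) =O[𝓝 0] fun v => v ^ 2 := by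
    have h := (Real.one_add_rpow_hasFPowerSeriesAt_zero (a := α)).isBigO_sub_partialSum_pow 2
    simp only [zero_add, FormalMultilinearSeries.partialSum, Finset.sum_range_succ,
      Finset.sum_range_zero, binomialSeries_apply] at h
    simp only [List.ofFn_const, List.prod_replicate, pow_zero, pow_one, Ring.choose_zero_right,
      Ring.choose_one_right, smul_eq_mul, mul_one, norm_eq_abs, sq_abs] at h
    exact h
  have hpu : (fun x => (1 + u x) ^ α - (1 + α * u x)) =O[𝓝[≠] 0] fun x => x ^ 2 :=
    (hpow.comp_tendsto hu0).trans (hu1.pow 2)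
  have hexp : (fun x : ℝ => exp x - (1 + x)) =O[𝓝[≠] 0] fun x => x ^ 2 := by
    have h := Real.exp_sub_sum_range_isBigO_pow 2
    simp [Finset.sum_range_succ] at h
    exact h.mono nhdsWithin_le_nhds
  have hnum : (fun x => (1 + u x) ^ α - (1 + α / 2 * (exp x - 1))) =O[𝓝[≠] 0] fun x => x ^ 2 := by
    refine ((hpu.add (hq.const_mul_left α)).sub (hexp.const_mul_left (α / 2))).congr_left fun x => ?_
    simp only [hu]
    ring
  have hden : Tendsto (fun x : ℝ => 1 + α / 2 * (exp x - 1)) (𝓝[≠] 0) (𝓝 1) := by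
    have : Tendsto (fun x : ℝ => 1 + α / 2 * (exp x - 1)) (𝓝 0) (𝓝 (1 + α / 2 * (exp 0 - 1))) :=
      Continuous.tendsto (by fun_prop) 0
    simp only [exp_zero, sub_self, mul_zero, add_zero] at this
    exact this.mono_left nhdsWithin_le_nhds
  have hinv : (fun x : ℝ => (1 + α / 2 * (exp x - 1))⁻¹) =O[𝓝[≠] 0] fun _ => (1 : ℝ) :=
    (hden.inv₀ one_ne_zero).isBigO_one ℝ
  have hfin := hnum.mul hinv
  simp only [mul_one] at hfin
  refine hfin.congr' ?_ EventuallyEq.rfl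
  filter_upwards [hden.eventually_ne one_ne_zero] with x hx
  simp only [hu, symbolRatio]
  rw [add_sub_cancel, ← div_eq_mul_inv, sub_div, div_self hx]

theorem exists_abs_symbolRatio_sub_one_le (α : ℝ) : ∃ C δ, 0 < C ∧ 0 < δ ∧
    ∀ x, x ≠ 0 → |x| ≤ δ → |symbolRatio α x - 1| ≤ C * x ^ 2 := by
  obtain ⟨C, hC0, hC⟩ := (symbolRatio_sub_one_isBigO α).exists_pos
  rw [Asymptotics.IsBigOWith, eventually_nhdsWithin_iff, Metric.eventually_nhds_iff] at hC
  obtain ⟨ε, hε, h⟩ := hC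
  refine ⟨C, ε / 2, hC0, by positivity, fun x hx hxε => ?_⟩
  have := h (y := x) (by rw [dist_zero_right, norm_eq_abs]; linarith) hx
  rwa [norm_eq_abs, norm_eq_abs, abs_of_nonneg (sq_nonneg x)] at this

theorem cnBranch_eq {α x : ℝ} (hx : 0 < x) : cnBranch α x = x ^ α * symbolRatio α x := by
  have h : 0 < exp x - 1 := by linarith [one_lt_exp_iff.2 hx]
  rw [cnBranch, symbolRatio, div_rpow h.le hx.le, div_div, ← mul_div_assoc, mul_comm (x ^ α),
    mul_comm (x ^ α), mul_div_mul_right _ _ (rpow_pos_of_pos hx α).ne']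

/-! ### Comparison of the discrete and continuous kernels -/

theorem continuous_relaxKernel_left {α t : ℝ} (h0 : 0 < α) (h1 : α < 1) (ht : 0 < t) :
    Continuous fun lam => relaxKernel α lam t := by
  refine continuous_of_dominated (bound := fun r => densBound α * (r ^ (-α) * exp (-(r * t))))
    (fun lam => ?_) (fun lam => ?_)
    ((integrableOn_rpow_mul_exp_neg (by linarith) ht).const_mul _) ?_
  · exact (by fun_prop : Measurable fun r =>
      exp (-(r * t)) * specDens α lam (r ^ α)).aestronglyMeasurable
  · filter_upwards [ae_restrict_mem measurableSet_Ioi] with r hr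
    rw [norm_mul, norm_eq_abs, norm_eq_abs, abs_exp]
    nlinarith [abs_specDens_rpow_le (lam := lam) h0 h1 hr, exp_pos (-(r * t))]
  · filter_upwards [ae_restrict_mem measurableSet_Ioi] with r hr
    have : ∀ lam : ℝ, (r ^ α) ^ 2 + 2 * r ^ α * lam * cos (π * α) + lam ^ 2 ≠ 0 := fun lam =>
      (specDens_den_pos h0 h1 (rpow_pos_of_pos hr α)).ne'
    unfold specDens
    fun_prop (disch := exact this _)

theorem exp_neg_mul_le_rpow {α L : ℝ} (h0 : 0 < α) (hL : 0 < L) {n : ℕ} (hn : 1 ≤ n) :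
    exp (-(n * L)) ≤ 6 / L ^ 3 * (n : ℝ) ^ (α - 3) := by
  have hn' : (1 : ℝ) ≤ n := by exact_mod_cast hn
  have hn0 : (0 : ℝ) < n := by linarith
  have h := Real.pow_div_factorial_le_exp (n * L) (by positivity) 3
  have h3 : (n : ℝ) ^ (3 - α) ≤ (n : ℝ) ^ 3 := by
    rw [← Real.rpow_natCast]
    exact rpow_le_rpow_of_exponent_le hn' (by push_cast; linarith)
  have h4 : (n : ℝ) ^ (α - 3) = ((n : ℝ) ^ (3 - α))⁻¹ := by
    rw [← rpow_neg hn0.le]; ring_nf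
  have h5 : 0 < (n : ℝ) ^ (3 - α) := rpow_pos_of_pos hn0 _
  rw [exp_neg, h4, ← div_eq_mul_inv, div_div, inv_eq_one_div,
    div_le_div_iff₀ (exp_pos _) (by positivity)]
  simp only [Nat.factorial] at h
  rw [div_le_iff₀ (by norm_num)] at h
  calc 1 * (L ^ 3 * (n : ℝ) ^ (3 - α)) ≤ L ^ 3 * (n : ℝ) ^ 3 := by rw [one_mul]; gcongr
    _ = (n * L) ^ 3 := by ring
    _ ≤ 6 * exp (n * L) := by push_cast at h; linarith

/-- The error of the discrete kernel. -/
theorem exists_abs_cnKernel_sub_relaxKernel_le {α : ℝ} (h0 : 0 < α) (h1 : α < 1) :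
    ∃ C, 0 < C ∧ ∀ μ, 0 ≤ μ → ∀ n : ℕ, 1 ≤ n →
      |cnKernel α μ n - relaxKernel α μ n| ≤ C * (n : ℝ) ^ (α - 3) := by
  obtain ⟨C₁, δ, hC₁, hδ, hratio⟩ := exists_abs_symbolRatio_sub_one_le α
  -- The bound δ is the range of the consistency estimate and -log α the admissible radius of the
  -- contour; the last two give C₁ r² ≤ 1/2 for r ≤ L, so that the symbol ratio stays above 1/2.
  set L := min (min δ (-log α)) (min 1 (2 * C₁)⁻¹) with hLdef
  have hlog : 0 < -log α := neg_pos.2 (log_neg h0 h1)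
  have hL : 0 < L := by positivity
  have hLδ : L ≤ δ := (min_le_left _ _).trans (min_le_left _ _)
  have hLα : exp L ≤ 1 / α := by
    have : L ≤ -log α := (min_le_left _ _).trans (min_le_right _ _)
    calc exp L ≤ exp (-log α) := exp_le_exp.2 this
      _ = 1 / α := by rw [exp_neg, exp_log h0, one_div]
  have hL1 : L ≤ 1 := (min_le_right _ _).trans (min_le_left _ _)
  have hLC : L ≤ (2 * C₁)⁻¹ := (min_le_right _ _).trans (min_le_right _ _)
  obtain ⟨C₂, hC₂, hK⟩ := exists_abs_cnKernel_sub_integral_le h0 h1 hL hLα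
  have hs := sin_pi_mul_pos h0 h1
  have hdb := densBound_pos h0 h1
  set c := 2 * (π * sin (π * α) ^ 3)⁻¹ with hc
  have hc0 : 0 < c := by positivity
  set A := c * (2 * C₁) + densBound α / L ^ 2 with hA
  have hA0 : 0 < A := by positivity
  have hG : 0 < Gamma (2 - α + 1) := Gamma_pos_of_pos (by linarith)
  have key : ∀ μ, 0 < μ → ∀ n : ℕ, 1 ≤ n → |cnKernel α μ n - relaxKernel α μ n| ≤
      (C₂ * (6 / L ^ 3) + A * Gamma (2 - α + 1)) * (n : ℝ) ^ (α - 3) := by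
    intro μ hμ n hn
    have hn0 : (0 : ℝ) < n := by exact_mod_cast hn
    -- The difference of the two densities, the discrete one cut off at `L`. It is O(r^(2-α)) up to
    -- `L` by consistency, and beyond `L` trivially, since there r^(-α) ≤ L⁻² r^(2-α).
    set φ : ℝ → ℝ := fun r => (Iic L).indicator (fun r => specDens α μ (cnBranch α r)) r -
      specDens α μ (r ^ α) with hφ
    have hφm : Measurable φ := by
      refine Measurable.sub (Measurable.indicator ?_ measurableSet_Iic) (by fun_prop)
      unfold cnBranch
      fun_prop
    have hφb : ∀ r, 0 < r → |φ r| ≤ A * r ^ (2 - α) := by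
      intro r hr
      have hrα : 0 < r ^ α := rpow_pos_of_pos hr α
      have hpow : r ^ (2 - α) = r ^ 2 * (r ^ α)⁻¹ := by
        rw [sub_eq_add_neg, rpow_add hr, rpow_two, rpow_neg hr.le]
      by_cases hrL : r ≤ L
      · have h2 := hratio r hr.ne' (by rw [abs_of_pos hr]; linarith)
        have h3 : C₁ * r ^ 2 ≤ 1 / 2 := by
          have : r ^ 2 ≤ (2 * C₁)⁻¹ := by nlinarith
          calc C₁ * r ^ 2 ≤ C₁ * (2 * C₁)⁻¹ := by gcongr
            _ = 1 / 2 := by field_simp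
        have h4 : 1 / 2 ≤ symbolRatio α r := by linarith [(abs_le.1 h2).1]
        simp only [hφ]
        rw [indicator_of_mem (mem_Iic.2 hrL), cnBranch_eq hr]
        refine (abs_specDens_sub_le h0 h1 hμ.le (by positivity) hrα).trans ?_
        rw [← hc]
        have h5 : |r ^ α * symbolRatio α r - r ^ α| / (r ^ α * symbolRatio α r * r ^ α) ≤
            2 * C₁ * r ^ (2 - α) := by
          rw [show r ^ α * symbolRatio α r - r ^ α = r ^ α * (symbolRatio α r - 1) by ring, abs_mul,
            abs_of_pos hrα, mul_assoc, mul_div_mul_left _ _ hrα.ne', div_le_iff₀ (by positivity),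
            hpow]
          calc _ ≤ C₁ * r ^ 2 * 1 := by rw [mul_one]; exact h2
            _ ≤ C₁ * r ^ 2 * (2 * symbolRatio α r) := by gcongr; linarith
            _ = _ := by field_simp
        calc _ ≤ c * (2 * C₁ * r ^ (2 - α)) := by gcongr
          _ ≤ A * r ^ (2 - α) := by
            rw [← mul_assoc, hA]
            gcongr
            exact le_add_of_nonneg_right (by positivity)
      · push Not at hrL
        simp only [hφ]
        rw [indicator_of_notMem (by simpa using hrL), zero_sub, abs_neg]
        refine (abs_specDens_rpow_le h0 h1 hr).trans ?_
        rw [hpow, rpow_neg hr.le, ← mul_assoc]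
        gcongr
        rw [hA, add_mul, div_mul_eq_mul_div, mul_div_assoc]
        have : 1 ≤ r ^ 2 / L ^ 2 := by
          rw [one_le_div (by positivity)]
          gcongr
        have h6 : 0 ≤ c * (2 * C₁) * r ^ 2 := by positivity
        nlinarith
    have hφi := integrableOn_exp_neg_mul_of_le hφm hφb (by linarith) hn0
    have hφI := abs_integral_exp_neg_mul_le hφb (by linarith) hn0
    have hki := relaxKernel_integrableOn (lam := μ) h0 h1 hn0
    have hsum : (∫ r in Ioi (0 : ℝ), exp (-(r * n)) * φ r) + relaxKernel α μ n =
        ∫ x in 0..L, exp (-(n * x)) * specDens α μ (cnBranch α x) := by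
      rw [relaxKernel, ← integral_add hφi hki, intervalIntegral.integral_of_le hL.le]
      have e : ∀ r, exp (-(r * n)) * φ r + exp (-(r * n)) * specDens α μ (r ^ α) =
          (Iic L).indicator (fun x => exp (-(n * x)) * specDens α μ (cnBranch α x)) r := by
        intro r
        simp only [hφ, indicator]
        split_ifs
        · ring_nf
        · ring
      simp only [e]
      rw [integral_indicator measurableSet_Iic, Measure.restrict_restrict measurableSet_Iic,
        Iic_inter_Ioi]
    have hKn := hK μ hμ n
    rw [← hsum] at hKn
    have hexp := exp_neg_mul_le_rpow h0 hL hn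
    have hp : (n : ℝ) ^ (-(2 - α + 1)) = (n : ℝ) ^ (α - 3) := by ring_nf
    rw [hp] at hφI
    have htri : |cnKernel α μ n - relaxKernel α μ n| ≤
        |cnKernel α μ n - ((∫ r in Ioi (0 : ℝ), exp (-(r * n)) * φ r) + relaxKernel α μ n)| +
        |∫ r in Ioi (0 : ℝ), exp (-(r * n)) * φ r| := by
      refine le_trans (le_of_eq ?_) (abs_add_le _ _)
      congr 1
      ring
    calc _ ≤ C₂ * exp (-(n * L)) + A * Gamma (2 - α + 1) * (n : ℝ) ^ (α - 3) := by linarith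
      _ ≤ C₂ * (6 / L ^ 3 * (n : ℝ) ^ (α - 3)) + A * Gamma (2 - α + 1) * (n : ℝ) ^ (α - 3) := by
        gcongr
      _ = _ := by ring
  refine ⟨C₂ * (6 / L ^ 3) + A * Gamma (2 - α + 1), by positivity, fun μ hμ n hn => ?_⟩
  rcases hμ.lt_or_eq with h | rfl
  · exact key μ h n hn
  -- The eigenvalue zero is the limit μ → 0+, both kernels being continuous in μ and the constant
  -- uniform.
  · have hn0 : (0 : ℝ) < n := by exact_mod_cast hn
    have t1 : Tendsto (fun μ => cnKernel α μ n) (𝓝[>] 0) (𝓝 (cnKernel α 0 n)) :=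
      ((continuousOn_cnKernel h1 n) 0 self_mem_Ici).mono_left
        (nhdsWithin_mono _ Ioi_subset_Ici_self)
    have t2 : Tendsto (fun μ => relaxKernel α μ n) (𝓝[>] 0) (𝓝 (relaxKernel α 0 n)) :=
      ((continuous_relaxKernel_left h0 h1 hn0).tendsto 0).mono_left nhdsWithin_le_nhds
    refine le_of_tendsto (t1.sub t2).abs ?_
    filter_upwards [self_mem_nhdsWithin] with μ hμ'
    exact key μ hμ' n hn

theorem abs_cnKernel_zero_le {α μ : ℝ} (h0 : 0 < α) (h1 : α < 1) (hμ : 0 ≤ μ) :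
    |cnKernel α μ 0| ≤ 1 := by
  have h2 : 0 ≤ μ * (1 - α / 2) := mul_nonneg hμ (by linarith)
  rw [cnKernel_recursion h1 hμ, coeff_cnPoly, Finset.range_zero, Finset.sum_empty, if_pos rfl,
    sub_zero, abs_mul, abs_inv, abs_of_pos (by linarith), abs_of_pos (by linarith),
    inv_mul_le_iff₀ (by linarith)]
  linarith

/-! ## Sums of powers -/

/-- Convexity of x^(-q), with the tangent at the right end. Summed up, the right side telescopes,
which bounds tails of power sums without an integral comparison. -/
theorem mul_rpow_le_rpow_sub_rpow {q x : ℝ} (hx : 0 < x) (hq : 0 ≤ q) :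
    q * (x + 1) ^ (-q - 1) ≤ x ^ (-q) - (x + 1) ^ (-q) := by
  have hx1 : 0 < x + 1 := by linarith
  have h1 : x = (x + 1) * (x / (x + 1)) := by field_simp
  have h2 : 0 < x / (x + 1) := by positivity
  have h3 : 1 + q / (x + 1) ≤ (x / (x + 1)) ^ (-q) := by
    rw [rpow_def_of_pos h2]
    have h4 := log_le_sub_one_of_pos h2
    have h5 := add_one_le_exp (log (x / (x + 1)) * -q)
    have h6 : x / (x + 1) - 1 = -(1 / (x + 1)) := by field_simp; ring
    have h7 : q * (1 / (x + 1)) = q / (x + 1) := by ring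
    nlinarith
  have h8 : x ^ (-q) = (x + 1) ^ (-q) * (x / (x + 1)) ^ (-q) := by
    rw [← mul_rpow hx1.le h2.le, ← h1]
  rw [h8, rpow_sub_one hx1.ne']
  have h9 : 0 < (x + 1) ^ (-q) := rpow_pos_of_pos hx1 _
  calc q * ((x + 1) ^ (-q) / (x + 1)) = (x + 1) ^ (-q) * (1 + q / (x + 1)) - (x + 1) ^ (-q) := by
        ring
    _ ≤ _ := by gcongr

theorem sum_range_rpow_le {q x : ℝ} (hq : 0 < q) (hx : 0 < x) (m : ℕ) :
    ∑ i ∈ Finset.range m, (x + i + 1) ^ (-q - 1) ≤ x ^ (-q) / q := by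
  rw [le_div_iff₀ hq]
  have key : (∑ i ∈ Finset.range m, (x + i + 1) ^ (-q - 1)) * q ≤
      x ^ (-q) - (x + m) ^ (-q) := by
    induction m with
    | zero => simp
    | succ m ih =>
      rw [Finset.sum_range_succ, add_mul]
      have := mul_rpow_le_rpow_sub_rpow (q := q) (x := x + m) (by positivity) hq.le
      push_cast
      rw [← add_assoc x]
      linarith
  have : 0 ≤ (x + m) ^ (-q) := by positivity
  linarith

theorem summable_add_rpow {q x : ℝ} (hq : 0 < q) (hx : 0 < x) :
    Summable fun i : ℕ => (x + i + 1) ^ (-q - 1) :=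
  summable_of_sum_range_le (fun i => by positivity) (sum_range_rpow_le hq hx)

theorem tsum_add_rpow_le {q x : ℝ} (hq : 0 < q) (hx : 0 < x) :
    ∑' i : ℕ, (x + i + 1) ^ (-q - 1) ≤ x ^ (-q) / q :=
  Real.tsum_le_of_sum_range_le (fun i => by positivity) (sum_range_rpow_le hq hx)

/-! ### Vanishing moments from the behaviour of a generating function at 1 -/

/-- If the coefficients of a power series decay and the series vanishes to high order at `1`,
then its coefficients have vanishing moments of order zero and one. -/
theorem tsum_eq_zero_of_abs_tsum_mul_exp_le {e : ℕ → ℝ} {C δ β : ℝ} (hδ : 0 < δ) (hβ : 1 < β)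
    (he : Summable fun n => |e n|) (hne : Summable fun n : ℕ => (n : ℝ) * |e n|)
    (hE : ∀ s, 0 < s → s ≤ δ → |∑' n : ℕ, e n * exp (-(s * n))| ≤ C * s ^ β) :
    ∑' n, e n = 0 ∧ ∑' n : ℕ, (n : ℝ) * e n = 0 := by
  have hs0 : ∀ᶠ s : ℝ in 𝓝[>] 0, 0 < s ∧ s ≤ δ := by
    filter_upwards [Ioc_mem_nhdsGT hδ] with s hs using hs
  have hid : Tendsto (fun s : ℝ => s) (𝓝[>] 0) (𝓝 0) := tendsto_nhdsWithin_of_tendsto_nhds tendsto_id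
  have hpow : ∀ γ : ℝ, 0 < γ → Tendsto (fun s : ℝ => C * s ^ γ) (𝓝[>] 0) (𝓝 0) := by
    intro γ hγ
    have h := (hid.rpow_const (p := γ) (Or.inr hγ.le)).const_mul C
    rwa [zero_rpow hγ.ne', mul_zero] at h
  have hexp : ∀ s : ℝ, 0 < s → ∀ n : ℕ, exp (-(s * n)) ≤ 1 := fun s hs n =>
    exp_le_one_iff.2 (neg_nonpos.2 (by positivity))
  have t1 : Tendsto (fun s : ℝ => ∑' n : ℕ, e n * exp (-(s * n))) (𝓝[>] 0) (𝓝 (∑' n, e n)) := by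
    refine tendsto_tsum_of_dominated_convergence he (fun n => ?_) ?_
    · have : Tendsto (fun s : ℝ => e n * exp (-(s * n))) (𝓝[>] 0) (𝓝 (e n * exp (-(0 * n)))) :=
        ((hid.mul_const _).neg.rexp).const_mul _
      simpa using this
    · filter_upwards [hs0] with s hs n
      rw [norm_eq_abs, abs_mul, abs_exp]
      exact mul_le_of_le_one_right (abs_nonneg _) (hexp s hs.1 n)
  have z1 : ∑' n, e n = 0 := by
    refine tendsto_nhds_unique t1 (squeeze_zero_norm' ?_ (hpow β (by linarith)))
    filter_upwards [hs0] with s hs using hE s hs.1 hs.2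
  refine ⟨z1, ?_⟩
  -- The first moment is a derivative of the generating function at s = 0. As the zeroth moment is
  -- already zero, the difference quotient is minus the series over `s`, which is O(s^(β-1)).
  have t2 : Tendsto (fun s : ℝ => ∑' n : ℕ, e n * ((1 - exp (-(s * n))) / s)) (𝓝[>] 0)
      (𝓝 (∑' n : ℕ, (n : ℝ) * e n)) := by
    refine tendsto_tsum_of_dominated_convergence hne (fun n => ?_) ?_
    · have hd : HasDerivAt (fun s : ℝ => -exp (-(s * n))) (n : ℝ) 0 := by
        have := ((hasDerivAt_id (0 : ℝ)).mul_const (n : ℝ)).neg.exp.neg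
        exact this.congr_deriv (by simp)
      have h := (hasDerivAt_iff_tendsto_slope.1 hd).mono_left
        (nhdsWithin_mono (0 : ℝ) (fun x (hx : 0 < x) => hx.ne'))
      rw [mul_comm]
      refine (h.const_mul (e n)).congr' ?_
      filter_upwards [hs0] with s hs
      simp [slope_def_field]
      left
      ring
    · filter_upwards [hs0] with s hs n
      rw [norm_eq_abs, abs_mul, mul_comm]
      refine mul_le_mul_of_nonneg_right ?_ (abs_nonneg _)
      have h1 := hexp s hs.1 n
      have h2 := add_one_le_exp (-(s * n))
      rw [abs_of_nonneg (div_nonneg (by linarith) hs.1.le), div_le_iff₀ hs.1]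
      linarith
  refine tendsto_nhds_unique t2 (squeeze_zero_norm' ?_ (hpow (β - 1) (by linarith)))
  filter_upwards [hs0] with s hs
  have hsum1 : Summable fun n : ℕ => e n * exp (-(s * n)) := by
    refine Summable.of_norm_bounded he fun n => ?_
    rw [norm_eq_abs, abs_mul, abs_exp]
    exact mul_le_of_le_one_right (abs_nonneg _) (hexp s hs.1 n)
  have heq : ∑' n : ℕ, e n * ((1 - exp (-(s * n))) / s) =
      -(∑' n : ℕ, e n * exp (-(s * n))) / s := by
    have h1 : ∀ n : ℕ, e n * ((1 - exp (-(s * n))) / s) = (e n - e n * exp (-(s * n))) / s := by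
      intro n; ring
    simp_rw [h1]
    rw [tsum_div_const, he.of_abs.tsum_sub hsum1, z1, zero_sub]
  rw [heq, norm_eq_abs, abs_div, abs_neg, abs_of_pos hs.1, rpow_sub_one hs.1.ne', ← mul_div_assoc]
  exact div_le_div_of_nonneg_right (hE s hs.1 hs.2) hs.1.le

/-! ## Hat function moments of the relaxation kernel -/

section Kernel

variable {α μ : ℝ}

theorem intervalIntegrable_relaxKernel (h0 : 0 < α) (h1 : α < 1) {x y : ℝ} (hx : 0 ≤ x)
    (hy : 0 ≤ y) : IntervalIntegrable (relaxKernel α μ) volume x y := by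
  have h2 : IntervalIntegrable (fun t : ℝ => kernelBound α * t ^ (α - 1)) volume x y :=
    (intervalIntegral.intervalIntegrable_rpow' (by linarith)).const_mul _
  refine h2.mono_fun' (measurable_relaxKernel α μ).aestronglyMeasurable ?_
  refine (ae_restrict_iff' measurableSet_uIoc).2 (Eventually.of_forall fun t ht => ?_)
  have ht0 : 0 < t := by
    rcases le_total x y with hxy | hxy
    · rw [uIoc_of_le hxy] at ht; exact hx.trans_lt ht.1
    · rw [uIoc_of_ge hxy] at ht; exact hy.trans_lt ht.1
  simp only [norm_eq_abs]
  rw [abs_of_nonneg (relaxKernel_nonneg h0 h1)]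
  exact relaxKernel_le h0 h1 ht0

theorem intervalIntegrable_mul_relaxKernel (h0 : 0 < α) (h1 : α < 1) {x y : ℝ} (hx : 0 ≤ x)
    (hy : 0 ≤ y) {φ : ℝ → ℝ} (hφ : Continuous φ) :
    IntervalIntegrable (fun t => φ t * relaxKernel α μ t) volume x y :=
  (intervalIntegrable_relaxKernel h0 h1 hx hy).continuousOn_mul hφ.continuousOn

theorem integral_mul_relaxKernel_mono (h0 : 0 < α) (h1 : α < 1) {x y : ℝ} (hx : 0 ≤ x)
    (hxy : x ≤ y) {φ ψ : ℝ → ℝ} (hφ : Continuous φ) (hψ : Continuous ψ)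
    (h : ∀ t ∈ Icc x y, φ t ≤ ψ t) :
    ∫ t in x..y, φ t * relaxKernel α μ t ≤ ∫ t in x..y, ψ t * relaxKernel α μ t :=
  intervalIntegral.integral_mono_on hxy
    (intervalIntegrable_mul_relaxKernel h0 h1 hx (hx.trans hxy) hφ)
    (intervalIntegrable_mul_relaxKernel h0 h1 hx (hx.trans hxy) hψ)
    fun t ht => mul_le_mul_of_nonneg_right (h t ht) (relaxKernel_nonneg h0 h1)

/-- Subadditivity of x ↦ x^α makes the bound uniform in the interval, including the one at the
singularity. -/
theorem integral_relaxKernel_unit_le (h0 : 0 < α) (h1 : α < 1) {x : ℝ} (hx : 0 ≤ x) :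
    ∫ t in x..x + 1, relaxKernel α μ t ≤ kernelBound α / α := by
  have hB := kernelBound_pos h0 h1
  calc ∫ t in x..x + 1, relaxKernel α μ t
      ≤ ∫ t in x..x + 1, kernelBound α * t ^ (α - 1) := by
        refine intervalIntegral.integral_mono_on_of_le_Ioo (by linarith)
          (intervalIntegrable_relaxKernel h0 h1 hx (by linarith))
          ((intervalIntegral.intervalIntegrable_rpow' (by linarith)).const_mul _) ?_
        exact fun t ht => relaxKernel_le h0 h1 (hx.trans_lt ht.1)
    _ = kernelBound α * (((x + 1) ^ α - x ^ α) / α) := by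
        rw [intervalIntegral.integral_const_mul, integral_rpow (Or.inl (by linarith)),
          sub_add_cancel]
    _ ≤ kernelBound α * (1 / α) := by
        gcongr
        have := Real.rpow_add_le_add_rpow hx zero_le_one h0.le h1.le
        rw [one_rpow] at this
        linarith
    _ = _ := by ring

/-- `∫ₙⁿ⁺¹ (n + 1 - t) k(t) dt`. -/
noncomputable def hatLeft (α μ : ℝ) (n : ℕ) : ℝ :=
  ∫ t in (n : ℝ)..n + 1, ((n + 1 : ℝ) - t) * relaxKernel α μ t

/-- `∫ₙⁿ⁺¹ (t - n) k(t) dt`. -/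
noncomputable def hatRight (α μ : ℝ) (n : ℕ) : ℝ :=
  ∫ t in (n : ℝ)..n + 1, (t - n) * relaxKernel α μ t

/-- The integral of the relaxation kernel against the hat function at `n`. -/
noncomputable def hatMoment (α μ : ℝ) : ℕ → ℝ
  | 0 => hatLeft α μ 0
  | n + 1 => hatLeft α μ (n + 1) + hatRight α μ n

theorem hatLeft_mem (h0 : 0 < α) (h1 : α < 1) (n : ℕ) :
    0 ≤ hatLeft α μ n ∧ hatLeft α μ n ≤ ∫ t in (n : ℝ)..n + 1, relaxKernel α μ t := by
  have hn : (0 : ℝ) ≤ n := n.cast_nonneg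
  constructor
  · have := integral_mul_relaxKernel_mono (μ := μ) h0 h1 hn (by linarith : (n : ℝ) ≤ n + 1)
      (φ := fun _ => 0) (ψ := fun t => n + 1 - t) (by fun_prop) (by fun_prop)
      (fun t ht => by linarith [ht.2])
    simpa [hatLeft] using this
  · have := integral_mul_relaxKernel_mono (μ := μ) h0 h1 hn (by linarith : (n : ℝ) ≤ n + 1)
      (φ := fun t => n + 1 - t) (ψ := fun _ => 1) (by fun_prop) (by fun_prop)
      (fun t ht => by linarith [ht.1])
    simpa [hatLeft] using this

theorem hatRight_mem (h0 : 0 < α) (h1 : α < 1) (n : ℕ) :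
    0 ≤ hatRight α μ n ∧ hatRight α μ n ≤ ∫ t in (n : ℝ)..n + 1, relaxKernel α μ t := by
  have hn : (0 : ℝ) ≤ n := n.cast_nonneg
  constructor
  · have := integral_mul_relaxKernel_mono (μ := μ) h0 h1 hn (by linarith : (n : ℝ) ≤ n + 1)
      (φ := fun _ => 0) (ψ := fun t => t - n) (by fun_prop) (by fun_prop)
      (fun t ht => by linarith [ht.1])
    simpa [hatRight] using this
  · have := integral_mul_relaxKernel_mono (μ := μ) h0 h1 hn (by linarith : (n : ℝ) ≤ n + 1)
      (φ := fun t => t - n) (ψ := fun _ => 1) (by fun_prop) (by fun_prop)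
      (fun t ht => by linarith [ht.2])
    simpa [hatRight] using this

theorem abs_hatMoment_le (h0 : 0 < α) (h1 : α < 1) (n : ℕ) :
    |hatMoment α μ n| ≤ 2 * (kernelBound α / α) := by
  have hB : 0 < kernelBound α / α := div_pos (kernelBound_pos h0 h1) h0
  have hk := fun n : ℕ => integral_relaxKernel_unit_le (μ := μ) h0 h1 (n.cast_nonneg (α := ℝ))
  cases n with
  | zero =>
    have h2 := hatLeft_mem (μ := μ) h0 h1 0
    rw [hatMoment, abs_of_nonneg h2.1]
    exact h2.2.trans ((hk 0).trans (by linarith))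
  | succ n =>
    have h2 := hatLeft_mem (μ := μ) h0 h1 (n + 1)
    have h3 := hatRight_mem (μ := μ) h0 h1 n
    rw [hatMoment, abs_of_nonneg (add_nonneg h2.1 h3.1)]
    linarith [h2.2, hk n, h3.2, hk (n + 1)]

/-- Folding the symmetric hat about its node leaves the second difference of the kernel; the hat has
integral one. -/
theorem hatMoment_sub_eq_integral (h0 : 0 < α) (h1 : α < 1) (n : ℕ) :
    hatMoment α μ (n + 1) - relaxKernel α μ ((n + 1 : ℕ) : ℝ) =
      ∫ x in (0 : ℝ)..1, (1 - x) * (relaxKernel α μ ((n + 1 : ℕ) + x) +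
        relaxKernel α μ ((n + 1 : ℕ) - x) - 2 * relaxKernel α μ ((n + 1 : ℕ) : ℝ)) := by
  set m : ℝ := ((n + 1 : ℕ) : ℝ) with hm
  have hm' : m = n + 1 := by rw [hm]; push_cast; ring
  have e1 : hatLeft α μ (n + 1) = ∫ x in (0 : ℝ)..1, (1 - x) * relaxKernel α μ (m + x) := by
    have := intervalIntegral.integral_comp_add_left (a := 0) (b := 1)
      (fun t => (m + 1 - t) * relaxKernel α μ t) m
    rw [hatLeft, ← hm, ← add_zero m, add_assoc, zero_add, ← this]
    refine intervalIntegral.integral_congr fun x _ => ?_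
    ring_nf
  have e2 : hatRight α μ n = ∫ x in (0 : ℝ)..1, (1 - x) * relaxKernel α μ (m - x) := by
    have := intervalIntegral.integral_comp_sub_left (a := 0) (b := 1)
      (fun t => (t - n) * relaxKernel α μ t) m
    have hmn : m - 1 = n := by rw [hm']; ring
    rw [hmn, sub_zero] at this
    rw [hatRight, ← hm', ← this]
    refine intervalIntegral.integral_congr fun x _ => ?_
    simp only [hm']
    ring_nf
  have i1 : IntervalIntegrable (fun x => (1 - x) * relaxKernel α μ (m + x)) volume 0 1 := by
    have := (intervalIntegrable_relaxKernel (μ := μ) h0 h1 (x := m) (y := m + 1)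
      (by positivity) (by positivity)).comp_add_left (c := m)
    simp only [sub_self, add_sub_cancel_left] at this
    exact this.continuousOn_mul (by fun_prop)
  have i2 : IntervalIntegrable (fun x => (1 - x) * relaxKernel α μ (m - x)) volume 0 1 := by
    have := (intervalIntegrable_relaxKernel (μ := μ) h0 h1 (x := m) (y := m - 1)
      (by positivity) (by rw [hm']; simp)).comp_sub_left (c := m)
    simp only [sub_self, sub_sub_cancel] at this
    exact this.continuousOn_mul (by fun_prop)
  have i3 : IntervalIntegrable (fun x => (1 - x) * (2 * relaxKernel α μ m)) volume 0 1 :=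
    (by fun_prop : Continuous fun x => (1 - x) * (2 * relaxKernel α μ m)).intervalIntegrable _ _
  have e3 : ∫ x in (0 : ℝ)..1, (1 - x) * (2 * relaxKernel α μ m) = relaxKernel α μ m := by
    rw [intervalIntegral.integral_mul_const, intervalIntegral.integral_sub
      (by simp) (by simp)]
    norm_num
    ring
  simp_rw [mul_sub, mul_add]
  rw [intervalIntegral.integral_sub (i1.add i2) i3, intervalIntegral.integral_add i1 i2, e3,
    ← e1, ← e2, hatMoment]

theorem exists_abs_hatMoment_sub_cnKernel_le (h0 : 0 < α) (h1 : α < 1) :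
    ∃ C, 0 < C ∧ ∀ μ, 0 ≤ μ → ∀ n : ℕ,
      |hatMoment α μ n - cnKernel α μ n| ≤ C * ((n : ℝ) + 1) ^ (α - 3) := by
  obtain ⟨C, hC, hK⟩ := exists_abs_cnKernel_sub_relaxKernel_le h0 h1
  have hB := kernelBound_pos h0 h1
  have hD : 0 < densBound α * Gamma (3 - α) :=
    mul_pos (densBound_pos h0 h1) (Gamma_pos_of_pos (by linarith))
  set A := 2 * (kernelBound α / α) + kernelBound α + 1 + C with hA
  have hA0 : 0 < A := by positivity
  set D := densBound α * Gamma (3 - α) with hDdef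
  refine ⟨(A + D + C) * 3 ^ (3 - α), by positivity, fun μ hμ n => ?_⟩
  -- The argument (n + 1)/3 covers all cases: it is at most 1 for n ≤ 1, where the power is at least
  -- 1 and crude bounds suffice, and at most n - 1 for n ≥ 2, where k(n) serves as intermediate
  -- value.
  have hkey : |hatMoment α μ n - cnKernel α μ n| ≤
      (A + D + C) * (((n : ℝ) + 1) / 3) ^ (α - 3) := by
    rcases Nat.lt_or_ge n 2 with hn | hn
    · have h3 : (1 : ℝ) ≤ (((n : ℝ) + 1) / 3) ^ (α - 3) := by
        refine one_le_rpow_of_pos_of_le_one_of_nonpos (by positivity) ?_ (by linarith)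
        have : (n : ℝ) ≤ 1 := by exact_mod_cast Nat.lt_succ_iff.1 hn
        linarith
      have h4 : |cnKernel α μ n| ≤ kernelBound α + 1 + C := by
        interval_cases n
        · linarith [abs_cnKernel_zero_le h0 h1 hμ]
        · have h5 := hK μ hμ 1 le_rfl
          have h6 := relaxKernel_le (lam := μ) h0 h1 one_pos
          have h7 := relaxKernel_nonneg (lam := μ) (t := 1) h0 h1
          rw [one_rpow] at h6
          norm_num at h5
          have h8 : |cnKernel α μ 1| ≤ |cnKernel α μ 1 - relaxKernel α μ 1| + |relaxKernel α μ 1| := by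
            simpa using abs_add_le (cnKernel α μ 1 - relaxKernel α μ 1) (relaxKernel α μ 1)
          rw [abs_of_nonneg h7] at h8
          linarith
      have h5 := abs_hatMoment_le (μ := μ) h0 h1 n
      have h6 := abs_sub (hatMoment α μ n) (cnKernel α μ n)
      have h7 : A + D + C ≤ (A + D + C) * (((n : ℝ) + 1) / 3) ^ (α - 3) :=
        le_mul_of_one_le_right (by positivity) h3
      linarith
    · obtain ⟨m, rfl⟩ : ∃ m, n = m + 1 := ⟨n - 1, by omega⟩
      have hm : (1 : ℝ) ≤ m := by exact_mod_cast (by omega : 1 ≤ m)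
      have hmono : ∀ y : ℝ, (((m + 1 : ℕ) : ℝ) + 1) / 3 ≤ y →
          y ^ (α - 3) ≤ ((((m + 1 : ℕ) : ℝ) + 1) / 3) ^ (α - 3) := fun y hy =>
        rpow_le_rpow_of_nonpos (by positivity) hy (by linarith)
      have h3 : |hatMoment α μ (m + 1) - relaxKernel α μ ((m + 1 : ℕ) : ℝ)| ≤
          D * (m : ℝ) ^ (α - 3) := by
        rw [hatMoment_sub_eq_integral h0 h1, ← norm_eq_abs]
        refine (intervalIntegral.norm_integral_le_of_norm_le_const (C := D * (m : ℝ) ^ (α - 3))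
          fun x hx => ?_).trans (by simp)
        rw [uIoc_of_le zero_le_one] at hx
        have h4 := relaxKernel_second_diff (lam := μ) h0 h1 (t := ((m + 1 : ℕ) : ℝ))
          (by push_cast; linarith) hx.1.le hx.2
        have h5 : ((m + 1 : ℕ) : ℝ) - 1 = m := by push_cast; ring
        rw [h5] at h4
        rw [norm_mul, norm_eq_abs, norm_eq_abs, abs_of_nonneg h4.1,
          abs_of_nonneg (by linarith [hx.2])]
        exact (mul_le_of_le_one_left h4.1 (by linarith [hx.1])).trans h4.2
      have h4 := hK μ hμ (m + 1) (by omega)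
      have h5 := hmono m (by push_cast; linarith)
      have h6 := hmono ((m + 1 : ℕ) : ℝ) (by push_cast; linarith)
      have h7 := abs_sub_le (hatMoment α μ (m + 1)) (relaxKernel α μ ((m + 1 : ℕ) : ℝ))
        (cnKernel α μ (m + 1))
      rw [abs_sub_comm (relaxKernel α μ _)] at h7
      set P := ((((m + 1 : ℕ) : ℝ) + 1) / 3) ^ (α - 3)
      have hP : 0 ≤ P := by positivity
      nlinarith
  refine hkey.trans (le_of_eq ?_)
  rw [div_rpow (by positivity) (by norm_num), mul_assoc, ← neg_sub 3 α,
    rpow_neg (by norm_num : (0 : ℝ) ≤ 3), div_inv_eq_mul]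
  ring

end Kernel

/-! ## Generating functions -/

section Generating

variable {α μ : ℝ}

theorem hasSum_integral_exp_mul_relaxKernel (h0 : 0 < α) (h1 : α < 1) (hμ : 0 ≤ μ) {s : ℝ}
    (hs : 0 < s) :
    HasSum (fun n : ℕ => ∫ t in (n : ℝ)..n + 1, exp (-(s * t)) * relaxKernel α μ t)
      (s ^ α + μ)⁻¹ := by
  have hnn : ∀ t, 0 ≤ exp (-(s * t)) * relaxKernel α μ t := fun t =>
    mul_nonneg (exp_pos _).le (relaxKernel_nonneg h0 h1)
  rw [hasSum_iff_tendsto_nat_of_nonneg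
    (fun n => intervalIntegral.integral_nonneg (by linarith) fun t _ => hnn t)]
  have h := intervalIntegral_tendsto_integral_Ioi 0
    (integrableOn_exp_mul_relaxKernel (lam := μ) h0 h1 hs) tendsto_natCast_atTop_atTop
  rw [integral_exp_mul_relaxKernel h0 h1 hμ hs] at h
  refine h.congr fun N => ?_
  have := intervalIntegral.sum_integral_adjacent_intervals (μ := volume)
    (f := fun t => exp (-(s * t)) * relaxKernel α μ t) (a := fun n : ℕ => (n : ℝ)) (n := N)
    (fun k _ => intervalIntegrable_mul_relaxKernel h0 h1 k.cast_nonneg (k + 1).cast_nonneg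
      (by fun_prop))
  simp only [Nat.cast_zero, Nat.cast_add, Nat.cast_one] at this
  exact this.symm

/-- The error of linear interpolation of e^(-sx) is at most s². The relative form, with factor 3 >
e, can be summed against the kernel without loss. -/
theorem abs_exp_neg_interp_sub_le {s x : ℝ} (hs : 0 ≤ s) (hs1 : s ≤ 1) (hx : 0 ≤ x) (hx1 : x ≤ 1) :
    |(1 - x) + x * exp (-s) - exp (-(s * x))| ≤ 3 * s ^ 2 * exp (-(s * x)) := by
  have hb : ∀ y : ℝ, 0 ≤ y → y ≤ 1 → |exp (-y) - 1 - -y| ≤ y ^ 2 := by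
    intro y hy hy1
    have := abs_exp_sub_one_sub_id_le (x := -y) (by rwa [abs_neg, abs_of_nonneg hy])
    simpa using this
  have h1 := abs_le.1 (hb s hs hs1)
  have hsx : s * x ≤ s := mul_le_of_le_one_right hs hx1
  have hsx0 : 0 ≤ s * x := by positivity
  have h2 := abs_le.1 (hb (s * x) hsx0 (hsx.trans hs1))
  have h3 : exp (-1 : ℝ) ≤ exp (-(s * x)) := exp_le_exp.2 (by linarith)
  have h4 : (1 / 3 : ℝ) < exp (-1) := by
    rw [exp_neg, ← one_div, one_div_lt_one_div (by norm_num) (exp_pos 1)]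
    linarith [exp_one_lt_d9]
  have h5 : s ^ 2 ≤ 3 * s ^ 2 * exp (-(s * x)) := by nlinarith [sq_nonneg s]
  refine le_trans ?_ h5
  have h6 := add_one_le_exp (-s)
  have h7 := add_one_le_exp (-(s * x))
  have h8 : (s * x) ^ 2 ≤ s ^ 2 := pow_le_pow_left₀ hsx0 hsx 2
  have h9 : x * (exp (-s) - 1 + s) ≤ 1 * s ^ 2 :=
    mul_le_mul hx1 (by linarith) (by linarith) zero_le_one
  have h10 : 0 ≤ x * (exp (-s) - 1 + s) := mul_nonneg hx (by linarith)
  rw [abs_le]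
  constructor <;> linarith

/-- Regroups the sum by intervals [n, n + 1] instead of nodes, so that it can be compared with the
integral cell by cell. -/
theorem hasSum_hatMoment_mul_exp (h0 : 0 < α) (h1 : α < 1) {s : ℝ} (hs : 0 < s) :
    HasSum (fun n : ℕ => hatMoment α μ n * exp (-(s * n)))
      (∑' n : ℕ, (hatLeft α μ n * exp (-(s * n)) + hatRight α μ n * exp (-(s * (n + 1))))) := by
  have hexp : Summable fun n : ℕ => exp (-(s * n)) := by
    have := summable_geometric_of_lt_one (exp_pos (-s)).le (exp_lt_one_iff.mpr (by linarith : -s < 0))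
    refine this.congr fun n => ?_
    rw [← exp_nat_mul]
    ring_nf
  have hk := fun n : ℕ => integral_relaxKernel_unit_le (μ := μ) h0 h1 (n.cast_nonneg (α := ℝ))
  have hL : Summable fun n : ℕ => hatLeft α μ n * exp (-(s * n)) := by
    refine Summable.of_nonneg_of_le (fun n => ?_) (fun n => ?_) (hexp.mul_left (kernelBound α / α))
    · exact mul_nonneg (hatLeft_mem h0 h1 n).1 (exp_pos _).le
    · exact mul_le_mul_of_nonneg_right ((hatLeft_mem h0 h1 n).2.trans (hk n)) (exp_pos _).le
  have hR : Summable fun n : ℕ => hatRight α μ n * exp (-(s * (n + 1))) := by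
    refine Summable.of_nonneg_of_le (fun n => ?_) (fun n => ?_) (hexp.mul_left (kernelBound α / α))
    · exact mul_nonneg (hatRight_mem h0 h1 n).1 (exp_pos _).le
    · refine mul_le_mul ((hatRight_mem h0 h1 n).2.trans (hk n)) ?_ (exp_pos _).le
        (div_pos (kernelBound_pos h0 h1) h0).le
      exact exp_le_exp.2 (by nlinarith)
  rw [hL.tsum_add hR, ← hasSum_nat_add_iff' 1]
  have h2 := ((hasSum_nat_add_iff' 1).2 hL.hasSum).add hR.hasSum
  convert h2 using 1
  · funext n
    simp only [hatMoment]
    push_cast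
    ring
  · simp [hatMoment]
    ring

/-- The sum is the integral of the kernel against the piecewise linear interpolant of e^(-st). The
interpolation error is relative and the kernel nonnegative, so the Laplace transform itself bounds
the difference. -/
theorem abs_tsum_hatMoment_sub_le (h0 : 0 < α) (h1 : α < 1) (hμ : 0 ≤ μ) {s : ℝ} (hs : 0 < s)
    (hs1 : s ≤ 1) :
    |(∑' n : ℕ, hatMoment α μ n * exp (-(s * n))) - (s ^ α + μ)⁻¹| ≤ 3 * s ^ 2 * (s ^ α + μ)⁻¹ := by
  have hI := hasSum_integral_exp_mul_relaxKernel h0 h1 hμ hs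
  have hJ : ∀ n : ℕ, |hatLeft α μ n * exp (-(s * n)) + hatRight α μ n * exp (-(s * (n + 1))) -
      ∫ t in (n : ℝ)..n + 1, exp (-(s * t)) * relaxKernel α μ t| ≤
      3 * s ^ 2 * ∫ t in (n : ℝ)..n + 1, exp (-(s * t)) * relaxKernel α μ t := by
    intro n
    have hn : (0 : ℝ) ≤ n := n.cast_nonneg
    have hi : ∀ φ : ℝ → ℝ, Continuous φ →
        IntervalIntegrable (fun t => φ t * relaxKernel α μ t) volume n (n + 1) := fun φ hφ =>
      intervalIntegrable_mul_relaxKernel h0 h1 hn (by linarith) hφ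
    have e : hatLeft α μ n * exp (-(s * n)) + hatRight α μ n * exp (-(s * (n + 1))) -
        ∫ t in (n : ℝ)..n + 1, exp (-(s * t)) * relaxKernel α μ t =
        ∫ t in (n : ℝ)..n + 1, (exp (-(s * n)) * (n + 1 - t) + exp (-(s * (n + 1))) * (t - n) -
          exp (-(s * t))) * relaxKernel α μ t := by
      rw [hatLeft, hatRight, mul_comm, ← intervalIntegral.integral_const_mul,
        mul_comm (intervalIntegral _ _ _ _), ← intervalIntegral.integral_const_mul,
        ← intervalIntegral.integral_add ((hi _ (by fun_prop)).const_mul _)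
          ((hi _ (by fun_prop)).const_mul _),
        ← intervalIntegral.integral_sub (((hi _ (by fun_prop)).const_mul _).add
          ((hi _ (by fun_prop)).const_mul _)) (hi _ (by fun_prop))]
      refine intervalIntegral.integral_congr fun t _ => ?_
      ring_nf
    rw [e, ← intervalIntegral.integral_const_mul]
    refine (intervalIntegral.abs_integral_le_integral_abs (by linarith)).trans ?_
    refine intervalIntegral.integral_mono_on (by linarith) (hi _ (by fun_prop)).abs
      ((hi _ (by fun_prop)).const_mul _) fun t ht => ?_
    rw [abs_mul, abs_of_nonneg (relaxKernel_nonneg h0 h1), ← mul_assoc]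
    refine mul_le_mul_of_nonneg_right ?_ (relaxKernel_nonneg h0 h1)
    have h3 := abs_exp_neg_interp_sub_le hs.le hs1 (x := t - n) (by linarith [ht.1])
      (by linarith [ht.2])
    have e1 : exp (-(s * (n + 1))) = exp (-(s * n)) * exp (-s) := by rw [← exp_add]; ring_nf
    have e2 : exp (-(s * t)) = exp (-(s * n)) * exp (-(s * (t - n))) := by
      rw [← exp_add]; ring_nf
    have e3 : exp (-(s * n)) * (n + 1 - t) + exp (-(s * (n + 1))) * (t - n) - exp (-(s * t)) =
        exp (-(s * n)) * ((1 - (t - n)) + (t - n) * exp (-s) - exp (-(s * (t - n)))) := by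
      rw [e1, e2]; ring
    rw [e3, abs_mul, abs_exp, e2]
    calc _ ≤ exp (-(s * n)) * (3 * s ^ 2 * exp (-(s * (t - n)))) := by gcongr
      _ = _ := by ring
  rw [(hasSum_hatMoment_mul_exp h0 h1 hs).tsum_eq]
  set J : ℕ → ℝ := fun n => hatLeft α μ n * exp (-(s * n)) +
    hatRight α μ n * exp (-(s * (n + 1))) with hJdef
  set I : ℕ → ℝ := fun n => ∫ t in (n : ℝ)..n + 1, exp (-(s * t)) * relaxKernel α μ t with hIdef
  have hb : HasSum (fun n => 3 * s ^ 2 * I n) (3 * s ^ 2 * (s ^ α + μ)⁻¹) := hI.mul_left _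
  have hd : Summable fun n => J n - I n := Summable.of_norm_bounded hb.summable hJ
  have hJs : Summable J := by
    have := hd.add hI.summable
    simpa using this
  rw [← hI.tsum_eq, ← hJs.tsum_sub hI.summable, ← norm_eq_abs]
  refine (tsum_of_norm_bounded hb hJ).trans_eq ?_
  rw [hI.tsum_eq]

/-- The generating function `cnInv` at ξ = e^(-s), divided through by the averaging polynomial. -/
theorem hasSum_cnKernel_mul_exp (h0 : 0 < α) (h1 : α < 1) (hμ : 0 ≤ μ) {s : ℝ} (hs : 0 < s) :
    HasSum (fun n : ℕ => cnKernel α μ n * exp (-(s * n)))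
      (s ^ α * symbolRatio α (-s) + μ)⁻¹ := by
  have hlt : exp (-s) < 1 := exp_lt_one_iff.mpr (by linarith)
  have h := hasSum_cnKernel h0 h1 hμ (z := ((exp (-s) : ℝ) : ℂ))
    (by rwa [Complex.norm_real, norm_eq_abs, abs_exp])
  have hx : 0 < (exp (-s) - 1) / -s := by
    rw [div_pos_iff]; right; constructor <;> linarith
  have hp : 0 < 1 + α / 2 * (exp (-s) - 1) := by nlinarith [exp_pos (-s)]
  have e1 : cnInv α μ ((exp (-s) : ℝ) : ℂ) =
      (((s ^ α * symbolRatio α (-s) + μ)⁻¹ : ℝ) : ℂ) := by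
    have e2 : (1 - ((exp (-s) : ℝ) : ℂ)) ^ (α : ℂ) = ((((1 - exp (-s)) ^ α : ℝ)) : ℂ) := by
      rw [Complex.ofReal_cpow (by linarith)]
      push_cast
      rfl
    have e3 : (1 - exp (-s)) ^ α = s ^ α * ((exp (-s) - 1) / -s) ^ α := by
      rw [← mul_rpow hs.le hx.le]
      congr 1
      field_simp
      ring
    rw [cnInv, e2, e3, symbolRatio]
    have hA : 0 ≤ s ^ α * ((exp (-s) - 1) / -s) ^ α := by positivity
    norm_cast
    have hden : s ^ α * (((exp (-s) - 1) / -s) ^ α / (1 + α / 2 * (exp (-s) - 1))) + μ =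
        (s ^ α * ((exp (-s) - 1) / -s) ^ α + μ * (1 - α / 2 * (1 - exp (-s)))) /
          (1 - α / 2 * (1 - exp (-s))) := by
      have : 1 + α / 2 * (exp (-s) - 1) = 1 - α / 2 * (1 - exp (-s)) := by ring
      rw [this] at hp ⊢
      rw [add_div, mul_div_assoc, mul_div_cancel_right₀ _ hp.ne']
    rw [hden, inv_div]
  rw [e1] at h
  have h2 := Complex.hasSum_re h
  simp only [Complex.ofReal_re] at h2
  convert h2 using 2 with n
  rw [← Complex.ofReal_pow, ← Complex.ofReal_mul, Complex.ofReal_re, ← exp_nat_mul, mul_comm]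
  ring_nf

/-- Both series equal (s^α + μ)⁻¹ up to a relative error O(s²), one by linear interpolation and one
by consistency of the symbol; and (s^α + μ)⁻¹ ≤ s^(-α). -/
theorem exists_abs_tsum_sub_le (h0 : 0 < α) (h1 : α < 1) :
    ∃ C δ, 0 < δ ∧ ∀ μ, 0 ≤ μ → ∀ s, 0 < s → s ≤ δ →
      |(∑' n : ℕ, hatMoment α μ n * exp (-(s * n))) - ∑' n : ℕ, cnKernel α μ n * exp (-(s * n))| ≤
        C * s ^ (2 - α) := by
  obtain ⟨C, δ, hC, hδ, hsym⟩ := exists_abs_symbolRatio_sub_one_le α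
  -- The last term gives C s² ≤ C s ≤ 1/2, so the symbol ratio at -s is at least 1/2.
  set ε := min (min δ 1) (1 / (2 * C + 1)) with hε
  have hε0 : 0 < ε := by positivity
  refine ⟨3 + 2 * C, ε, hε0, fun μ hμ s hs hsε => ?_⟩
  have hs1 : s ≤ 1 := hsε.trans ((min_le_left _ _).trans (min_le_right _ _))
  have hsδ : s ≤ δ := hsε.trans ((min_le_left _ _).trans (min_le_left _ _))
  have hsC : s * (2 * C + 1) ≤ 1 := by
    have := hsε.trans (min_le_right _ _)
    rwa [le_div_iff₀ (by positivity)] at this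
  have hh := hsym (-s) (by linarith [hs]) (by rwa [abs_neg, abs_of_pos hs])
  rw [neg_sq] at hh
  set h := symbolRatio α (-s) with hhdef
  have hh2 : 1 / 2 ≤ h := by
    have := (abs_le.1 hh).1
    nlinarith
  have hp : 0 < s ^ α := rpow_pos_of_pos hs _
  have hA := abs_tsum_hatMoment_sub_le h0 h1 hμ hs hs1
  rw [(hasSum_cnKernel_mul_exp h0 h1 hμ hs).tsum_eq]
  have hpow : s ^ (2 - α) = s ^ 2 / s ^ α := by
    rw [rpow_sub hs]; norm_num
  have hle : (s ^ α + μ)⁻¹ ≤ (s ^ α)⁻¹ := inv_anti₀ hp (by linarith)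
  have hB : |(s ^ α + μ)⁻¹ - (s ^ α * h + μ)⁻¹| ≤ 2 * C * s ^ 2 * (s ^ α)⁻¹ := by
    have d1 : 0 < s ^ α + μ := by positivity
    have d2 : 0 < s ^ α * h + μ := by positivity
    have e : (s ^ α + μ)⁻¹ - (s ^ α * h + μ)⁻¹ = s ^ α * (h - 1) * ((s ^ α + μ)⁻¹ * (s ^ α * h + μ)⁻¹) := by
      field_simp
      ring
    have hle2 : (s ^ α * h + μ)⁻¹ ≤ (s ^ α * (1 / 2))⁻¹ := by
      refine inv_anti₀ (by positivity) ?_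
      have := mul_le_mul_of_nonneg_left hh2 hp.le
      linarith
    rw [e, abs_mul, abs_mul, abs_of_pos hp, abs_of_pos (by positivity : 0 < (s ^ α + μ)⁻¹ * (s ^ α * h + μ)⁻¹)]
    calc s ^ α * |h - 1| * ((s ^ α + μ)⁻¹ * (s ^ α * h + μ)⁻¹)
        ≤ s ^ α * (C * s ^ 2) * ((s ^ α)⁻¹ * (s ^ α * (1 / 2))⁻¹) := by gcongr
      _ = _ := by field_simp
  have := abs_sub_le (∑' n : ℕ, hatMoment α μ n * exp (-(s * n))) (s ^ α + μ)⁻¹ (s ^ α * h + μ)⁻¹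
  calc _ ≤ 3 * s ^ 2 * (s ^ α + μ)⁻¹ + 2 * C * s ^ 2 * (s ^ α)⁻¹ := by linarith
    _ ≤ 3 * s ^ 2 * (s ^ α)⁻¹ + 2 * C * s ^ 2 * (s ^ α)⁻¹ := by gcongr
    _ = _ := by rw [hpow]; ring

end Generating

/-! ## Quadrature errors -/

section Quadrature

variable {α μ : ℝ}

/-- Partial sums of the differences between hat moments and quadrature weights, and of their
first moments, are controlled by the tails. -/
theorem exists_abs_sum_sub_le (h0 : 0 < α) (h1 : α < 1) :
    ∃ C, 0 < C ∧ ∀ μ, 0 ≤ μ → ∀ n : ℕ, 1 ≤ n →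
      |∑ j ∈ Finset.range n, (hatMoment α μ j - cnKernel α μ j)| ≤ C * (n : ℝ) ^ (α - 2) ∧
      |∑ j ∈ Finset.range n, ((n : ℝ) - j) * (hatMoment α μ j - cnKernel α μ j)| ≤
        C * (n : ℝ) ^ (α - 1) := by
  obtain ⟨C, hC, he⟩ := exists_abs_hatMoment_sub_cnKernel_le h0 h1
  obtain ⟨A, δ, hδ, hE⟩ := exists_abs_tsum_sub_le h0 h1
  refine ⟨C / (1 - α), div_pos hC (by linarith), fun μ hμ n hn => ?_⟩
  have hn0 : (0 : ℝ) < n := by exact_mod_cast hn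
  set e : ℕ → ℝ := fun j => hatMoment α μ j - cnKernel α μ j with hedef
  have he' : ∀ j, |e j| ≤ C * ((j : ℝ) + 1) ^ (α - 3) := he μ hμ
  have hne' : ∀ (i : ℕ) (x : ℝ), 0 ≤ x → x ≤ i + 1 → x * |e i| ≤ C * ((i : ℝ) + 1) ^ (α - 2) := by
    intro i x hx hxi
    have hp : (0 : ℝ) < i + 1 := by positivity
    have e1 : ((i : ℝ) + 1) ^ (α - 2) = (i + 1) * ((i : ℝ) + 1) ^ (α - 3) := by
      rw [show α - 2 = 1 + (α - 3) by ring, rpow_add hp, rpow_one]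
    rw [e1]
    calc x * |e i| ≤ (i + 1) * (C * ((i : ℝ) + 1) ^ (α - 3)) := by
          gcongr; exact he' i
      _ = _ := by ring
  have key : ∀ (q : ℝ), 0 < q → Summable fun i : ℕ => C * ((i : ℝ) + 1) ^ (-q - 1) := by
    intro q hq
    have := (summable_add_rpow hq one_pos).mul_left C
    rw [← summable_nat_add_iff 1]
    refine this.congr fun i => ?_
    push_cast
    ring_nf
  have hs1 : Summable fun j => |e j| := by
    refine Summable.of_nonneg_of_le (fun j => abs_nonneg _) he' ?_
    have := key (2 - α) (by linarith)
    rwa [show -(2 - α) - 1 = α - 3 by ring] at this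
  have hs2 : Summable fun j : ℕ => (j : ℝ) * |e j| := by
    refine Summable.of_nonneg_of_le (fun j => by positivity)
      (fun j => hne' j j (by positivity) (by linarith)) ?_
    have := key (1 - α) (by linarith)
    rwa [show -(1 - α) - 1 = α - 2 by ring] at this
  have hs2' : Summable fun j : ℕ => (j : ℝ) * e j := by
    refine Summable.of_norm_bounded hs2 fun j => ?_
    rw [norm_eq_abs, abs_mul, Nat.abs_cast]
  -- The size of `A` is irrelevant: only the order 2 - α > 1 of vanishing counts.
  obtain ⟨z1, z2⟩ := tsum_eq_zero_of_abs_tsum_mul_exp_le (e := e) (C := A) (β := 2 - α) hδ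
    (by linarith) hs1 hs2 (by
      intro s hs hsδ
      have hsum1 := hasSum_hatMoment_mul_exp (μ := μ) h0 h1 hs
      have hsum2 := hasSum_cnKernel_mul_exp h0 h1 hμ hs
      have := hE μ hμ s hs hsδ
      rw [← hsum1.summable.tsum_sub hsum2.summable] at this
      simpa only [hedef, sub_mul] using this)
  constructor
  · have h := hs1.of_abs.sum_add_tsum_nat_add n
    rw [z1] at h
    have hb : ∀ i : ℕ, ‖e (i + n)‖ ≤ C * ((n : ℝ) + i + 1) ^ (-(2 - α) - 1) := by
      intro i
      refine (he' _).trans_eq ?_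
      push_cast
      ring_nf
    have hsm := (summable_add_rpow (q := 2 - α) (by linarith) hn0).mul_left C
    have h2 := tsum_of_norm_bounded hsm.hasSum hb
    rw [tsum_mul_left] at h2
    have h3 := tsum_add_rpow_le (q := 2 - α) (by linarith) hn0
    rw [eq_neg_of_add_eq_zero_left h, abs_neg, ← norm_eq_abs]
    refine h2.trans ?_
    calc _ ≤ C * ((n : ℝ) ^ (-(2 - α)) / (2 - α)) := by gcongr
      _ ≤ C * ((n : ℝ) ^ (-(2 - α)) / (1 - α)) := by
        gcongr
        linarith
      _ = _ := by rw [neg_sub]; ring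
  -- By the two vanishing moments the full series with weights n - j is zero too, and the tail
  -- consists of the terms -i e(n + i).
  · have hs3 : Summable fun j : ℕ => ((n : ℝ) - j) * e j := by
      simp only [sub_mul]
      exact (hs1.of_abs.mul_left _).sub hs2'
    have h := hs3.sum_add_tsum_nat_add n
    have hz : ∑' j : ℕ, ((n : ℝ) - j) * e j = 0 := by
      simp only [sub_mul]
      rw [(hs1.of_abs.mul_left _).tsum_sub hs2', tsum_mul_left, z1, z2]
      simp
    rw [hz] at h
    have hb : ∀ i : ℕ, ‖((n : ℝ) - (i + n : ℕ)) * e (i + n)‖ ≤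
        C * ((n : ℝ) + i + 1) ^ (-(1 - α) - 1) := by
      intro i
      rw [norm_mul, norm_eq_abs, norm_eq_abs]
      have e1 : |(n : ℝ) - (i + n : ℕ)| = i := by
        push_cast
        rw [show (n : ℝ) - (i + n) = -i by ring, abs_neg, Nat.abs_cast]
      rw [e1]
      refine (hne' (i + n) i (by positivity) (by push_cast; linarith)).trans_eq ?_
      push_cast
      ring_nf
    have hsm := (summable_add_rpow (q := 1 - α) (by linarith) hn0).mul_left C
    have h2 := tsum_of_norm_bounded hsm.hasSum hb
    rw [tsum_mul_left] at h2
    have h3 := tsum_add_rpow_le (q := 1 - α) (by linarith) hn0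
    rw [eq_neg_of_add_eq_zero_left h, abs_neg, ← norm_eq_abs]
    refine h2.trans ?_
    calc _ ≤ C * ((n : ℝ) ^ (-(1 - α)) / (1 - α)) := by gcongr
      _ = _ := by rw [neg_sub]; ring

/-- The hats at 0, …, n add up to 1 on [0, n] and to the descending half hat on [n, n + 1]. -/
theorem integral_relaxKernel_add_hatLeft (h0 : 0 < α) (h1 : α < 1) (n : ℕ) :
    (∫ t in (0 : ℝ)..n, relaxKernel α μ t) + hatLeft α μ n =
      ∑ j ∈ Finset.range (n + 1), hatMoment α μ j := by
  induction n with
  | zero => simp [hatMoment]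
  | succ n ih =>
    rw [Finset.sum_range_succ, ← ih, hatMoment]
    have hn : (0 : ℝ) ≤ n := n.cast_nonneg
    have e1 : hatLeft α μ n + hatRight α μ n = ∫ t in (n : ℝ)..n + 1, relaxKernel α μ t := by
      rw [hatLeft, hatRight, ← intervalIntegral.integral_add
        (intervalIntegrable_mul_relaxKernel h0 h1 hn (by linarith) (by fun_prop))
        (intervalIntegrable_mul_relaxKernel h0 h1 hn (by linarith) (by fun_prop))]
      refine intervalIntegral.integral_congr fun t _ => ?_
      ring_nf
    rw [← intervalIntegral.integral_add_adjacent_intervals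
      (intervalIntegrable_relaxKernel h0 h1 le_rfl hn)
      (intervalIntegrable_relaxKernel h0 h1 hn (n + 1).cast_nonneg)]
    push_cast
    rw [← e1]
    ring

theorem integral_sub_mul_relaxKernel_step (h0 : 0 < α) (h1 : α < 1) {n : ℕ} {x : ℝ}
    (hx : (n : ℝ) ≤ x) :
    ∫ t in (0 : ℝ)..x, (x - t) * relaxKernel α μ t =
      (∫ t in (0 : ℝ)..n, ((n : ℝ) - t) * relaxKernel α μ t) +
      (x - n) * (∫ t in (0 : ℝ)..n, relaxKernel α μ t) +
      ∫ t in (n : ℝ)..x, (x - t) * relaxKernel α μ t := by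
  have hn : (0 : ℝ) ≤ n := n.cast_nonneg
  rw [← intervalIntegral.integral_add_adjacent_intervals (b := (n : ℝ))
    (intervalIntegrable_mul_relaxKernel h0 h1 le_rfl hn (by fun_prop))
    (intervalIntegrable_mul_relaxKernel h0 h1 hn (hn.trans hx) (by fun_prop)),
    ← intervalIntegral.integral_const_mul, ← intervalIntegral.integral_add
    (intervalIntegrable_mul_relaxKernel h0 h1 le_rfl hn (by fun_prop))
    ((intervalIntegrable_relaxKernel h0 h1 le_rfl hn).const_mul _)]
  congr 1
  refine intervalIntegral.integral_congr fun t _ => ?_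
  ring_nf

/-- The ramp (n - t)_+ ends at a node, hence is a combination of hats with its nodal values as
coefficients: the product quadrature is exact. -/
theorem integral_sub_mul_relaxKernel_nat (h0 : 0 < α) (h1 : α < 1) (n : ℕ) :
    ∫ t in (0 : ℝ)..n, ((n : ℝ) - t) * relaxKernel α μ t =
      ∑ j ∈ Finset.range n, ((n : ℝ) - j) * hatMoment α μ j := by
  induction n with
  | zero => simp
  | succ n ih =>
    have h := integral_sub_mul_relaxKernel_step (μ := μ) h0 h1 (n := n) (x := n + 1) (by linarith)
    push_cast
    rw [h, ih]
    have h2 := integral_relaxKernel_add_hatLeft (μ := μ) h0 h1 n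
    rw [hatLeft] at h2
    rw [add_sub_cancel_left, one_mul, add_assoc, h2, Finset.sum_range_succ,
      Finset.sum_range_succ, ← add_assoc, ← Finset.sum_add_distrib]
    congr 1
    · refine Finset.sum_congr rfl fun j _ => ?_
      ring
    · ring

theorem abs_hatRight_sub_le (h0 : 0 < α) (h1 : α < 1) {n : ℕ} (hn : 1 ≤ n) :
    |hatRight α μ n - 1 / 2 * relaxKernel α μ n| ≤
      1 / 2 * (relaxKernel α μ n - relaxKernel α μ (n + 1)) := by
  have hn0 : (0 : ℝ) < n := by exact_mod_cast hn
  have hi := intervalIntegrable_mul_relaxKernel (μ := μ) h0 h1 hn0.le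
    (by linarith : (0 : ℝ) ≤ n + 1) (φ := fun t => t - n) (by fun_prop)
  have hc : ∀ c : ℝ, IntervalIntegrable (fun t : ℝ => (t - n) * c) volume n (n + 1) := fun c =>
    (by fun_prop : Continuous fun t : ℝ => (t - n) * c).intervalIntegrable _ _
  have hv : ∀ c : ℝ, ∫ t in (n : ℝ)..n + 1, (t - n) * c = 1 / 2 * c := by
    intro c
    rw [intervalIntegral.integral_mul_const, intervalIntegral.integral_sub (by simp) (by simp)]
    simp only [integral_id, intervalIntegral.integral_const, smul_eq_mul]
    ring
  have hu : hatRight α μ n ≤ 1 / 2 * relaxKernel α μ n := by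
    rw [← hv]
    refine intervalIntegral.integral_mono_on (by linarith) hi (hc _) fun t ht => ?_
    exact mul_le_mul_of_nonneg_left (relaxKernel_antitone h0 h1 hn0 ht.1) (by linarith [ht.1])
  have hl : 1 / 2 * relaxKernel α μ (n + 1) ≤ hatRight α μ n := by
    rw [← hv]
    refine intervalIntegral.integral_mono_on (by linarith) (hc _) hi fun t ht => ?_
    exact mul_le_mul_of_nonneg_left (relaxKernel_antitone h0 h1 (hn0.trans_le ht.1) ht.2)
      (by linarith [ht.1])
  rw [abs_le]
  constructor <;> linarith

theorem rpow_natCast_le_mul_succ {q : ℝ} (hq : 0 ≤ q) {n : ℕ} (hn : 1 ≤ n) :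
    (n : ℝ) ^ (-q) ≤ 2 ^ q * ((n : ℝ) + 1) ^ (-q) := by
  have hn0 : (1 : ℝ) ≤ n := by exact_mod_cast hn
  have h : (n : ℝ) ^ (-q) ≤ (((n : ℝ) + 1) / 2) ^ (-q) :=
    rpow_le_rpow_of_nonpos (by positivity) (by linarith) (by linarith)
  refine h.trans_eq ?_
  rw [div_rpow (by positivity) (by norm_num), rpow_neg (by norm_num : (0 : ℝ) ≤ 2), div_inv_eq_mul,
    mul_comm]

/-- The error of the corrected quadrature for a constant source. -/
theorem exists_abs_integral_sub_sum_le (h0 : 0 < α) (h1 : α < 1) :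
    ∃ C, 0 < C ∧ ∀ μ, 0 ≤ μ → ∀ n : ℕ,
      |(∫ t in (0 : ℝ)..(n + 1 : ℕ), relaxKernel α μ t) -
        ((∑ j ∈ Finset.range (n + 1), cnKernel α μ j) + 1 / 2 * cnKernel α μ n)| ≤
        C * ((n + 1 : ℕ) : ℝ) ^ (α - 2) := by
  obtain ⟨C, hC, hS⟩ := exists_abs_sum_sub_le h0 h1
  obtain ⟨A, hA, hK⟩ := exists_abs_cnKernel_sub_relaxKernel_le h0 h1
  have hB := kernelBound_pos h0 h1
  have hD : 0 < densBound α * Gamma (2 - α) :=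
    mul_pos (densBound_pos h0 h1) (Gamma_pos_of_pos (by linarith))
  set D := densBound α * Gamma (2 - α)
  have hBα : 0 < kernelBound α / α := div_pos hB h0
  set R := kernelBound α / α + 1 + (D + A) * 2 ^ (2 - α) with hR
  have hR0 : 0 < R := by positivity
  refine ⟨C + R, by positivity, fun μ hμ n => ?_⟩
  have hn : (0 : ℝ) ≤ n := n.cast_nonneg
  have e1 : hatLeft α μ n + hatRight α μ n = ∫ t in (n : ℝ)..n + 1, relaxKernel α μ t := by
    rw [hatLeft, hatRight, ← intervalIntegral.integral_add
      (intervalIntegrable_mul_relaxKernel h0 h1 hn (by linarith) (by fun_prop))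
      (intervalIntegrable_mul_relaxKernel h0 h1 hn (by linarith) (by fun_prop))]
    refine intervalIntegral.integral_congr fun t _ => ?_
    ring_nf
  -- The ascending half hat on the last interval belongs to the source at time zero. Its moment is
  -- what the correction term has to reproduce.
  have e2 : ∫ t in (0 : ℝ)..(n + 1 : ℕ), relaxKernel α μ t =
      (∑ j ∈ Finset.range (n + 1), hatMoment α μ j) + hatRight α μ n := by
    rw [← integral_relaxKernel_add_hatLeft h0 h1, add_assoc, e1]
    push_cast
    rw [intervalIntegral.integral_add_adjacent_intervals
      (intervalIntegrable_relaxKernel h0 h1 le_rfl hn)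
      (intervalIntegrable_relaxKernel h0 h1 hn (by linarith))]
  have h3 := (hS μ hμ (n + 1) (by omega)).1
  rw [Finset.sum_sub_distrib] at h3
  -- Through k(n)/2: monotonicity of the kernel costs k(n) - k(n + 1) = O(n^(α-2)) and the kernel
  -- error is smaller. At n = 0 all quantities are merely bounded.
  have h4 : |hatRight α μ n - 1 / 2 * cnKernel α μ n| ≤ R * ((n + 1 : ℕ) : ℝ) ^ (α - 2) := by
    rcases Nat.eq_zero_or_pos n with rfl | hn1
    · have h5 := hatRight_mem (μ := μ) h0 h1 0
      have h6 : hatRight α μ 0 ≤ kernelBound α / α :=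
        h5.2.trans (integral_relaxKernel_unit_le h0 h1 (by simp))
      have h7 := abs_le.1 (abs_cnKernel_zero_le h0 h1 hμ)
      have h8 : (0 : ℝ) < (D + A) * 2 ^ (2 - α) := by positivity
      simp only [zero_add, Nat.cast_one, one_rpow, mul_one]
      rw [abs_le]
      constructor <;> linarith [h7.1, h7.2, h5.1]
    · have h5 := abs_hatRight_sub_le (μ := μ) h0 h1 hn1
      have hn0 : (0 : ℝ) < n := by exact_mod_cast hn1
      have h6 := relaxKernel_sub_le (lam := μ) h0 h1 hn0 (by linarith : (n : ℝ) ≤ n + 1)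
      rw [add_sub_cancel_left, one_mul] at h6
      have h7 := hK μ hμ n hn1
      have h8 : (n : ℝ) ^ (α - 3) ≤ (n : ℝ) ^ (α - 2) :=
        rpow_le_rpow_of_exponent_le (by exact_mod_cast hn1) (by linarith)
      have h9 := rpow_natCast_le_mul_succ (q := 2 - α) (by linarith) hn1
      rw [neg_sub] at h9
      have h10 := abs_sub_le (hatRight α μ n) (1 / 2 * relaxKernel α μ n) (1 / 2 * cnKernel α μ n)
      rw [← mul_sub, abs_mul, abs_of_pos (by norm_num : (0 : ℝ) < 1 / 2),
        abs_sub_comm (relaxKernel α μ n)] at h10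
      have h11 : 0 ≤ (n : ℝ) ^ (α - 2) := by positivity
      have h12 : A * (n : ℝ) ^ (α - 3) ≤ A * (n : ℝ) ^ (α - 2) := by gcongr
      have h13 : |hatRight α μ n - 1 / 2 * cnKernel α μ n| ≤ (D + A) * (n : ℝ) ^ (α - 2) := by
        nlinarith
      refine h13.trans ?_
      push_cast
      calc (D + A) * (n : ℝ) ^ (α - 2) ≤ (D + A) * (2 ^ (2 - α) * ((n : ℝ) + 1) ^ (α - 2)) := by
            gcongr
        _ = (D + A) * 2 ^ (2 - α) * ((n : ℝ) + 1) ^ (α - 2) := by ring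
        _ ≤ _ := by
            refine mul_le_mul_of_nonneg_right ?_ (by positivity)
            linarith
  rw [e2]
  have e3 : (∑ j ∈ Finset.range (n + 1), hatMoment α μ j) + hatRight α μ n -
      ((∑ j ∈ Finset.range (n + 1), cnKernel α μ j) + 1 / 2 * cnKernel α μ n) =
      ((∑ j ∈ Finset.range (n + 1), hatMoment α μ j) - ∑ j ∈ Finset.range (n + 1), cnKernel α μ j) +
      (hatRight α μ n - 1 / 2 * cnKernel α μ n) := by ring
  rw [e3, add_mul]
  exact (abs_add_le _ _).trans (add_le_add h3 h4)

/-- The quadrature error for ramp sources. -/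
theorem exists_abs_ramp_integral_sub_sum_le (h0 : 0 < α) (h1 : α < 1) :
    ∃ C, 0 < C ∧ ∀ μ, 0 ≤ μ → ∀ N : ℕ, ∀ x : ℝ, 0 < x → x ≤ N →
      |(∫ t in (0 : ℝ)..x, (x - t) * relaxKernel α μ t) -
        ∑ j ∈ Finset.range N, cnKernel α μ j * max (x - j) 0| ≤ C * x ^ (α - 1) := by
  obtain ⟨C, hC, hS⟩ := exists_abs_sum_sub_le h0 h1
  have hB := kernelBound_pos h0 h1
  have hBα : 0 < kernelBound α / α := div_pos hB h0
  set R := kernelBound α / α + kernelBound α * 2 ^ (1 - α) with hR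
  have hR0 : 0 < R := by positivity
  refine ⟨R + C * 2 ^ (1 - α), by positivity, fun μ hμ N x hx hxN => ?_⟩
  -- The ceiling gives m < x ≤ m + 1, so the nodes with nonzero terms are 0, …, m and m + 1 ≤ N.
  obtain ⟨m, hm⟩ : ∃ m, m + 1 = ⌈x⌉₊ := ⟨⌈x⌉₊ - 1, by have := Nat.ceil_pos.2 hx; omega⟩
  have hmx : (m : ℝ) < x := by
    rw [← Nat.lt_ceil]; omega
  have hxm : x ≤ m + 1 := by
    have := Nat.le_ceil x
    rw [← hm] at this
    exact_mod_cast this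
  have hmN : m + 1 ≤ N := by rw [hm]; exact Nat.ceil_le.2 hxN
  have hm0 : (0 : ℝ) ≤ m := m.cast_nonneg
  have hsum : ∑ j ∈ Finset.range N, cnKernel α μ j * max (x - j) 0 =
      ∑ j ∈ Finset.range (m + 1), (x - j) * cnKernel α μ j := by
    rw [← Finset.sum_subset (Finset.range_subset_range.2 hmN)]
    · refine Finset.sum_congr rfl fun j hj => ?_
      have : (j : ℝ) ≤ m := by exact_mod_cast Nat.lt_succ_iff.1 (Finset.mem_range.1 hj)
      rw [max_eq_left (by linarith), mul_comm]
    · intro j _ hj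
      have : ((m + 1 : ℕ) : ℝ) ≤ j := by exact_mod_cast not_lt.1 fun h => hj (Finset.mem_range.2 h)
      push_cast at this
      rw [max_eq_right (by linarith), mul_zero]
  set θ := x - m with hθ
  set P : ℕ → ℝ := fun n => ∑ j ∈ Finset.range n, ((n : ℝ) - j) * cnKernel α μ j with hP
  -- The discrete sum is affine in `x` between nodes, so it interpolates its nodal values, where the
  -- estimate of the first moments applies.
  have hlin : ∑ j ∈ Finset.range (m + 1), (x - j) * cnKernel α μ j =
      (1 - θ) * P m + θ * P (m + 1) := by
    have hPm : P m = ∑ j ∈ Finset.range (m + 1), ((m : ℝ) - j) * cnKernel α μ j := by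
      rw [Finset.sum_range_succ, sub_self, zero_mul, add_zero]
    rw [hPm, hP]
    simp only
    rw [Finset.mul_sum, Finset.mul_sum, ← Finset.sum_add_distrib]
    refine Finset.sum_congr rfl fun j _ => ?_
    push_cast
    rw [hθ]
    ring
  set v : ℝ → ℝ := fun y => ∫ t in (0 : ℝ)..y, (y - t) * relaxKernel α μ t with hv
  have hD : ∀ n : ℕ, 1 ≤ n → |v n - P n| ≤ C * (n : ℝ) ^ (α - 1) := by
    intro n hn
    have h := (hS μ hμ n hn).2
    simp only [hv, hP]
    rw [integral_sub_mul_relaxKernel_nat h0 h1, ← Finset.sum_sub_distrib]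
    simpa only [mul_sub] using h
  have hpow : ∀ n : ℕ, 1 ≤ n → (n : ℝ) ^ (α - 1) ≤ 2 ^ (1 - α) * ((n : ℝ) + 1) ^ (α - 1) := by
    intro n hn
    have := rpow_natCast_le_mul_succ (q := 1 - α) (by linarith) hn
    rwa [neg_sub] at this
  have hge1 : (1 : ℝ) ≤ 2 ^ (1 - α) := one_le_rpow (by norm_num) (by linarith)
  have hD1 : |v m - P m| ≤ C * 2 ^ (1 - α) * ((m : ℝ) + 1) ^ (α - 1) := by
    rcases Nat.eq_zero_or_pos m with h | h
    · have : v m - P m = 0 := by simp [hv, hP, h]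
      rw [this, abs_zero]
      positivity
    · refine (hD m h).trans ?_
      rw [mul_assoc]
      exact mul_le_mul_of_nonneg_left (hpow m h) hC.le
  have hD2 : |v (m + 1) - P (m + 1)| ≤ C * 2 ^ (1 - α) * ((m : ℝ) + 1) ^ (α - 1) := by
    have := hD (m + 1) (by omega)
    push_cast at this
    refine this.trans ?_
    refine mul_le_mul_of_nonneg_right ?_ (by positivity)
    exact le_mul_of_one_le_right hC.le hge1
  set I := ∫ t in (m : ℝ)..m + 1, relaxKernel α μ t with hI
  have hIle : I ≤ R * ((m : ℝ) + 1) ^ (α - 1) := by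
    rcases Nat.eq_zero_or_pos m with h | h
    · have h2 := integral_relaxKernel_unit_le (μ := μ) h0 h1 hm0
      rw [h] at h2 hI ⊢
      rw [hI]
      refine h2.trans ?_
      have : 0 < kernelBound α * 2 ^ (1 - α) := by positivity
      simp only [Nat.cast_zero, zero_add, one_rpow, mul_one]
      linarith
    · have hm1 : (0 : ℝ) < m := by exact_mod_cast h
      have h2 : I ≤ ∫ t in (m : ℝ)..m + 1, kernelBound α * (m : ℝ) ^ (α - 1) := by
        refine intervalIntegral.integral_mono_on (by linarith)
          (intervalIntegrable_relaxKernel h0 h1 hm0 (by linarith)) (by simp) fun t ht => ?_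
        exact (relaxKernel_antitone h0 h1 hm1 ht.1).trans (relaxKernel_le h0 h1 hm1)
      rw [intervalIntegral.integral_const, add_sub_cancel_left, one_smul] at h2
      refine h2.trans ((mul_le_mul_of_nonneg_left (hpow m h) hB.le).trans ?_)
      rw [← mul_assoc]
      refine mul_le_mul_of_nonneg_right ?_ (by positivity)
      linarith
  have hθ0 : 0 ≤ θ := by linarith
  have hθ1 : θ ≤ 1 := by linarith
  -- The exact integral deviates from its linear interpolant by the difference of two numbers in [0,
  -- I], and `I` = O(x^(α-1)): the loss from x not being a node has the admissible order.
  have hinterp : |v x - ((1 - θ) * v m + θ * v (m + 1))| ≤ I := by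
    have e1 := integral_sub_mul_relaxKernel_step (μ := μ) h0 h1 (n := m) (x := x) hmx.le
    have e2 := integral_sub_mul_relaxKernel_step (μ := μ) h0 h1 (n := m) (x := m + 1) (by linarith)
    have hL := hatLeft_mem (μ := μ) h0 h1 m
    have hq1 : 0 ≤ ∫ t in (m : ℝ)..x, (x - t) * relaxKernel α μ t :=
      intervalIntegral.integral_nonneg hmx.le fun t ht =>
        mul_nonneg (by linarith [ht.2]) (relaxKernel_nonneg h0 h1)
    have hq2 : ∫ t in (m : ℝ)..x, (x - t) * relaxKernel α μ t ≤ I := by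
      have h2 := integral_mul_relaxKernel_mono (μ := μ) h0 h1 hm0 hmx.le
        (φ := fun t => x - t) (ψ := fun _ => 1) (by fun_prop) (by fun_prop)
        (fun t ht => by linarith [ht.1])
      simp only [one_mul] at h2
      refine h2.trans ?_
      rw [hI, ← intervalIntegral.integral_add_adjacent_intervals
        (intervalIntegrable_relaxKernel h0 h1 hm0 hx.le)
        (intervalIntegrable_relaxKernel h0 h1 hx.le (by linarith : (0 : ℝ) ≤ m + 1))]
      have := intervalIntegral.integral_nonneg (μ := volume) hxm
        (fun t _ => relaxKernel_nonneg (lam := μ) (t := t) h0 h1)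
      linarith
    have e3 : v x - ((1 - θ) * v m + θ * v (m + 1)) =
        (∫ t in (m : ℝ)..x, (x - t) * relaxKernel α μ t) - θ * hatLeft α μ m := by
      simp only [hv, hatLeft]
      rw [e1, e2, add_sub_cancel_left]
      ring
    have h3 : θ * hatLeft α μ m ≤ I := (mul_le_of_le_one_left hL.1 hθ1).trans hL.2
    have h4 : 0 ≤ θ * hatLeft α μ m := mul_nonneg hθ0 hL.1
    rw [e3, abs_le]
    constructor <;> linarith
  rw [hsum, hlin]
  have e4 : v x - ((1 - θ) * P m + θ * P (m + 1)) = (v x - ((1 - θ) * v m + θ * v (m + 1))) +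
      ((1 - θ) * (v m - P m) + θ * (v (m + 1) - P (m + 1))) := by ring
  have h5 : |(1 - θ) * (v m - P m) + θ * (v (m + 1) - P (m + 1))| ≤
      C * 2 ^ (1 - α) * ((m : ℝ) + 1) ^ (α - 1) := by
    refine (abs_add_le _ _).trans ?_
    rw [abs_mul, abs_mul, abs_of_nonneg hθ0, abs_of_nonneg (by linarith : 0 ≤ 1 - θ)]
    have := mul_le_mul_of_nonneg_left hD1 (by linarith : 0 ≤ 1 - θ)
    have := mul_le_mul_of_nonneg_left hD2 hθ0
    linarith
  have h6 : ((m : ℝ) + 1) ^ (α - 1) ≤ x ^ (α - 1) :=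
    rpow_le_rpow_of_nonpos hx hxm (by linarith)
  change |v x - _| ≤ _
  rw [e4]
  calc _ ≤ I + C * 2 ^ (1 - α) * ((m : ℝ) + 1) ^ (α - 1) :=
        (abs_add_le _ _).trans (add_le_add hinterp h5)
    _ ≤ (R + C * 2 ^ (1 - α)) * ((m : ℝ) + 1) ^ (α - 1) := by
        rw [add_mul]; gcongr
    _ ≤ _ := by gcongr

end Quadrature

/-! ## Weak derivatives in time -/

theorem integrable_smul_of_tsupport_subset {X : Type*} [NormedAddCommGroup X] [NormedSpace ℝ X]
    {φ : ℝ → ℝ} {g : ℝ → X} {U : Set ℝ} (hφ : Continuous φ) (hφc : HasCompactSupport φ)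
    (hφs : tsupport φ ⊆ U) (hg : LocallyIntegrableOn g U) : Integrable fun t => φ t • g t := by
  have h1 : IntegrableOn g (tsupport φ) := hg.integrableOn_compact_subset hφs hφc
  have h2 : IntegrableOn (fun t => φ t • g t) (tsupport φ) :=
    h1.continuousOn_smul hφ.continuousOn hφc
  rwa [integrableOn_iff_integrable_of_support_subset] at h2
  intro t ht
  refine subset_tsupport _ fun h => ht ?_
  simp [h]

theorem HasWeakTimeDeriv.clm_comp {X : Type*} [NormedAddCommGroup X] [NormedSpace ℝ X]
    [CompleteSpace X] {T : ℝ} {f g : ℝ → X} (h : HasWeakTimeDeriv T f g) (L : X →L[ℝ] ℝ) :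
    HasWeakTimeDeriv T (fun t => L (f t)) (fun t => L (g t)) := by
  refine ⟨fun x hx => ?_, fun x hx => ?_, fun φ hφ hφc hφs => ?_⟩
  · obtain ⟨s, hs, hi⟩ := h.1 x hx
    exact ⟨s, hs, L.integrable_comp hi⟩
  · obtain ⟨s, hs, hi⟩ := h.2.1 x hx
    exact ⟨s, hs, L.integrable_comp hi⟩
  · have h2 := congrArg L (h.2.2 φ hφ hφc hφs)
    have i1 := integrable_smul_of_tsupport_subset (hφ.continuous_deriv (by simp)) hφc.deriv
      ((tsupport_deriv_subset (𝕜 := ℝ)).trans hφs) h.1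
    have i2 := integrable_smul_of_tsupport_subset hφ.continuous hφc hφs h.2.1
    rw [map_neg, ← L.integral_comp_comm i1.integrableOn, ← L.integral_comp_comm i2.integrableOn]
      at h2
    simpa using h2

theorem setIntegral_mul_eq_integral_of_tsupport_subset {ψ h : ℝ → ℝ} {U : Set ℝ}
    (hψ : tsupport ψ ⊆ U) : ∫ t in U, ψ t * h t = ∫ t, ψ t * h t := by
  refine setIntegral_eq_integral_of_forall_compl_eq_zero fun x hx => ?_
  rw [image_eq_zero_of_notMem_tsupport fun h => hx (hψ h), zero_mul]

/-- A test function of zero mean is the derivative of a test function. -/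
theorem exists_deriv_eq_of_integral_eq_zero {T : ℝ} {η : ℝ → ℝ} (hη : ContDiff ℝ ∞ η)
    (hηc : HasCompactSupport η) (hηs : tsupport η ⊆ Ioo 0 T) (h0 : ∫ t, η t = 0) :
    ∃ φ : ℝ → ℝ, ContDiff ℝ ∞ φ ∧ HasCompactSupport φ ∧ tsupport φ ⊆ Ioo 0 T ∧ deriv φ = η := by
  rcases (tsupport η).eq_empty_or_nonempty with he | hne
  · refine ⟨0, contDiff_const, HasCompactSupport.zero, by simp [tsupport], ?_⟩
    rw [tsupport_eq_empty_iff] at he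
    rw [he]
    simp
  obtain ⟨a, ha, hal⟩ := hηc.exists_isLeast hne
  obtain ⟨b, hb, hbl⟩ := hηc.exists_isGreatest hne
  have ha0 := (hηs ha).1
  have hbT := (hηs hb).2
  have hz : ∀ t, t < a ∨ b < t → η t = 0 := by
    rintro t (ht | ht)
    · exact image_eq_zero_of_notMem_tsupport fun h => absurd (hal h) (not_le.2 ht)
    · exact image_eq_zero_of_notMem_tsupport fun h => absurd (hbl h) (not_le.2 ht)
  set φ : ℝ → ℝ := fun x => ∫ t in (0 : ℝ)..x, η t with hφ
  have hd : ∀ x, HasDerivAt φ (η x) x := fun x =>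
    intervalIntegral.integral_hasDerivAt_right (hη.continuous.intervalIntegrable _ _)
      (hη.continuous.stronglyMeasurableAtFilter _ _) hη.continuous.continuousAt
  have hderiv : deriv φ = η := funext fun x => (hd x).deriv
  have hsupp : tsupport φ ⊆ Icc a b := by
    refine closure_minimal (fun x hx => ?_) isClosed_Icc
    by_contra hxn
    refine hx ?_
    simp only [hφ]
    rcases lt_or_ge x a with hxa | hxa
    · refine (intervalIntegral.integral_congr (g := fun _ => 0) fun t ht => ?_).trans (by simp)
      refine hz t (Or.inl ?_)
      rw [mem_uIcc] at ht
      rcases ht with ht | ht <;> linarith [ht.2]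
    · have hxb : b < x := by
        by_contra h
        exact hxn ⟨hxa, not_lt.1 h⟩
      rw [intervalIntegral.integral_eq_integral_of_support_subset, h0]
      intro t ht
      have h1 := hz t
      constructor
      · by_contra h
        exact ht (h1 (Or.inl (by linarith)))
      · by_contra h
        exact ht (h1 (Or.inr (by linarith)))
  refine ⟨φ, ?_, ?_, ?_, hderiv⟩
  · rw [contDiff_infty_iff_deriv, hderiv]
    exact ⟨fun x => (hd x).differentiableAt, hη⟩
  · exact isCompact_Icc.of_isClosed_subset (isClosed_tsupport _) hsupp
  · exact hsupp.trans fun t ht => ⟨ha0.trans_le ht.1, ht.2.trans_lt hbT⟩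

/-- The lemma of du Bois-Reymond. -/
theorem exists_ae_eq_const_of_integral_deriv_mul_eq_zero {T : ℝ} (hT : 0 < T) {h : ℝ → ℝ}
    (hh : LocallyIntegrableOn h (Ioo 0 T))
    (hz : ∀ φ : ℝ → ℝ, ContDiff ℝ ∞ φ → HasCompactSupport φ → tsupport φ ⊆ Ioo 0 T →
      ∫ t in Ioo 0 T, deriv φ t * h t = 0) :
    ∃ c, ∀ᵐ t, t ∈ Ioo 0 T → h t = c := by
  let b : ContDiffBump (T / 2) := ⟨T / 8, T / 4, by positivity, by linarith⟩
  set χ : ℝ → ℝ := b.normed volume with hχ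
  have hχd : ContDiff ℝ ∞ χ := b.contDiff_normed
  have hχc : HasCompactSupport χ := b.hasCompactSupport_normed
  have hχs : tsupport χ ⊆ Ioo 0 T := by
    rw [hχ, b.tsupport_normed_eq, Real.closedBall_eq_Icc]
    intro t ht
    have e : b.rOut = T / 4 := rfl
    rw [e] at ht
    exact ⟨by linarith [ht.1], by linarith [ht.2]⟩
  have hχ1 : ∫ t, χ t = 1 := b.integral_normed
  have hint : ∀ ψ : ℝ → ℝ, ContDiff ℝ ∞ ψ → HasCompactSupport ψ → tsupport ψ ⊆ Ioo 0 T →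
      Integrable fun t => ψ t * h t := fun ψ h1 h2 h3 =>
    integrable_smul_of_tsupport_subset h1.continuous h2 h3 hh
  refine ⟨∫ t, χ t * h t, ?_⟩
  set c := ∫ t, χ t * h t with hc
  have key := isOpen_Ioo.ae_eq_zero_of_integral_contDiff_smul_eq_zero (μ := volume)
    (U := Ioo 0 T) (f := fun t => h t - c) (hh.sub ((locallyIntegrable_const c).locallyIntegrableOn _))
    (fun ψ hψ hψc hψs => ?_)
  · filter_upwards [key] with t ht htm
    exact sub_eq_zero.1 (ht htm)
  set m := ∫ t, ψ t with hm
  have hψi : Integrable ψ := hψ.continuous.integrable_of_hasCompactSupport hψc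
  have hχi : Integrable χ := hχd.continuous.integrable_of_hasCompactSupport hχc
  have hsub : tsupport (fun t => ψ t - m * χ t) ⊆ tsupport ψ ∪ tsupport χ := by
    refine closure_minimal (fun t ht => ?_) ((isClosed_tsupport _).union (isClosed_tsupport _))
    by_contra hn
    rw [mem_union, not_or] at hn
    refine ht ?_
    simp only
    rw [image_eq_zero_of_notMem_tsupport hn.1, image_eq_zero_of_notMem_tsupport hn.2]
    simp
  -- Subtracting the multiple `m * χ` of a fixed unit mass leaves a function of zero mean, hence the
  -- derivative of a test function.
  obtain ⟨φ, hφ, hφc, hφs, hφd⟩ := exists_deriv_eq_of_integral_eq_zero (T := T)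
    (η := fun t => ψ t - m * χ t) (by fun_prop)
    ((hψc.union hχc).of_isClosed_subset (isClosed_tsupport _) hsub)
    (hsub.trans (union_subset hψs hχs))
    (by rw [integral_sub hψi (hχi.const_mul m), integral_const_mul, hχ1, mul_one, sub_self])
  have h1 := hz φ hφ hφc hφs
  rw [hφd, setIntegral_mul_eq_integral_of_tsupport_subset (hsub.trans (union_subset hψs hχs))] at h1
  have e1 : ∫ t, (ψ t - m * χ t) * h t = (∫ t, ψ t * h t) - m * c := by
    rw [hc, ← integral_const_mul, ← integral_sub (hint ψ hψ hψc hψs)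
      ((hint χ hχd hχc hχs).const_mul m)]
    refine integral_congr_ae (Eventually.of_forall fun t => ?_)
    simp only
    ring
  have e2 : ∫ t, ψ t • (h t - c) = (∫ t, ψ t * h t) - m * c := by
    rw [hm, ← integral_mul_const, ← integral_sub (hint ψ hψ hψc hψs) (hψi.mul_const c)]
    refine integral_congr_ae (Eventually.of_forall fun t => ?_)
    simp only [smul_eq_mul]
    ring
  rw [e2, ← e1, h1]

/-- A continuous function with an integrable weak derivative is the integral of the latter. -/
theorem HasWeakTimeDeriv.eq_add_integral {T : ℝ} (hT : 0 < T) {f g : ℝ → ℝ}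
    (h : HasWeakTimeDeriv T f g) (hf : ContinuousOn f (Icc 0 T)) (hg : IntegrableOn g (Ioo 0 T))
    {t : ℝ} (ht : t ∈ Icc 0 T) : f t = f 0 + ∫ s in Ioo 0 t, g s := by
  have hgi : IntervalIntegrable g volume 0 T :=
    (intervalIntegrable_iff_integrableOn_Ioo_of_le hT.le).2 hg
  set G : ℝ → ℝ := fun x => ∫ s in (0 : ℝ)..x, g s with hG
  have hGac : AbsolutelyContinuousOnInterval G 0 T :=
    hgi.absolutelyContinuousOnInterval_intervalIntegral left_mem_uIcc
  have hGc : ContinuousOn G (Icc 0 T) := by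
    have := hGac.continuousOn
    rwa [uIcc_of_le hT.le] at this
  have hGd : ∀ᵐ x ∂(volume.restrict (Ioo 0 T)), deriv G x = g x := by
    rw [ae_restrict_iff' measurableSet_Ioo]
    filter_upwards [hgi.ae_hasDerivAt_integral] with x hx hxm
    rw [uIcc_of_le hT.le] at hx
    exact (hx ⟨hxm.1.le, hxm.2.le⟩ 0 ⟨le_rfl, hT.le⟩).deriv
  have hloc : ∀ k : ℝ → ℝ, ContinuousOn k (Icc 0 T) → LocallyIntegrableOn k (Ioo 0 T) :=
    fun k hk => (hk.mono Ioo_subset_Icc_self).locallyIntegrableOn measurableSet_Ioo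
  obtain ⟨c, hc⟩ := exists_ae_eq_const_of_integral_deriv_mul_eq_zero hT
    (h := fun x => f x - G x) (hloc _ (hf.sub hGc)) (by
      intro φ hφ hφc hφs
      have h1 := h.2.2 φ hφ hφc hφs
      simp only [smul_eq_mul] at h1
      have h2 := (hφ.contDiffOn.of_le (by simp)).absolutelyContinuousOnInterval
        |>.integral_mul_deriv_eq_deriv_mul hGac
      have z0 : φ 0 = 0 := image_eq_zero_of_notMem_tsupport fun h => lt_irrefl _ (hφs h).1
      have zT : φ T = 0 := image_eq_zero_of_notMem_tsupport fun h => lt_irrefl _ (hφs h).2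
      rw [z0, zT, zero_mul, zero_mul, sub_zero, zero_sub, intervalIntegral.integral_of_le hT.le,
        intervalIntegral.integral_of_le hT.le, integral_Ioc_eq_integral_Ioo,
        integral_Ioc_eq_integral_Ioo] at h2
      have h3 : ∫ x in Ioo 0 T, φ x * deriv G x = ∫ x in Ioo 0 T, φ x * g x :=
        integral_congr_ae (hGd.mono fun x hx => by simp only [hx])
      have hi : ∀ k : ℝ → ℝ, ContinuousOn k (Icc 0 T) →
          IntegrableOn (fun x => deriv φ x * k x) (Ioo 0 T) := fun k hk =>
        (integrable_smul_of_tsupport_subset (hφ.continuous_deriv (by simp)) hφc.deriv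
          ((tsupport_deriv_subset (𝕜 := ℝ)).trans hφs) (hloc k hk)).integrableOn
      simp only [mul_sub]
      rw [integral_sub (hi f hf) (hi G hGc), h1, ← h3, h2]
      ring)
  have heq : EqOn (fun x => f x - G x) (fun _ => c) (Icc 0 T) := by
    have hE : EqOn (fun x => f x - G x) (fun _ => c) (Ioo 0 T) :=
      Measure.eqOn_Ioo_of_ae_eq _ ((ae_restrict_iff' measurableSet_Ioo).2 hc)
        ((hf.sub hGc).mono Ioo_subset_Icc_self) continuousOn_const
    have := hE.of_subset_closure (hf.sub hGc) continuousOn_const Ioo_subset_Icc_self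
      (by rw [closure_Ioo hT.ne])
    exact this
  have h0 := heq (left_mem_Icc.2 hT.le)
  have ht' := heq ht
  simp only [hG, intervalIntegral.integral_same, sub_zero] at h0 ht'
  rw [intervalIntegral.integral_of_le ht.1, integral_Ioc_eq_integral_Ioo] at ht'
  linarith

/-- Taylor's formula with a weak second derivative. -/
theorem eq_taylor_of_hasWeakTimeDeriv {T : ℝ} (hT : 0 < T) {f f' f'' : ℝ → ℝ}
    (h : HasWeakTimeDeriv T f f') (h' : HasWeakTimeDeriv T f' f'')
    (hf : ContinuousOn f (Icc 0 T)) (hf' : ContinuousOn f' (Icc 0 T))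
    (hi : IntegrableOn f'' (Ioo 0 T)) {t : ℝ} (ht : t ∈ Icc 0 T) :
    f t = f 0 + t * f' 0 + ∫ s in Ioo 0 t, (t - s) * f'' s := by
  have hf'i : IntegrableOn f' (Ioo 0 T) :=
    (hf'.integrableOn_compact isCompact_Icc).mono_set Ioo_subset_Icc_self
  have hit : IntegrableOn f'' (Ioo 0 t) := hi.mono_set (Ioo_subset_Ioo_right ht.2)
  rw [h.eq_add_integral hT hf hf'i ht, add_assoc]
  congr 1
  have e1 : ∫ s in Ioo 0 t, f' s = ∫ s in Ioo 0 t, (f' 0 + ∫ x in Ioo 0 s, f'' x) :=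
    setIntegral_congr_fun measurableSet_Ioo fun s hs =>
      h'.eq_add_integral hT hf' hi ⟨hs.1.le, hs.2.le.trans ht.2⟩
  have hint : IntegrableOn (fun s => ∫ x in Ioo 0 s, f'' x) (Ioo 0 t) := by
    have h2 : IntegrableOn (fun s => f' s - f' 0) (Ioo 0 t) :=
      (hf'i.mono_set (Ioo_subset_Ioo_right ht.2)).sub
        (integrableOn_const (by simp))
    refine h2.congr_fun (fun s hs => ?_) measurableSet_Ioo
    simp only
    rw [h'.eq_add_integral hT hf' hi ⟨hs.1.le, hs.2.le.trans ht.2⟩, add_sub_cancel_left]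
  have hc : Integrable (fun _ : ℝ => f' 0) (volume.restrict (Ioo 0 t)) := integrable_const _
  rw [e1, integral_add hc hint]
  congr 1
  · simp [ht.1]
  · have e2 : ∀ x : ℝ, ∫ s in (0 : ℝ)..(t - x), (1 : ℝ) * 1 = t - x := by simp
    -- With both kernels equal to 1 the swap is Cauchy's formula for the repeated integral.
    have := integral_triangle_swap (a := fun _ => 1) (b := fun _ => 1) (g := f'') (t := t)
      measurable_const measurable_const (fun _ _ => zero_le_one) (fun _ _ => zero_le_one)
      (Eventually.of_forall fun z => by simp) hit.aestronglyMeasurable (by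
        simp only [e2]
        have hb : IntegrableOn (fun x => (t - x) * f'' x) (Ioo 0 t) := by
          refine Integrable.bdd_mul (c := t) hit (by fun_prop) ?_
          refine (ae_restrict_iff' measurableSet_Ioo).2 (Eventually.of_forall fun x hx => ?_)
          rw [norm_eq_abs, abs_of_nonneg (by linarith [hx.2])]
          linarith [hx.1]
        simpa only [mul_comm] using hb)
    simp only [e2] at this
    simp only [one_mul] at this
    rw [this]
    simp only [mul_comm]

/-! ## The weighted integral of the second derivative -/

/-- An essential bound yields a bound at every point, including t = T. Choose r_k < t tending to `t`
at which the bound holds; on (0, r_k) the weight only decreases when r_k is replaced by `t`, and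
these intervals exhaust (0, t). -/
theorem weightedIntegral_le_essSup {X : Type*} [NormedAddCommGroup X] {α T : ℝ} (h1 : α < 1)
    {g : ℝ → X} {t : ℝ} (ht : 0 < t) (htT : t ≤ T) :
    weightedIntegral α g t ≤ essSup (weightedIntegral α g) (volume.restrict (Ioo 0 T)) := by
  set M := essSup (weightedIntegral α g) (volume.restrict (Ioo 0 T))
  have hae : ∀ᵐ r ∂(volume.restrict (Ioo 0 T)), weightedIntegral α g r ≤ M := ae_le_essSup
  rw [ae_restrict_iff' measurableSet_Ioo] at hae
  have hex : ∀ k : ℕ, ∃ r, r ∈ Ioo (max 0 (t - 1 / (k + 1))) t ∧ weightedIntegral α g r ≤ M := by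
    intro k
    have hlt : max 0 (t - 1 / ((k : ℝ) + 1)) < t :=
      max_lt ht (by have : (0 : ℝ) < 1 / ((k : ℝ) + 1) := by positivity
                    linarith)
    have hne : (ae (volume.restrict (Ioo (max 0 (t - 1 / ((k : ℝ) + 1))) t))).NeBot := by
      rw [ae_neBot, Ne, Measure.restrict_eq_zero, Real.volume_Ioo]
      simpa using hlt
    have h2 : ∀ᵐ r ∂(volume.restrict (Ioo (max 0 (t - 1 / ((k : ℝ) + 1))) t)),
        r ∈ Ioo (max 0 (t - 1 / ((k : ℝ) + 1))) t ∧ weightedIntegral α g r ≤ M := by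
      rw [ae_restrict_iff' measurableSet_Ioo]
      filter_upwards [hae] with r hr hrm
      exact ⟨hrm, hr ⟨(le_max_left _ _).trans_lt hrm.1, hrm.2.trans_le htT⟩⟩
    exact h2.exists
  choose r hr hrM using hex
  have hU : Ioo 0 t = ⋃ k, Ioo 0 (r k) := by
    ext s
    simp only [mem_iUnion, mem_Ioo]
    constructor
    · rintro ⟨hs0, hst⟩
      obtain ⟨k, hk⟩ := exists_nat_one_div_lt (sub_pos.2 hst)
      exact ⟨k, hs0, by linarith [(le_max_right _ _).trans_lt (hr k).1]⟩
    · rintro ⟨k, hs0, hsk⟩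
      exact ⟨hs0, hsk.trans (hr k).2⟩
  have hdir : Directed (· ⊆ ·) fun k => Ioo 0 (r k) := by
    intro i j
    rcases le_total (r i) (r j) with h | h
    · exact ⟨j, Ioo_subset_Ioo_right h, subset_rfl⟩
    · exact ⟨i, subset_rfl, Ioo_subset_Ioo_right h⟩
  rw [weightedIntegral, hU, setLIntegral_iUnion_of_directed _ hdir]
  refine iSup_le fun k => le_trans ?_ (hrM k)
  refine setLIntegral_mono' measurableSet_Ioo fun s hs => ?_
  gcongr ?_ * _
  refine ENNReal.ofReal_le_ofReal (rpow_le_rpow_of_nonpos (by linarith [hs.2]) ?_ (by linarith))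
  linarith [(hr k).2]

/-- Finiteness of the weighted integral, in terms of Bochner integrals. -/
theorem integrableOn_rpow_mul_norm {X : Type*} [NormedAddCommGroup X] {α t : ℝ} {g : ℝ → X}
    (hg : AEStronglyMeasurable g (volume.restrict (Ioo 0 t)))
    (hfin : weightedIntegral α g t < ⊤) :
    IntegrableOn (fun s => (t - s) ^ (α - 1) * ‖g s‖) (Ioo 0 t) ∧
      ∫ s in Ioo 0 t, (t - s) ^ (α - 1) * ‖g s‖ = (weightedIntegral α g t).toReal := by
  have hm : AEStronglyMeasurable (fun s => (t - s) ^ (α - 1) * ‖g s‖)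
      (volume.restrict (Ioo 0 t)) :=
    AEStronglyMeasurable.mul (Measurable.aestronglyMeasurable (by fun_prop)) hg.norm
  have hnn : 0 ≤ᵐ[volume.restrict (Ioo 0 t)] fun s => (t - s) ^ (α - 1) * ‖g s‖ := by
    refine (ae_restrict_iff' measurableSet_Ioo).2 (Eventually.of_forall fun s hs => ?_)
    exact mul_nonneg (rpow_nonneg (by linarith [hs.2]) _) (norm_nonneg _)
  have e : ∫⁻ s in Ioo 0 t, ENNReal.ofReal ((t - s) ^ (α - 1) * ‖g s‖) =
      weightedIntegral α g t := by
    refine setLIntegral_congr_fun measurableSet_Ioo fun s hs => ?_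
    rw [ENNReal.ofReal_mul (rpow_nonneg (by linarith [hs.2]) _), ofReal_norm]
  constructor
  · refine ⟨hm, ?_⟩
    rw [hasFiniteIntegral_iff_ofReal hnn, e]
    exact hfin
  · rw [integral_eq_lintegral_of_nonneg_ae hnn hm, e]

theorem integrableOn_of_weightedIntegral_lt_top {X : Type*} [NormedAddCommGroup X] {α t : ℝ}
    (h1 : α < 1) {g : ℝ → X} (hg : AEStronglyMeasurable g (volume.restrict (Ioo 0 t)))
    (hfin : weightedIntegral α g t < ⊤) : IntegrableOn g (Ioo 0 t) := by
  have h := (integrableOn_rpow_mul_norm hg hfin).1.const_mul (t ^ (1 - α))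
  refine Integrable.mono' h hg ?_
  refine (ae_restrict_iff' measurableSet_Ioo).2 (Eventually.of_forall fun s hs => ?_)
  have ht : 0 < t := hs.1.trans hs.2
  have h2 : t ^ (α - 1) ≤ (t - s) ^ (α - 1) :=
    rpow_le_rpow_of_nonpos (by linarith [hs.2]) (by linarith [hs.1]) (by linarith)
  have h3 : t ^ (1 - α) * t ^ (α - 1) = 1 := by
    rw [← rpow_add ht]; simp
  calc ‖g s‖ = t ^ (1 - α) * (t ^ (α - 1) * ‖g s‖) := by rw [← mul_assoc, h3, one_mul]
    _ ≤ _ := by gcongr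

/-! ## The scalar error estimate -/

section Scalar

variable {α lam τ : ℝ}

theorem integral_relaxKernel_scaling (hτ : 0 < τ) (y : ℝ) :
    ∫ s in (0 : ℝ)..τ * y, relaxKernel α lam s =
      τ ^ α * ∫ r in (0 : ℝ)..y, relaxKernel α (lam * τ ^ α) r := by
  have h := intervalIntegral.mul_integral_comp_mul_left (a := 0) (b := y)
    (f := relaxKernel α lam) (c := τ)
  rw [mul_zero] at h
  rw [← h, ← intervalIntegral.integral_const_mul, ← intervalIntegral.integral_const_mul]
  refine intervalIntegral.integral_congr fun r _ => ?_
  have e : τ ^ α = τ * τ ^ (α - 1) := by rw [rpow_sub_one hτ.ne']; field_simp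
  rw [relaxKernel_scaling hτ, e]
  ring

theorem integral_sub_mul_relaxKernel_scaling (hτ : 0 < τ) (y : ℝ) :
    ∫ s in (0 : ℝ)..τ * y, (τ * y - s) * relaxKernel α lam s =
      τ * τ ^ α * ∫ r in (0 : ℝ)..y, (y - r) * relaxKernel α (lam * τ ^ α) r := by
  have h := intervalIntegral.mul_integral_comp_mul_left (a := 0) (b := y)
    (f := fun s => (τ * y - s) * relaxKernel α lam s) (c := τ)
  rw [mul_zero] at h
  rw [← h, ← intervalIntegral.integral_const_mul, ← intervalIntegral.integral_const_mul]
  refine intervalIntegral.integral_congr fun r _ => ?_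
  have e : τ ^ α = τ * τ ^ (α - 1) := by rw [rpow_sub_one hτ.ne']; field_simp
  simp only [relaxKernel_scaling hτ]
  rw [e]
  ring

theorem continuousOn_integral_sub_mul_relaxKernel (h0 : 0 < α) (h1 : α < 1) {t : ℝ} (ht : 0 ≤ t) :
    ContinuousOn (fun x => ∫ s in (0 : ℝ)..x, (x - s) * relaxKernel α lam s) (Icc 0 t) := by
  have hc : ∀ φ : ℝ → ℝ, Continuous φ →
      ContinuousOn (fun x => ∫ s in (0 : ℝ)..x, φ s * relaxKernel α lam s) (Icc 0 t) := by
    intro φ hφ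
    have h := intervalIntegral.continuousOn_primitive_interval
      (f := fun s => φ s * relaxKernel α lam s) (μ := volume) (a := 0) (b := t) (by
        rw [uIcc_of_le ht, integrableOn_Icc_iff_integrableOn_Ioc,
          ← intervalIntegrable_iff_integrableOn_Ioc_of_le ht]
        exact intervalIntegrable_mul_relaxKernel h0 h1 le_rfl ht hφ)
    rwa [uIcc_of_le ht] at h
  refine ((continuousOn_id.mul (hc (fun _ => 1) continuous_const)).sub
    (hc (fun s => s) continuous_id)).congr fun x hx => ?_
  simp only [Pi.sub_apply, Pi.mul_apply, id_eq]
  have i1 := (intervalIntegrable_mul_relaxKernel (μ := lam) h0 h1 le_rfl hx.1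
    (continuous_const (y := (1 : ℝ)))).const_mul x
  have i2 := intervalIntegrable_mul_relaxKernel (μ := lam) h0 h1 le_rfl hx.1 continuous_id
  simp only [id_eq] at i2
  rw [← intervalIntegral.integral_const_mul, ← intervalIntegral.integral_sub i1 i2]
  refine intervalIntegral.integral_congr fun s _ => ?_
  ring

theorem integral_relaxKernel_reflect (φ : ℝ → ℝ) {t : ℝ} (ht : 0 ≤ t) :
    ∫ s in Ioo 0 t, relaxKernel α lam (t - s) * φ s =
      ∫ s in (0 : ℝ)..t, φ (t - s) * relaxKernel α lam s := by
  rw [← integral_Ioc_eq_integral_Ioo, ← intervalIntegral.integral_of_le ht]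
  have := intervalIntegral.integral_comp_sub_left (a := 0) (b := t)
    (fun s => φ (t - s) * relaxKernel α lam s) t
  rw [sub_self, sub_zero] at this
  rw [← this]
  refine intervalIntegral.integral_congr fun s _ => ?_
  simp only [sub_sub_cancel]
  ring

theorem integrableOn_relaxKernel_sub_mul (h0 : 0 < α) (h1 : α < 1) {t : ℝ} (ht : 0 ≤ t)
    {φ : ℝ → ℝ} (hφ : ContinuousOn φ (Icc 0 t)) :
    IntegrableOn (fun s => relaxKernel α lam (t - s) * φ s) (Ioo 0 t) := by
  have h := (intervalIntegrable_relaxKernel (μ := lam) h0 h1 ht le_rfl).comp_sub_left (c := t)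
  simp only [sub_self, sub_zero] at h
  have h2 := h.mul_continuousOn (g := φ) (by rwa [uIcc_of_le ht])
  rwa [intervalIntegrable_iff_integrableOn_Ioo_of_le ht] at h2

/-- The Duhamel integral of a source given by its Taylor formula. -/
theorem duhamel_taylor (h0 : 0 < α) (h1 : α < 1) {t F0 F1 : ℝ} (ht : 0 ≤ t) {F F2 : ℝ → ℝ}
    (hFc : ContinuousOn F (Icc 0 t)) (hF2 : IntegrableOn F2 (Ioo 0 t))
    (hF : ∀ s ∈ Icc 0 t, F s = F0 + s * F1 + ∫ σ in Ioo 0 s, (s - σ) * F2 σ) :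
    ∫ s in Ioo 0 t, relaxKernel α lam (t - s) * F s =
      (∫ s in (0 : ℝ)..t, relaxKernel α lam s) * F0 +
      (∫ s in (0 : ℝ)..t, (t - s) * relaxKernel α lam s) * F1 +
      ∫ σ in Ioo 0 t, F2 σ * ∫ s in (0 : ℝ)..(t - σ), (t - σ - s) * relaxKernel α lam s := by
  set R : ℝ → ℝ := fun s => ∫ σ in Ioo 0 s, (s - σ) * F2 σ with hR
  have hRc : ContinuousOn R (Icc 0 t) := by
    refine (hFc.sub (by fun_prop : ContinuousOn (fun s => F0 + s * F1) (Icc 0 t))).congr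
      fun s hs => ?_
    simp only [Pi.sub_apply]
    rw [hF s hs, add_sub_cancel_left]
  have e1 : ∫ s in Ioo 0 t, relaxKernel α lam (t - s) * F s =
      ∫ s in Ioo 0 t, ((relaxKernel α lam (t - s) * (fun _ => F0) s +
        relaxKernel α lam (t - s) * (fun s => s * F1) s) + relaxKernel α lam (t - s) * R s) := by
    refine setIntegral_congr_fun measurableSet_Ioo fun s hs => ?_
    simp only
    rw [hF s ⟨hs.1.le, hs.2.le⟩]
    ring
  have i1 := integrableOn_relaxKernel_sub_mul (lam := lam) h0 h1 ht (φ := fun _ => F0) (by fun_prop)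
  have i2 := integrableOn_relaxKernel_sub_mul (lam := lam) h0 h1 ht (φ := fun s => s * F1)
    (by fun_prop)
  have i3 := integrableOn_relaxKernel_sub_mul (lam := lam) h0 h1 ht hRc
  have hi12 : Integrable (fun s => relaxKernel α lam (t - s) * (fun _ => F0) s +
    relaxKernel α lam (t - s) * (fun s => s * F1) s) (volume.restrict (Ioo 0 t)) := i1.add i2
  rw [e1, integral_add hi12 i3, integral_add i1 i2, integral_relaxKernel_reflect _ ht,
    integral_relaxKernel_reflect _ ht]
  congr 1
  · congr 1
    · rw [intervalIntegral.integral_const_mul, mul_comm]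
    · rw [← intervalIntegral.integral_mul_const]
      refine intervalIntegral.integral_congr fun s _ => ?_
      ring
  · have hsw := integral_triangle_swap (a := relaxKernel α lam) (b := fun y => y) (g := F2) (t := t)
      (measurable_relaxKernel α lam) measurable_id (fun _ _ => relaxKernel_nonneg h0 h1)
      (fun _ h => h.le) ?_ hF2.aestronglyMeasurable ?_
    · rw [hR, hsw]
      simp only [mul_comm]
    · refine (ae_restrict_iff' measurableSet_Ioo).2 (Eventually.of_forall fun z hz => ?_)
      have := intervalIntegrable_mul_relaxKernel (μ := lam) h0 h1 le_rfl hz.1.le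
        (φ := fun s => z - s) (by fun_prop)
      simpa only [mul_comm] using this
    · have hc := continuousOn_integral_sub_mul_relaxKernel (lam := lam) h0 h1 ht
      have hc' : ContinuousOn (fun x => ∫ s in (0 : ℝ)..(t - x), (t - x - s) * relaxKernel α lam s)
          (Icc 0 t) := by
        refine hc.comp (f := fun x => t - x) (by fun_prop) fun x hx => ?_
        exact ⟨by linarith [hx.2], by linarith [hx.1]⟩
      obtain ⟨B, hB⟩ := isCompact_Icc.exists_bound_of_continuousOn hc'
      have hb : IntegrableOn (fun x => (∫ s in (0 : ℝ)..(t - x), (t - x - s) * relaxKernel α lam s) *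
          F2 x) (Ioo 0 t) := by
        refine Integrable.bdd_mul (c := B) hF2
          ((hc'.mono Ioo_subset_Icc_self).aestronglyMeasurable measurableSet_Ioo) ?_
        exact (ae_restrict_iff' measurableSet_Ioo).2 (Eventually.of_forall fun x hx =>
          hB x (Ioo_subset_Icc_self hx))
      simpa only [mul_comm] using hb

/-- The quadrature sum of a source given by its Taylor formula. -/
theorem quadrature_taylor (hτ : 0 < τ) {n : ℕ} {F0 F1 : ℝ} {F F2 : ℝ → ℝ} {K : ℕ → ℝ}
    (hF2 : IntegrableOn F2 (Ioo 0 (n * τ)))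
    (hF : ∀ s ∈ Icc 0 (n * τ), F s = F0 + s * F1 + ∫ σ in Ioo 0 s, (s - σ) * F2 σ) :
    ∑ j ∈ Finset.range n, K j * F ((n - j) * τ) =
      (∑ j ∈ Finset.range n, K j) * F0 + τ * (∑ j ∈ Finset.range n, K j * ((n : ℝ) - j)) * F1 +
      ∫ σ in Ioo 0 (n * τ), F2 σ * ∑ j ∈ Finset.range n, K j * max (n * τ - σ - j * τ) 0 := by
  have hb : ∀ j : ℕ, IntegrableOn (fun σ => max (n * τ - σ - j * τ) 0 * F2 σ) (Ioo 0 (n * τ)) := by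
    intro j
    refine Integrable.bdd_mul (c := n * τ) hF2 (by fun_prop) ?_
    refine (ae_restrict_iff' measurableSet_Ioo).2 (Eventually.of_forall fun σ hσ => ?_)
    have : (0 : ℝ) ≤ j * τ := by positivity
    rw [norm_eq_abs, abs_of_nonneg (le_max_right _ _)]
    refine max_le (by linarith [hσ.1]) (by positivity)
  have e1 : ∀ j ∈ Finset.range n, K j * F ((n - j) * τ) = K j * F0 + K j * ((n - j) * τ * F1) +
      ∫ σ in Ioo 0 (n * τ), K j * (max (n * τ - σ - j * τ) 0 * F2 σ) := by
    intro j hj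
    have hjn : (j : ℝ) ≤ n := by exact_mod_cast (Finset.mem_range.1 hj).le
    have hj0 : (0 : ℝ) ≤ j * τ := by positivity
    have hle : ((n : ℝ) - j) * τ ≤ n * τ := by linarith
    rw [hF _ ⟨mul_nonneg (by linarith) hτ.le, hle⟩, integral_const_mul]
    -- The positive part puts all remainder integrals on the common domain (0, nτ), so the sum can
    -- be taken under the integral.
    have e2 : ∫ σ in Ioo 0 ((n - j) * τ), ((n - j) * τ - σ) * F2 σ =
        ∫ σ in Ioo 0 (n * τ), max (n * τ - σ - j * τ) 0 * F2 σ := by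
      rw [setIntegral_eq_of_subset_of_forall_sdiff_eq_zero measurableSet_Ioo
        (Ioo_subset_Ioo_right hle)]
      · refine setIntegral_congr_fun measurableSet_Ioo fun σ hσ => ?_
        rw [max_eq_left (by linarith [hσ.2])]
        ring
      · intro σ hσ
        have : ((n : ℝ) - j) * τ ≤ σ := not_lt.1 fun h => hσ.2 ⟨hσ.1.1, h⟩
        rw [max_eq_right (by linarith), zero_mul]
    rw [e2]
    ring
  rw [Finset.sum_congr rfl e1, Finset.sum_add_distrib, Finset.sum_add_distrib, ← Finset.sum_mul,
    ← integral_finsetSum _ fun j _ => (hb j).const_mul _]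
  congr 1
  · congr 1
    rw [mul_comm τ, mul_assoc, Finset.sum_mul]
    refine Finset.sum_congr rfl fun j _ => ?_
    ring
  · refine integral_congr_ae (Eventually.of_forall fun σ => ?_)
    simp only
    rw [Finset.mul_sum]
    refine Finset.sum_congr rfl fun j _ => ?_
    ring

/-- The error of the corrected Crank–Nicolson quadrature for a scalar problem. -/
theorem exists_abs_duhamel_sub_quadrature_le (h0 : 0 < α) (h1 : α < 1) :
    ∃ C, 0 < C ∧ ∀ lam τ : ℝ, 0 ≤ lam → 0 < τ → ∀ (n : ℕ) (F0 F1 : ℝ) (F F2 : ℝ → ℝ), 1 ≤ n →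
      ContinuousOn F (Icc 0 (n * τ)) → IntegrableOn F2 (Ioo 0 (n * τ)) →
      (∀ s ∈ Icc 0 (n * τ), F s = F0 + s * F1 + ∫ σ in Ioo 0 s, (s - σ) * F2 σ) →
      IntegrableOn (fun σ => (n * τ - σ) ^ (α - 1) * |F2 σ|) (Ioo 0 (n * τ)) →
      |(∫ s in Ioo 0 (n * τ), relaxKernel α lam (n * τ - s) * F s) -
        τ ^ α * ((∑ j ∈ Finset.range n, cnKernel α (lam * τ ^ α) j * F ((n - j) * τ)) +
          1 / 2 * cnKernel α (lam * τ ^ α) (n - 1) * F0)| ≤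
      C * τ ^ 2 * ((n * τ) ^ (α - 2) * |F0| + (n * τ) ^ (α - 1) * |F1| +
        ∫ σ in Ioo 0 (n * τ), (n * τ - σ) ^ (α - 1) * |F2 σ|) := by
  obtain ⟨C, hC, hA⟩ := exists_abs_integral_sub_sum_le h0 h1
  obtain ⟨D, hD, hB⟩ := exists_abs_ramp_integral_sub_sum_le h0 h1
  refine ⟨C + D, by positivity, fun lam τ hl hτ n F0 F1 F F2 hn hFc hF2 hF hw => ?_⟩
  have hn0 : (0 : ℝ) < n := by exact_mod_cast hn
  have ht : 0 < n * τ := by positivity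
  have hτα : 0 < τ ^ α := rpow_pos_of_pos hτ _
  set μ := lam * τ ^ α with hμdef
  have hμ : 0 ≤ μ := by positivity
  set K := cnKernel α μ with hK
  have hpow : ∀ y : ℝ, 0 < y → τ * τ ^ α * y ^ (α - 1) = τ ^ 2 * (y * τ) ^ (α - 1) := by
    intro y hy
    rw [mul_rpow hy.le hτ.le, rpow_sub_one hτ.ne']
    field_simp
  -- Needed for all real `x`: the value x = nτ treats the linear term, and x = nτ - σ is the Peano
  -- kernel of the remainder.
  have hramp : ∀ x : ℝ, 0 < x → x ≤ n * τ →
      |(∫ s in (0 : ℝ)..x, (x - s) * relaxKernel α lam s) -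
        τ ^ α * ∑ j ∈ Finset.range n, K j * max (x - j * τ) 0| ≤ D * τ ^ 2 * x ^ (α - 1) := by
    intro x hx hxn
    obtain ⟨y, rfl⟩ : ∃ y, x = τ * y := ⟨x / τ, by field_simp⟩
    have hy : 0 < y := by
      by_contra h
      exact absurd hx (not_lt.2 (mul_nonpos_of_nonneg_of_nonpos hτ.le (not_lt.1 h)))
    have hyn : y ≤ n := by
      rw [mul_comm] at hxn
      exact le_of_mul_le_mul_right hxn hτ
    have h := hB μ hμ n y hy hyn
    have e1 : ∑ j ∈ Finset.range n, K j * max (τ * y - j * τ) 0 =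
        τ * ∑ j ∈ Finset.range n, K j * max (y - j) 0 := by
      rw [Finset.mul_sum]
      refine Finset.sum_congr rfl fun j _ => ?_
      have : max (τ * y - j * τ) 0 = τ * max (y - j) 0 := by
        rw [mul_max_of_nonneg _ _ hτ.le]
        ring_nf
      rw [this]
      ring
    rw [integral_sub_mul_relaxKernel_scaling hτ, e1]
    have e2 : τ * τ ^ α * (∫ r in (0 : ℝ)..y, (y - r) * relaxKernel α (lam * τ ^ α) r) -
        τ ^ α * (τ * ∑ j ∈ Finset.range n, K j * max (y - j) 0) =
        τ * τ ^ α * ((∫ r in (0 : ℝ)..y, (y - r) * relaxKernel α (lam * τ ^ α) r) -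
          ∑ j ∈ Finset.range n, K j * max (y - j) 0) := by ring
    rw [e2, abs_mul, abs_of_pos (by positivity : 0 < τ * τ ^ α)]
    calc _ ≤ τ * τ ^ α * (D * y ^ (α - 1)) := by gcongr
      _ = D * (τ * τ ^ α * y ^ (α - 1)) := by ring
      _ = _ := by rw [hpow y hy, mul_comm y]; ring
  have hAc : |(∫ s in (0 : ℝ)..n * τ, relaxKernel α lam s) -
      τ ^ α * ((∑ j ∈ Finset.range n, K j) + 1 / 2 * K (n - 1))| ≤
      C * τ ^ 2 * (n * τ) ^ (α - 2) := by
    obtain ⟨m, rfl⟩ : ∃ m, n = m + 1 := ⟨n - 1, by omega⟩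
    have h := hA μ hμ m
    rw [mul_comm _ τ, integral_relaxKernel_scaling hτ, ← mul_sub, abs_mul, abs_of_pos hτα]
    calc _ ≤ τ ^ α * (C * ((m + 1 : ℕ) : ℝ) ^ (α - 2)) := by gcongr; exact h
      _ = _ := by
        rw [mul_rpow hτ.le hn0.le, rpow_sub hτ, rpow_ofNat]
        field_simp
  have hBc := hramp (n * τ) ht le_rfl
  have eB : τ ^ α * ∑ j ∈ Finset.range n, K j * max (n * τ - j * τ) 0 =
      τ ^ α * (τ * ∑ j ∈ Finset.range n, K j * ((n : ℝ) - j)) := by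
    rw [Finset.mul_sum (a := τ)]
    congr 1
    refine Finset.sum_congr rfl fun j hj => ?_
    have hjn : (j : ℝ) * τ ≤ n * τ :=
      mul_le_mul_of_nonneg_right (by exact_mod_cast (Finset.mem_range.1 hj).le) hτ.le
    rw [max_eq_left (by linarith)]
    ring
  rw [eB] at hBc
  set V : ℝ → ℝ := fun σ => ∫ s in (0 : ℝ)..(n * τ - σ), (n * τ - σ - s) * relaxKernel α lam s
    with hV
  set S : ℝ → ℝ := fun σ => ∑ j ∈ Finset.range n, K j * max (n * τ - σ - j * τ) 0 with hS
  have hVc : ContinuousOn V (Icc 0 (n * τ)) := by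
    refine (continuousOn_integral_sub_mul_relaxKernel (lam := lam) h0 h1 ht.le).comp
      (f := fun x => n * τ - x) (by fun_prop) fun x hx => ?_
    exact ⟨by linarith [hx.2], by linarith [hx.1]⟩
  have hSc : Continuous S := by fun_prop
  have hint : ∀ W : ℝ → ℝ, ContinuousOn W (Icc 0 (n * τ)) →
      IntegrableOn (fun σ => F2 σ * W σ) (Ioo 0 (n * τ)) := by
    intro W hW
    obtain ⟨B, hB⟩ := isCompact_Icc.exists_bound_of_continuousOn hW
    refine Integrable.mul_bdd (c := B) hF2
      ((hW.mono Ioo_subset_Icc_self).aestronglyMeasurable measurableSet_Ioo) ?_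
    exact (ae_restrict_iff' measurableSet_Ioo).2 (Eventually.of_forall fun x hx =>
      hB x (Ioo_subset_Icc_self hx))
  rw [duhamel_taylor h0 h1 ht.le hFc hF2 hF, quadrature_taylor hτ hF2 hF]
  have hI : |(∫ σ in Ioo 0 (n * τ), F2 σ * V σ) - τ ^ α * ∫ σ in Ioo 0 (n * τ), F2 σ * S σ| ≤
      D * τ ^ 2 * ∫ σ in Ioo 0 (n * τ), (n * τ - σ) ^ (α - 1) * |F2 σ| := by
    rw [← integral_const_mul, ← integral_sub (hint V hVc)
      ((hint S hSc.continuousOn).const_mul _), ← norm_eq_abs, ← integral_const_mul]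
    refine norm_integral_le_of_norm_le (hw.const_mul _) ?_
    refine (ae_restrict_iff' measurableSet_Ioo).2 (Eventually.of_forall fun σ hσ => ?_)
    have h := hramp (n * τ - σ) (by linarith [hσ.2]) (by linarith [hσ.1])
    have e : F2 σ * V σ - τ ^ α * (F2 σ * S σ) = F2 σ * (V σ - τ ^ α * S σ) := by ring
    rw [e, norm_mul, norm_eq_abs, norm_eq_abs]
    calc _ ≤ |F2 σ| * (D * τ ^ 2 * (n * τ - σ) ^ (α - 1)) := by gcongr
      _ = _ := by ring
  set P := ∫ σ in Ioo 0 (n * τ), F2 σ * V σ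
  set Q := ∫ σ in Ioo 0 (n * τ), F2 σ * S σ
  set J := ∫ σ in Ioo 0 (n * τ), (n * τ - σ) ^ (α - 1) * |F2 σ| with hJ
  have hJ0 : 0 ≤ J := setIntegral_nonneg measurableSet_Ioo fun σ hσ =>
    mul_nonneg (rpow_nonneg (by linarith [hσ.2]) _) (abs_nonneg _)
  set A := (∫ s in (0 : ℝ)..n * τ, relaxKernel α lam s) -
      τ ^ α * ((∑ j ∈ Finset.range n, K j) + 1 / 2 * K (n - 1)) with hAdef
  set B := (∫ s in (0 : ℝ)..n * τ, (n * τ - s) * relaxKernel α lam s) -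
      τ ^ α * (τ * ∑ j ∈ Finset.range n, K j * ((n : ℝ) - j)) with hBdef
  have hsplit : (∫ s in (0 : ℝ)..n * τ, relaxKernel α lam s) * F0 +
      (∫ s in (0 : ℝ)..n * τ, (n * τ - s) * relaxKernel α lam s) * F1 + P -
      τ ^ α * ((∑ j ∈ Finset.range n, K j) * F0 +
        τ * (∑ j ∈ Finset.range n, K j * ((n : ℝ) - j)) * F1 + Q + 1 / 2 * K (n - 1) * F0) =
      A * F0 + B * F1 + (P - τ ^ α * Q) := by
    rw [hAdef, hBdef]; ring
  rw [hsplit]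
  have hp1 : 0 ≤ (n * τ) ^ (α - 2) := by positivity
  have hp2 : 0 ≤ (n * τ) ^ (α - 1) := by positivity
  calc |A * F0 + B * F1 + (P - τ ^ α * Q)| ≤ |A| * |F0| + |B| * |F1| + |P - τ ^ α * Q| := by
        rw [← abs_mul, ← abs_mul]
        exact (abs_add_le _ _).trans (add_le_add_left (abs_add_le _ _) _)
    _ ≤ C * τ ^ 2 * (n * τ) ^ (α - 2) * |F0| + D * τ ^ 2 * (n * τ) ^ (α - 1) * |F1| +
        D * τ ^ 2 * J := by gcongr
    _ ≤ (C + D) * τ ^ 2 * (n * τ) ^ (α - 2) * |F0| + (C + D) * τ ^ 2 * (n * τ) ^ (α - 1) * |F1| +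
        (C + D) * τ ^ 2 * J := by gcongr <;> linarith
    _ = _ := by ring

end Scalar

/-! ## Components of the discrete solution -/

theorem sum_coeff_cnPoly_mul (α : ℝ) (X : ℕ → ℝ) (n : ℕ) :
    ∑ j ∈ Finset.range (n + 1 + 1), PowerSeries.coeff (n + 1 - j) (cnPoly α) * X j =
      (1 - α / 2) * X (n + 1) + α / 2 * X n := by
  rw [Finset.sum_range_succ, Finset.sum_range_succ, Finset.sum_eq_zero]
  · simp only [coeff_cnPoly]
    simp
    ring
  · intro j hj
    have hj' := Finset.mem_range.1 hj
    rw [coeff_cnPoly, if_neg (by omega), if_neg (by omega), zero_mul]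

/-- The source of the corrected scheme: the initial value is moved to the first step. -/
noncomputable def correctedSource (F : ℕ → ℝ) : ℕ → ℝ
  | 0 => 0
  | 1 => F 1 + 1 / 2 * F 0
  | n + 2 => F (n + 2)

/-- The half of F 0 placed at the first step is seen through the weight K_n; the source at index 0
is zero. -/
theorem sum_cnKernel_mul_correctedSource (K F : ℕ → ℝ) (n : ℕ) :
    ∑ j ∈ Finset.range (n + 1 + 1), K (n + 1 - j) * correctedSource F j =
      (∑ j ∈ Finset.range (n + 1), K j * F (n + 1 - j)) + 1 / 2 * K n * F 0 := by
  rw [← Finset.sum_range_reflect (fun j => K (n + 1 - j) * correctedSource F j),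
    Finset.sum_range_succ]
  have e : ∀ j ∈ Finset.range (n + 1),
      K (n + 1 - (n + 1 + 1 - 1 - j)) * correctedSource F (n + 1 + 1 - 1 - j) =
      K j * F (n + 1 - j) + if j = n then 1 / 2 * K n * F 0 else 0 := by
    intro j hj
    have hj' := Finset.mem_range.1 hj
    have e1 : n + 1 - (n + 1 + 1 - 1 - j) = j := by omega
    have e2 : n + 1 + 1 - 1 - j = n - j + 1 := by omega
    have e3 : n + 1 - j = n - j + 1 := by omega
    rw [e1, e2, e3]
    split_ifs with h
    · subst h
      rw [Nat.sub_self]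
      simp only [correctedSource]
      ring
    · obtain ⟨m, hm⟩ : ∃ m, n - j = m + 1 := ⟨n - j - 1, by omega⟩
      rw [hm]
      simp only [correctedSource]
      ring
  rw [Finset.sum_congr rfl e, Finset.sum_add_distrib]
  have e0 : n + 1 + 1 - 1 - (n + 1) = 0 := by omega
  rw [e0]
  simp [correctedSource]

/-- Multiplied by τ^α, the scheme is the power series identity `cnSeries` · U = τ^α `cnPoly` · F̃ up
to order `N`, with F̃ the corrected source; dividing by `cnSeries` gives the discrete Duhamel
formula. -/
theorem eq_sum_cnKernel_of_scheme {α lam τ : ℝ} (h1 : α < 1) (hl : 0 ≤ lam) (hτ : 0 < τ) {N : ℕ}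
    {U F : ℕ → ℝ} (hU0 : U 0 = 0)
    (hU : ∀ n, n + 1 ≤ N →
      τ ^ (-α) * (∑ j ∈ Finset.range (n + 1 + 1), cqWeight α (n + 1 - j) * U j) +
        lam * ((1 - α / 2) * U (n + 1) + α / 2 * U n) =
      (1 - α / 2) * correctedSource F (n + 1) + α / 2 * correctedSource F n)
    {n : ℕ} (hn : n + 1 ≤ N) :
    U (n + 1) = τ ^ α * ((∑ j ∈ Finset.range (n + 1),
      cnKernel α (lam * τ ^ α) j * F (n + 1 - j)) + 1 / 2 * cnKernel α (lam * τ ^ α) n * F 0) := by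
  have hτα : 0 < τ ^ α := rpow_pos_of_pos hτ _
  set μ := lam * τ ^ α with hμdef
  have hμ : 0 ≤ μ := by positivity
  set V : PowerSeries ℝ := PowerSeries.C (τ ^ α) *
    (PowerSeries.mk (cnKernel α μ) * PowerSeries.mk (correctedSource F)) with hV
  have hVn : ∀ n, PowerSeries.coeff n V = τ ^ α * ∑ j ∈ Finset.range (n + 1),
      cnKernel α μ (n - j) * correctedSource F j := by
    intro n
    rw [hV, PowerSeries.coeff_C_mul, coeff_mul_mk_eq_sum_range]
    simp only [PowerSeries.coeff_mk]
  have hprod : cnSeries α μ * V =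
      PowerSeries.C (τ ^ α) * (cnPoly α * PowerSeries.mk (correctedSource F)) := by
    rw [hV, ← cnSeries_mul_cnKernel h1 hμ]
    ring
  have hVmk : V = PowerSeries.mk fun n => PowerSeries.coeff n V := by
    ext n
    rw [PowerSeries.coeff_mk]
  have hconv : ∀ n, ∑ j ∈ Finset.range (n + 1),
      PowerSeries.coeff (n - j) (cnSeries α μ) * PowerSeries.coeff j V =
      τ ^ α * ∑ j ∈ Finset.range (n + 1), PowerSeries.coeff (n - j) (cnPoly α) *
        correctedSource F j := by
    intro n
    rw [← coeff_mul_mk_eq_sum_range, ← hVmk, hprod, PowerSeries.coeff_C_mul,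
      coeff_mul_mk_eq_sum_range]
  have hmain := eq_of_convolution_eq (constantCoeff_cnSeries_pos (α := α) h1 hμ).ne'
    (U := U) (V := fun n => PowerSeries.coeff n V) (N := N) (by
      intro n hn
      rw [hconv]
      rcases n with _ | n
      · simp [hU0, correctedSource]
      · rw [sum_coeff_cnPoly_mul, ← hU n hn, mul_add, ← mul_assoc, ← rpow_add hτ, add_neg_cancel,
          rpow_zero, one_mul]
        simp only [coeff_cnSeries, add_mul, mul_assoc, Finset.sum_add_distrib]
        rw [← Finset.mul_sum, sum_coeff_cnPoly_mul, hμdef]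
        ring) (n + 1) hn
  rw [hmain, hVn, sum_cnKernel_mul_correctedSource]

/-! ## Components of the semidiscrete solution -/

/-- The convolution of two integrable functions exists almost everywhere. Needed to take a
functional inside the Caputo derivative. -/
theorem ae_integrableOn_rpow_smul {X : Type*} [NormedAddCommGroup X] [NormedSpace ℝ X]
    {α T : ℝ} (h1 : α < 1) {h : ℝ → X} (hh : IntegrableOn h (Ioo 0 T)) :
    ∀ᵐ t ∂(volume.restrict (Ioo 0 T)), IntegrableOn (fun s => (t - s) ^ (-α) • h s) (Ioo 0 t) := by
  rcases le_or_gt T 0 with hT | hT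
  · simp [Ioo_eq_empty (not_lt.2 hT)]
  have hk : IntegrableOn (fun x : ℝ => x ^ (-α)) (Ioo 0 T) :=
    (intervalIntegrable_iff_integrableOn_Ioo_of_le hT.le).1
      (intervalIntegral.intervalIntegrable_rpow' (by linarith))
  have hk' := (integrable_indicator_iff measurableSet_Ioo).2 hk
  have hh' := (integrable_indicator_iff measurableSet_Ioo).2 hh
  have hc := hh'.ae_convolution_exists (ContinuousLinearMap.lsmul ℝ ℝ (E := X)).flip hk'
  rw [ae_restrict_iff' measurableSet_Ioo]
  filter_upwards [hc] with t ht htm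
  have h2 : IntegrableOn _ (Ioo 0 t) := Integrable.integrableOn ht
  refine h2.congr_fun (fun s hs => ?_) measurableSet_Ioo
  have hs1 : s ∈ Ioo 0 T := ⟨hs.1, hs.2.trans htm.2⟩
  have hs2 : t - s ∈ Ioo 0 T := ⟨by linarith [hs.2], by linarith [hs.1, htm.2]⟩
  simp [indicator_of_mem hs1, indicator_of_mem hs2]

/-- The components of the solution of a fractional evolution equation, by Duhamel's formula. -/
theorem component_eq_integral_relaxKernel {X : Type*} [NormedAddCommGroup X] [NormedSpace ℝ X]
    [CompleteSpace X] {α lam T : ℝ} (h0 : 0 < α) (h1 : α < 1) (hl : 0 ≤ lam) {A : X →L[ℝ] X}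
    {L : X →L[ℝ] ℝ} (hL : ∀ x, L (A x) = -(lam * L x)) {u F : ℝ → X} (hu0 : u 0 = 0)
    (hud : IntegrableOn (deriv u) (Ioo 0 T))
    (hu : ∀ t ∈ Icc 0 T, u t = u 0 + ∫ s in Ioo 0 t, deriv u s)
    (heq : ∀ᵐ t ∂(volume.restrict (Ioo 0 T)), caputoDeriv α u t - A (u t) = F t)
    {t : ℝ} (ht : t ∈ Icc 0 T) :
    L (u t) = ∫ s in Ioo 0 t, relaxKernel α lam (t - s) * L (F s) := by
  have hLu : ∀ t ∈ Icc 0 T, L (u t) = ∫ s in Ioo 0 t, L (deriv u s) := by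
    intro t ht
    rw [hu t ht, hu0, zero_add, L.integral_comp_comm (hud.mono_set (Ioo_subset_Ioo_right ht.2))]
  rw [hLu t ht]
  refine integral_eq_integral_relaxKernel_mul h0 h1 hl (g := fun s => L (deriv u s))
    (F := fun s => L (F s)) (L.integrable_comp hud) ?_ ht.2
  filter_upwards [heq, ae_integrableOn_rpow_smul h1 hud, ae_restrict_mem measurableSet_Ioo]
    with r hr hi hrm
  have hrI : r ∈ Icc 0 T := Ioo_subset_Icc_self hrm
  have i1 : IntegrableOn (fun s => (r - s) ^ (-α) * L (deriv u s)) (Ioo 0 r) := by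
    have := L.integrable_comp hi
    simp only [map_smul, smul_eq_mul] at this
    exact this
  have i2 : IntegrableOn (fun s => L (deriv u s)) (Ioo 0 r) :=
    L.integrable_comp (hud.mono_set (Ioo_subset_Ioo_right hrI.2))
  rw [← hr, map_sub, hL, caputoDeriv, map_smul, ← L.integral_comp_comm hi, hLu r hrI]
  simp only [caputoKernel, add_mul, map_smul, smul_eq_mul, mul_assoc]
  rw [integral_add (i1.const_mul _) (i2.const_mul _), integral_const_mul, integral_const_mul]
  ring

/-! ## Spectral decomposition of the discrete Laplacian -/

theorem sum_abs_inner_mul_abs_inner_le {ι E : Type*} [Fintype ι] [NormedAddCommGroup E]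
    [InnerProductSpace ℝ E] (b : OrthonormalBasis ι ℝ E) (x y : E) :
    ∑ i, |⟪b i, x⟫_ℝ| * |⟪b i, y⟫_ℝ| ≤ ‖x‖ * ‖y‖ := by
  have h := Real.sum_mul_le_sqrt_mul_sqrt Finset.univ (fun i => |⟪b i, x⟫_ℝ|)
    (fun i => |⟪b i, y⟫_ℝ|)
  have hx := b.sum_sq_norm_inner_right x
  have hy := b.sum_sq_norm_inner_right y
  simp only [norm_eq_abs] at hx hy
  rwa [hx, hy, sqrt_sq (norm_nonneg _), sqrt_sq (norm_nonneg _)] at h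

/-- Componentwise bounds with respect to an orthonormal basis add up. -/
theorem norm_le_of_forall_abs_inner_le {ι E : Type*} [Fintype ι] [NormedAddCommGroup E]
    [InnerProductSpace ℝ E] (b : OrthonormalBasis ι ℝ E) {z x y : E} {a p q : ℝ} {w : ℝ → ℝ}
    {g : ℝ → E} {G : ℝ → ℝ} {s : Set ℝ} (hs : MeasurableSet s) (ha : 0 ≤ a) (hp : 0 ≤ p)
    (hq : 0 ≤ q) (hw : ∀ σ ∈ s, 0 ≤ w σ) (hgG : ∀ σ ∈ s, ‖g σ‖ ≤ G σ)
    (hwg : ∀ i, IntegrableOn (fun σ => w σ * |⟪b i, g σ⟫_ℝ|) s)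
    (hwG : IntegrableOn (fun σ => w σ * G σ) s)
    (h : ∀ i, |⟪b i, z⟫_ℝ| ≤ a * (p * |⟪b i, x⟫_ℝ| + q * |⟪b i, y⟫_ℝ| +
      ∫ σ in s, w σ * |⟪b i, g σ⟫_ℝ|)) :
    ‖z‖ ≤ a * (p * ‖x‖ + q * ‖y‖ + ∫ σ in s, w σ * G σ) := by
  have hJ : 0 ≤ ∫ σ in s, w σ * G σ := setIntegral_nonneg hs fun σ hσ =>
    mul_nonneg (hw σ hσ) ((norm_nonneg _).trans (hgG σ hσ))
  rcases eq_or_ne z 0 with rfl | hz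
  · rw [norm_zero]; positivity
  have hzp : 0 < ‖z‖ := norm_pos_iff.2 hz
  have hzz := b.sum_sq_norm_inner_right z
  simp only [norm_eq_abs] at hzz
  -- Pairing the componentwise bounds with the components of `z` itself allows Cauchy–Schwarz for
  -- each fixed σ under the integral, so no dimension dependent constant appears.
  refine le_of_mul_le_mul_left ?_ hzp
  have hint : ∑ i, |⟪b i, z⟫_ℝ| * ∫ σ in s, w σ * |⟪b i, g σ⟫_ℝ| ≤
      ‖z‖ * ∫ σ in s, w σ * G σ := by
    simp only [← integral_const_mul]
    rw [← integral_finsetSum _ fun i _ => (hwg i).const_mul _]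
    refine setIntegral_mono_on (integrable_finsetSum _ fun i _ => (hwg i).const_mul _)
      (hwG.const_mul _) hs fun σ hσ => ?_
    calc ∑ i, |⟪b i, z⟫_ℝ| * (w σ * |⟪b i, g σ⟫_ℝ|) =
        w σ * ∑ i, |⟪b i, z⟫_ℝ| * |⟪b i, g σ⟫_ℝ| := by
          rw [Finset.mul_sum]
          exact Finset.sum_congr rfl fun i _ => by ring
      _ ≤ w σ * (‖z‖ * G σ) := by
          refine mul_le_mul_of_nonneg_left ?_ (hw σ hσ)
          exact (sum_abs_inner_mul_abs_inner_le b _ _).trans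
            (mul_le_mul_of_nonneg_left (hgG σ hσ) hzp.le)
      _ = _ := by ring
  calc ‖z‖ * ‖z‖ = ∑ i, |⟪b i, z⟫_ℝ| * |⟪b i, z⟫_ℝ| := by
        rw [← sq, ← hzz]
        simp only [sq]
    _ ≤ ∑ i, |⟪b i, z⟫_ℝ| * (a * (p * |⟪b i, x⟫_ℝ| + q * |⟪b i, y⟫_ℝ| +
      ∫ σ in s, w σ * |⟪b i, g σ⟫_ℝ|)) :=
        Finset.sum_le_sum fun i _ => mul_le_mul_of_nonneg_left (h i) (abs_nonneg _)
    _ = a * (p * ∑ i, |⟪b i, z⟫_ℝ| * |⟪b i, x⟫_ℝ| + q * ∑ i, |⟪b i, z⟫_ℝ| * |⟪b i, y⟫_ℝ| +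
      ∑ i, |⟪b i, z⟫_ℝ| * ∫ σ in s, w σ * |⟪b i, g σ⟫_ℝ|) := by
        simp only [Finset.mul_sum, ← Finset.sum_add_distrib]
        exact Finset.sum_congr rfl fun i _ => by ring
    _ ≤ a * (p * (‖z‖ * ‖x‖) + q * (‖z‖ * ‖y‖) + ‖z‖ * ∫ σ in s, w σ * G σ) := by
        gcongr
        · exact sum_abs_inner_mul_abs_inner_le b _ _
        · exact sum_abs_inner_mul_abs_inner_le b _ _
    _ = _ := by ring

/-- An orthonormal basis of eigenvectors of a symmetric negative semidefinite operator. -/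
theorem exists_eigenbasis {E : Type*} [NormedAddCommGroup E] [InnerProductSpace ℝ E]
    [FiniteDimensional ℝ E] {A : E →L[ℝ] E} (hsymm : ∀ x y, ⟪A x, y⟫_ℝ = ⟪x, A y⟫_ℝ)
    (hneg : ∀ x, ⟪A x, x⟫_ℝ ≤ 0) :
    ∃ (m : ℕ) (b : OrthonormalBasis (Fin m) ℝ E) (lam : Fin m → ℝ),
      (∀ i, 0 ≤ lam i) ∧ ∀ i x, ⟪b i, A x⟫_ℝ = -(lam i * ⟪b i, x⟫_ℝ) := by
  have hsym : (A : E →ₗ[ℝ] E).IsSymmetric := hsymm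
  set b := hsym.eigenvectorBasis rfl with hb
  set ν := hsym.eigenvalues rfl with hν
  have hA : ∀ i, A (b i) = ν i • b i := fun i => hsym.apply_eigenvectorBasis rfl i
  refine ⟨_, b, fun i => -ν i, fun i => ?_, fun i x => ?_⟩
  · have h := hneg (b i)
    rw [hA, real_inner_smul_left, real_inner_self_eq_norm_sq, b.norm_eq_one] at h
    linarith
  · rw [← hsymm, hA, real_inner_smul_left]
    ring

set_option maxHeartbeats 1000000 in
/-- The error estimate for an abstract fractional evolution equation in a finite dimensional
space, with a symmetric negative semidefinite operator `A` and a source `P f`. -/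
theorem exists_norm_sub_le {α : ℝ} (h0 : 0 < α) (h1 : α < 1) :
    ∃ C : ℝ, 0 < C ∧ ∀ (E H : Type) [NormedAddCommGroup E] [InnerProductSpace ℝ E]
      [FiniteDimensional ℝ E] [CompleteSpace E] [NormedAddCommGroup H] [NormedSpace ℝ H]
      [CompleteSpace H] (A : E →L[ℝ] E) (_ : ∀ x y, ⟪A x, y⟫_ℝ = ⟪x, A y⟫_ℝ)
      (_ : ∀ x, ⟪A x, x⟫_ℝ ≤ 0) (P : H →L[ℝ] E) (_ : ∀ x, ‖P x‖ ≤ ‖x‖)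
      (T : ℝ) (_ : 0 < T) (f f' f'' : ℝ → H) (_ : ContinuousOn f (Icc 0 T))
      (_ : ContinuousOn f' (Icc 0 T)) (_ : HasWeakTimeDeriv T f f')
      (_ : HasWeakTimeDeriv T f' f'') (_ : IntegrableOn f'' (Ioo 0 T))
      (u : ℝ → E) (_ : u 0 = 0) (_ : IntegrableOn (deriv u) (Ioo 0 T))
      (_ : ∀ t ∈ Icc 0 T, u t = u 0 + ∫ s in Ioo 0 t, deriv u s)
      (_ : ∀ᵐ t ∂(volume.restrict (Ioo 0 T)), caputoDeriv α u t - A (u t) = P (f t))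
      (N : ℕ) (τ : ℝ) (_ : 0 < τ) (_ : N * τ ≤ T) (U : ℕ → E) (_ : U 0 = 0)
      (_ : 1 ≤ N → cqDeriv α τ U 1 - (1 - α / 2) • A (U 1) =
        (1 - α / 2) • (P (f (1 * τ)) + (1 / 2 : ℝ) • P (f 0)))
      (_ : 2 ≤ N → cqDeriv α τ U 2 - (1 - α / 2) • A (U 2) - (α / 2) • A (U 1) =
        (1 - α / 2) • P (f (2 * τ)) + (α / 2) • P (f (1 * τ)) + (α / 4) • P (f 0))
      (_ : ∀ n, n + 3 ≤ N → cqDeriv α τ U (n + 3) - (1 - α / 2) • A (U (n + 3)) -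
        (α / 2) • A (U (n + 2)) =
        (1 - α / 2) • P (f ((n + 3 : ℕ) * τ)) + (α / 2) • P (f ((n + 2 : ℕ) * τ)))
      (n : ℕ) (_ : 1 ≤ n) (_ : n ≤ N) (_ : weightedIntegral α f'' (n * τ) < ⊤),
      ‖u (n * τ) - U n‖ ≤ C * τ ^ 2 *
          ((n * τ) ^ (α - 2) * ‖f 0‖ + (n * τ) ^ (α - 1) * ‖f' 0‖
            + (weightedIntegral α f'' (n * τ)).toReal) := by
  obtain ⟨C, hC, hmain⟩ := exists_abs_duhamel_sub_quadrature_le h0 h1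
  refine ⟨C, hC, ?_⟩
  intro E H _ _ _ _ _ _ _ A hsymm hneg P hP T hT f f' f'' hf hf' hw hw' hi u hu0 hud hu hueq N τ hτ
    hN U hU0 hU1 hU2 hU3 n hn hnN hfin
  obtain ⟨m, b, lam, hlam, hb⟩ := exists_eigenbasis hsymm hneg
  have hn0 : (0 : ℝ) < n := by exact_mod_cast hn
  have ht : 0 < n * τ := by positivity
  have htT : n * τ ≤ T :=
    (mul_le_mul_of_nonneg_right (by exact_mod_cast hnN) hτ.le).trans hN
  have hm : AEStronglyMeasurable f'' (volume.restrict (Ioo 0 (n * τ))) :=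
    (hi.mono_set (Ioo_subset_Ioo_right htT)).aestronglyMeasurable
  obtain ⟨hwi, hwe⟩ := integrableOn_rpow_mul_norm hm hfin
  rw [← hwe]
  have hit : IntegrableOn f'' (Ioo 0 (n * τ)) := hi.mono_set (Ioo_subset_Ioo_right htT)
  have hIcc : Icc 0 (n * τ) ⊆ Icc 0 T := Icc_subset_Icc_right htT
  have hP0 : ‖P (f 0)‖ ≤ ‖f 0‖ := hP _
  have hP1 : ‖P (f' 0)‖ ≤ ‖f' 0‖ := hP _
  have hwpos : ∀ σ ∈ Ioo 0 (n * τ), 0 ≤ (n * τ - σ) ^ (α - 1) := fun σ hσ =>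
    rpow_nonneg (by linarith [hσ.2]) _
  have hcomp : ∀ i, IntegrableOn (fun σ => (n * τ - σ) ^ (α - 1) * |⟪b i, P (f'' σ)⟫_ℝ|)
      (Ioo 0 (n * τ)) := by
    intro i
    refine Integrable.mono' hwi ?_ ?_
    · have h2 : IntegrableOn (fun σ => ⟪b i, P (f'' σ)⟫_ℝ) (Ioo 0 (n * τ)) :=
        ((innerSL ℝ (b i)).comp P).integrable_comp hit
      exact AEStronglyMeasurable.mul (Measurable.aestronglyMeasurable (by fun_prop))
        h2.aestronglyMeasurable.norm
    · refine (ae_restrict_iff' measurableSet_Ioo).2 (Eventually.of_forall fun σ hσ => ?_)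
      rw [norm_mul, norm_of_nonneg (hwpos σ hσ), norm_eq_abs, abs_abs]
      refine mul_le_mul_of_nonneg_left ?_ (hwpos σ hσ)
      refine (abs_real_inner_le_norm _ _).trans ?_
      rw [b.norm_eq_one, one_mul]
      exact hP _
  have hkey := norm_le_of_forall_abs_inner_le b (z := u (n * τ) - U n) (x := P (f 0))
    (y := P (f' 0)) (a := C * τ ^ 2) (p := (n * τ) ^ (α - 2)) (q := (n * τ) ^ (α - 1))
    (w := fun σ => (n * τ - σ) ^ (α - 1)) (g := fun σ => P (f'' σ)) (G := fun σ => ‖f'' σ‖)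
    measurableSet_Ioo (by positivity) (by positivity) (by positivity) hwpos (fun σ _ => hP _)
    hcomp hwi ?_
  · refine hkey.trans ?_
    gcongr
  intro i
  set L : H →L[ℝ] ℝ := (innerSL ℝ (b i)).comp P with hL
  have hLapp : ∀ x, L x = ⟪b i, P x⟫_ℝ := fun x => rfl
  set Λ : E →L[ℝ] ℝ := innerSL ℝ (b i) with hΛ
  have hΛP : ∀ x, Λ (P x) = L x := fun x => rfl
  have hΛA : ∀ x, Λ (A x) = -(lam i * Λ x) := hb i
  have hcont := component_eq_integral_relaxKernel h0 h1 (hlam i) hΛA hu0 hud hu hueq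
    (t := n * τ) ⟨ht.le, htT⟩
  obtain ⟨k, rfl⟩ : ∃ k, n = k + 1 := ⟨n - 1, by omega⟩
  have hcq : ∀ j, Λ (cqDeriv α τ U j) =
      τ ^ (-α) * ∑ l ∈ Finset.range (j + 1), cqWeight α (j - l) * Λ (U l) := by
    intro j
    simp only [cqDeriv, map_smul, map_sum, smul_eq_mul]
  have hdisc := eq_sum_cnKernel_of_scheme (α := α) (lam := lam i) (N := N) (U := fun j => Λ (U j))
    (F := fun j : ℕ => L (f (j * τ))) h1 (hlam i) hτ (by simp [hU0]) (by
      intro j hj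
      rw [← hcq]
      -- The averages of `correctedSource` are the corrected right sides: the extra half of F 0 at
      -- step one enters step two with weight α/2 · 1/2 = α/4.
      rcases j with _ | _ | j
      · have h := congrArg Λ (hU1 hj)
        simp only [map_sub, map_add, map_smul, smul_eq_mul, hΛA, hΛP] at h
        simp only [correctedSource, hU0, map_zero, zero_add, Nat.cast_one, Nat.cast_zero, zero_mul]
        linarith
      · have h := congrArg Λ (hU2 hj)
        simp only [map_sub, map_add, map_smul, smul_eq_mul, hΛA, hΛP] at h
        simp only [correctedSource, zero_add, Nat.cast_one, Nat.cast_zero, zero_mul,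
          Nat.reduceAdd, Nat.cast_ofNat]
        linarith
      · have h := congrArg Λ (hU3 j hj)
        simp only [map_sub, map_add, map_smul, smul_eq_mul, hΛA, hΛP] at h
        simp only [correctedSource, add_assoc, Nat.reduceAdd]
        linarith) (n := k) hnN
  have hest := hmain (lam i) τ (hlam i) hτ (k + 1) (L (f 0)) (L (f' 0)) (fun s => L (f s))
    (fun s => L (f'' s)) hn (L.continuous.comp_continuousOn (hf.mono hIcc))
    (L.integrable_comp hit) (fun s hs =>
      eq_taylor_of_hasWeakTimeDeriv hT (hw.clm_comp L) (hw'.clm_comp L)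
        (L.continuous.comp_continuousOn hf) (L.continuous.comp_continuousOn hf')
        (L.integrable_comp hi) (hIcc hs)) (hcomp i)
  have e1 : ⟪b i, u ((k + 1 : ℕ) * τ) - U (k + 1)⟫_ℝ =
      Λ (u ((k + 1 : ℕ) * τ)) - Λ (U (k + 1)) := inner_sub_right _ _ _
  have e2 : ∀ j ∈ Finset.range (k + 1), cnKernel α (lam i * τ ^ α) j * L (f ((k + 1 - j : ℕ) * τ)) =
      cnKernel α (lam i * τ ^ α) j * L (f ((((k + 1 : ℕ) : ℝ) - j) * τ)) := by
    intro j hj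
    rw [Nat.cast_sub (Finset.mem_range.1 hj).le]
  rw [e1, hcont, hdisc, Finset.sum_congr rfl e2]
  simp only [Nat.cast_zero, zero_mul]
  exact hest

end FracCN
-- The finite element problem
theorem theorem3p3 (α : ℝ) (hα₀ : 0 < α) (hα₁ : α < 1) :
    ∃ c : ℝ, 0 < c ∧
      ∀ (d : ℕ) (_ : 1 ≤ d) (_ : d ≤ 3) (Ω : Set (FracCN.Space d))
        (_ : FracCN.IsConvexPolygonalDomain Ω) (𝒯 : FracCN.Triangulation Ω)
        (T : ℝ) (_ : 0 < T) (f f' f'' : ℝ → FracCN.L2 Ω)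
        (_ : ContinuousOn f (Set.Icc 0 T)) (_ : ContinuousOn f' (Set.Icc 0 T))
        (_ : MeasureTheory.MemLp f ⊤ (MeasureTheory.volume.restrict (Set.Ioo 0 T)))
        (_ : MeasureTheory.MemLp f' ⊤ (MeasureTheory.volume.restrict (Set.Ioo 0 T)))
        (_ : FracCN.HasWeakTimeDeriv T f f') (_ : FracCN.HasWeakTimeDeriv T f' f'')
        (_ : essSup (FracCN.weightedIntegral α f'')
          (MeasureTheory.volume.restrict (Set.Ioo 0 T)) < ⊤)
        (u : ℝ → FracCN.femSpace 𝒯)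
        (_ : FracCN.IsSemidiscreteSolution 𝒯 α T 0 (fun t => FracCN.l2Projection 𝒯 (f t)) u)
        (N : ℕ) (_ : 1 ≤ N) (τ : ℝ) (_ : τ = T / N) (U : ℕ → FracCN.femSpace 𝒯)
        (_ : FracCN.IsCorrectedCNSolution 𝒯 α τ N 0
          (fun n => FracCN.l2Projection 𝒯 (f (n * τ))) U)
        (n : ℕ) (_ : 1 ≤ n) (_ : n ≤ N),
        FracCN.weightedIntegral α f'' (n * τ) < ⊤ ∧
        ‖u (n * τ) - U n‖ ≤ c * τ ^ 2 *
          ((n * τ) ^ (α - 2) * ‖f 0‖ + (n * τ) ^ (α - 1) * ‖f' 0‖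
            + (FracCN.weightedIntegral α f'' (n * τ)).toReal) := by
  obtain ⟨c, hc, hmain⟩ := FracCN.exists_norm_sub_le hα₀ hα₁
  refine ⟨c, hc, ?_⟩
  intro d _ _ Ω _ 𝒯 T hT f f' f'' hf hf' _ _ hw hw' hess u hu N hN τ hτ U hU n hn hnN
  have hN0 : (0 : ℝ) < N := by exact_mod_cast hN
  have hτ0 : 0 < τ := by rw [hτ]; positivity
  have hNT : N * τ = T := by rw [hτ]; field_simp
  have hn0 : (0 : ℝ) < n := by exact_mod_cast hn
  have hnT : n * τ ≤ T := by
    rw [← hNT]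
    exact mul_le_mul_of_nonneg_right (by exact_mod_cast hnN) hτ0.le
  have hfin : ∀ t, 0 < t → t ≤ T → FracCN.weightedIntegral α f'' t < ⊤ := fun t h0 h1 =>
    (FracCN.weightedIntegral_le_essSup hα₁ h0 h1).trans_lt hess
  -- Finiteness of the weighted integral at t = T upgrades local integrability of f'' to
  -- integrability on (0, T), as Taylor's formula from 0 requires.
  have hi := FracCN.integrableOn_of_weightedIntegral_lt_top hα₁
    hw'.2.1.aestronglyMeasurable (hfin T hT le_rfl)
  have hfn := hfin (n * τ) (by positivity) hnT
  refine ⟨hfn, ?_⟩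
  refine hmain (FracCN.femSpace 𝒯) (FracCN.L2 Ω) (FracCN.discreteLaplacian 𝒯) ?_ ?_
    (FracCN.l2Projection 𝒯) ?_ T hT f f' f'' hf hf' hw hw' hi u hu.initial hu.integrable_deriv
    hu.eq_integral_deriv hu.equation N τ hτ0 hNT.le U hU.initial ?_ ?_ ?_ n hn hnN hfn
  · intro x y
    have h1 := FracCN.discreteLaplacian_spec 𝒯 x y
    have h2 := FracCN.discreteLaplacian_spec 𝒯 y x
    rw [real_inner_comm, real_inner_comm (FracCN.femGradient 𝒯 x)] at h2
    linarith
  · intro x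
    have h1 := FracCN.discreteLaplacian_spec 𝒯 x x
    have h2 : 0 ≤ inner ℝ (FracCN.femGradient 𝒯 x) (FracCN.femGradient 𝒯 x) :=
      real_inner_self_nonneg
    linarith
  · intro x
    exact (FracCN.femSpace 𝒯).norm_orthogonalProjectionOnto_apply_le x
  · intro h
    have := hU.step_one h
    simpa using this
  · intro h
    have := hU.step_two h
    simpa using this
  · intro k hk
    have := hU.step (k + 3) (by omega) hk
    simpa using this
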